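/- Let $N\ge 1$, $0<\sigma<2$, $Q=\mathbb{R}^N\times(0,\infty)$, $\rho(x)=(1+|x|)^{-(N+\sigma)}$, and let $(-\Delta)^{\sigma/2}=\mathcal F^{-1}(|\cdot|^\sigma\mathcal F)$ act in the variable $x$. For $0<\alpha\le\min\{1,\sigma\}$ let $C^\alpha_\sigma(Q)$ be the space of functions $f:Q\to\mathbb{R}$ for which there is a constant $c>0$ with $$|f(x_1,t_1)-f(x_2,t_2)|\le c\,\big(|x_1-x_2|^2+|t_1-t_2|^{2/\sigma}\big)^{\alpha/2}\qquad\text{for all }(x_1,t_1),(x_2,t_2)\in Q.$$ Let $P_\sigma(\cdot,t)$, $t>0$, be the function on $\mathbb{R}^N$ with Fourier transform $\widehat{P_\sigma}(\xi,t)=e^{-|\xi|^\sigma t}$, and let $A_\sigma=(-\Delta)^{\sigma/2}P_\sigma$. A very weak solution of the problem $$\partial_t u+(-\Delta)^{\sigma/2}u=(-\Delta)^{\sigma/2}f\ \text{ in }Q,\qquad u(\cdot,0)=u_0\ \text{ in }\mathbb{R}^N, \tag{1}$$ is a function $u\in C([0,\infty);L^1(\mathbb{R}^N,\rho\,dx))$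 with $u(\cdot,0)=u_0$ almost everywhere and $$\int_0^\infty\!\!\int_{\mathbb{R}^N}u\,\partial_t\zeta\,dx\,dt=\int_0^\infty\!\!\int_{\mathbb{R}^N}(u-f)\,(-\Delta)^{\sigma/2}\zeta\,dx\,dt\qquad\text{for all }\zeta\in C_c^\infty(Q).$$ Theorem. Let $f\in L^\infty_{\rm loc}([0,\infty);L^1(\mathbb{R}^N,\rho\,dx))\cap C^\alpha_\sigma(Q)$ for some $0<\alpha\le\min\{1,\sigma\}$, and let $u_0\in L^p(\mathbb{R}^N)$ for some $1\le p\le\infty$. Then problem (1) has a unique very weak solution $u$. For every $t>0$ it is given, for almost every $x\in\mathbb{R}^N$, by Duhamel's formula $$u(x,t)=\int_{\mathbb{R}^N}P_\sigma(x-y,t)\,u_0(y)\,dy+\int_0^t\Big(\int_{\mathbb{R}^N}A_\sigma(x-y,t-s)\,f(y,s)\,dy\Big)ds,$$ where, for every $(x,t)\in Q$, the first integral, the inner integral for every $0<s<t$, and the integral in $s$ converge absolutely. -/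

import Mathlib

open MeasureTheory Set
open scoped FourierTransform ContDiff NNReal ENNReal

noncomputable section

namespace FractionalHeat

/-- Euclidean space `ℝ^N`. -/
abbrev Space (N : ℕ) : Type := EuclideanSpace ℝ (Fin N)

/-- The space-time domain `Q = ℝ^N × (0,∞)`. -/
def domainQ (N : ℕ) : Set (Space N × ℝ) := {Y | 0 < Y.2}

/-- The fractional Laplacian `(-Δ)^{σ/2} φ = 𝓕⁻¹ (|·|^σ 𝓕 φ)` of a real function on `ℝ^N`.
Mathlib's Fourier transform has the kernel `exp (-2πi ⟨y, ξ⟩)`, so its frequency `ξ` is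
`1 / (2π)` times the one for the kernel `exp (-i ⟨y, ξ⟩)`, and the multiplier `|·|^σ`
becomes `(2π ‖ξ‖)^σ`. -/
def fracLaplacian {N : ℕ} (σ : ℝ) (φ : Space N → ℝ) (x : Space N) : ℝ :=
  (𝓕⁻ (fun ξ : Space N =>
    (((2 * Real.pi * ‖ξ‖) ^ σ : ℝ) : ℂ) * 𝓕 (fun y : Space N => (φ y : ℂ)) ξ) x).re

/-- The kernel `P_σ(x,t)` of the fractional heat equation `∂ₜ u + (-Δ)^{σ/2} u = 0`: the
function whose Fourier transform in `x` is `exp (-|ξ|^σ t)`. -/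
def kernelP {N : ℕ} (σ : ℝ) (x : Space N) (t : ℝ) : ℝ :=
  (𝓕⁻ (fun ξ : Space N => ((Real.exp (-((2 * Real.pi * ‖ξ‖) ^ σ * t)) : ℝ) : ℂ)) x).re

/-- The kernel `A_σ = (-Δ)^{σ/2} P_σ` (the operator acts in the space variable). -/
def kernelA {N : ℕ} (σ : ℝ) (x : Space N) (t : ℝ) : ℝ :=
  fracLaplacian σ (fun y : Space N => kernelP σ y t) x

/-- The size `|Y|_σ = (|x|² + |t|^{2/σ})^{1/2}` of `Y = (x,t)`. -/
def sigmaSize {N : ℕ} (σ : ℝ) (Y : Space N × ℝ) : ℝ :=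
  Real.sqrt (‖Y.1‖ ^ 2 + |Y.2| ^ (2 / σ))

/-- Membership in the Hölder space `C^α_σ(Q)`. -/
def IsSigmaHolder {N : ℕ} (σ α : ℝ) (f : Space N × ℝ → ℝ) : Prop :=
  ∃ c : ℝ, 0 < c ∧ ∀ Y₁ ∈ domainQ N, ∀ Y₂ ∈ domainQ N,
    |f Y₁ - f Y₂| ≤ c * sigmaSize σ (Y₁ - Y₂) ^ α

/-- The measure `ρ dx` on `ℝ^N`, where `ρ(x) = (1 + |x|)^{-(N+σ)}`. -/
def rhoMeasure (N : ℕ) (σ : ℝ) : Measure (Space N) :=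
  volume.withDensity (fun x => ENNReal.ofReal ((1 + ‖x‖) ^ (-((N : ℝ) + σ))))

/-- Membership in `L^∞_loc([0,∞); L^1(ℝ^N, ρ dx))`: `f` is measurable on `Q`, and on every
bounded time interval `(0,T)` the norm of `f(·,t)` in `L^1(ρ dx)` is essentially bounded. -/
def MemLinftyLocL1Rho {N : ℕ} (σ : ℝ) (f : Space N × ℝ → ℝ) : Prop :=
  AEStronglyMeasurable f (volume.restrict (domainQ N)) ∧
    ∀ T : ℝ, 0 < T → ∃ C : ℝ≥0, ∀ᵐ t ∂(volume.restrict (Ioo 0 T)),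
      ∫⁻ x, ‖f (x, t)‖ₑ ∂(rhoMeasure N σ) ≤ C

/-- Test functions `ζ ∈ C_c^∞(Q)`. -/
structure IsTestFunction {N : ℕ} (ζ : Space N × ℝ → ℝ) : Prop where
  smooth : ContDiff ℝ ∞ ζ
  compact : HasCompactSupport ζ
  support : tsupport ζ ⊆ domainQ N

/-- Very weak solutions `u ∈ C([0,∞); L^1(ℝ^N, ρ dx))` of the Cauchy problem
`∂ₜ u + (-Δ)^{σ/2} u = (-Δ)^{σ/2} f` in `Q`, `u(·,0) = u₀`. -/
structure IsVeryWeakSolution {N : ℕ} (σ : ℝ) (f : Space N × ℝ → ℝ) (u₀ : Space N → ℝ)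
    (u : C(ℝ≥0, Lp ℝ 1 (rhoMeasure N σ))) : Prop where
  weak : ∀ ζ : Space N × ℝ → ℝ, IsTestFunction ζ →
    ∫ t in Ioi (0 : ℝ), ∫ x : Space N, u t.toNNReal x * deriv (fun s => ζ (x, s)) t =
      ∫ t in Ioi (0 : ℝ), ∫ x : Space N,
        (u t.toNNReal x - f (x, t)) * fracLaplacian σ (fun y => ζ (y, t)) x
  initial : ∀ᵐ x : Space N, u 0 x = u₀ x

/-- Duhamel's formula. The last term is the iterated integral (first in space, then in
time). -/
def duhamel {N : ℕ} (σ : ℝ) (f : Space N × ℝ → ℝ) (u₀ : Space N → ℝ)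
    (x : Space N) (t : ℝ) : ℝ :=
  (∫ y : Space N, kernelP σ (x - y) t * u₀ y) +
    ∫ s in (0 : ℝ)..t, ∫ y : Space N, kernelA σ (x - y) (t - s) * f (y, s)

/-- All the integrals in Duhamel's formula at the point `(x,t)` converge. -/
structure DuhamelWellDefined {N : ℕ} (σ : ℝ) (f : Space N × ℝ → ℝ) (u₀ : Space N → ℝ)
    (x : Space N) (t : ℝ) : Prop where
  data : Integrable (fun y : Space N => kernelP σ (x - y) t * u₀ y)
  source_space : ∀ s ∈ Ioo 0 t,
    Integrable (fun y : Space N => kernelA σ (x - y) (t - s) * f (y, s))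
  source_time : IntervalIntegrable
    (fun s => ∫ y : Space N, kernelA σ (x - y) (t - s) * f (y, s)) volume 0 t

end FractionalHeat

end

open FractionalHeat

/-! Everything is measured against `ρ(x) = (1 + |x|)^{-(N+σ)}`. This weight gives the decay of the
kernels: with `s = t^{1/σ}`, `|P_σ(x,t)| ≤ C s^{-N} ρ(x/s)` and `|A_σ(x,t)| ≤ C t^{-1} s^{-N}
ρ(x/s)`. It is also stable under convolution, `ρ * ρ ≤ C ρ`. Hence functions of size `O(ρ)` pair
with `L¹(ρ dx)`, and convolution with an even kernel of size `O(ρ)` is bounded and symmetric there.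

The kernel decay comes from the singularity `|ξ|^σ` of the symbols at the origin
(`exists_fourier_bound`). Only the unit sphere needs an estimate, with a constant linear in the size
of the singularity; dilating the symbol does the rest. The same estimate, applied to `r^b
(1+r)^{-k}` with `r = |2πξ|²`, shows that `(-Δ)^b φ = O(ρ)` for test functions `φ` and `b ≥ σ/2`
(`exists_fracPow_seminorm_bound`). So `e^{-t(-Δ)^{σ/2}} φ` and its image under `(-Δ)^{σ/2}` can be
paired with `L¹(ρ dx)`, uniformly for bounded `t`.

The delicate term is the source. The `L¹` norm of `A_σ(·,τ)` is of order `τ^{-1}`, which is not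
integrable at `τ = 0`. But `∫ A_σ(·,τ) = 0`, so `f(y)` may be replaced by `f(y) - f(x)`. For `|x -
y| ≤ 1` the Hölder condition and the moment of order `α/2` give `τ^{α/(2σ)-1}`, which is integrable;
for `|x - y| ≥ 1` one has `|A_σ| ≤ C ρ` uniformly in `τ`. The resulting bound holds pointwise, so
the integrals converge, and in `L¹(ρ dx)`, so the curve is continuous (`exists_abs_conv_symA_le`,
`exists_rhoNorm_conv_symA_le`).

Existence: in Duhamel's formula tested with `φ`, symmetry moves the kernels onto `φ`. The identity
`φ - e^{-t(-Δ)^{σ/2}} φ = ∫_0^t (-Δ)^{σ/2} e^{-r(-Δ)^{σ/2}} φ dr` and Fubini on a triangle then give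
the equation integrated in time (`IsSource.integral_srcEvol_mul_test`). General space-time test
functions follow from the chain rule on a diagonal (`weak_of_integral_mul_eq`).

Uniqueness: a difference `w` of two solutions solves the homogeneous equation, and `s ↦ ∫ w(s)
e^{-(t-s)(-Δ)^{σ/2}} φ` is constant, zero at `s = 0` and `∫ w(t) φ` at `s = t`. The evolved `φ` is
not compactly supported, but it is an average of translates of `φ`, each of which may be used as a
test function (`integral_mul_heatMul_eq`, `eq_zero_of_integral_mul_eq`). -/

namespace FractionalHeat

open Filter Topology

/-! ### The weight -/

/-- The weight `ρ(x) = (1 + |x|)^{-(N+σ)}`. -/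
noncomputable def rho {N : ℕ} (σ : ℝ) (x : Space N) : ℝ := (1 + ‖x‖) ^ (-((N : ℝ) + σ))

section weight
variable {N : ℕ} {σ : ℝ}

lemma rho_pos (x : Space N) : 0 < rho σ x := Real.rpow_pos_of_pos (by positivity) _

lemma rho_nonneg (x : Space N) : 0 ≤ rho σ x := (rho_pos x).le

lemma rho_le_one (hσ : 0 < σ) (x : Space N) : rho σ x ≤ 1 :=
  Real.rpow_le_one_of_one_le_of_nonpos (by linarith [norm_nonneg x])
    (by have : (0 : ℝ) ≤ N := N.cast_nonneg
        linarith)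

lemma continuous_rho : Continuous (rho σ : Space N → ℝ) := by
  unfold rho
  refine Continuous.rpow_const (by fun_prop) fun x => Or.inl ?_
  positivity

lemma rho_neg (x : Space N) : rho σ (-x) = rho σ x := by simp [rho]

lemma integrable_rho (hσ : 0 < σ) : Integrable (rho σ : Space N → ℝ) := by
  refine integrable_one_add_norm ?_
  simp only [finrank_euclideanSpace, Fintype.card_fin]
  linarith

/-- Peetre's inequality. -/
lemma rho_sub_le (hσ : 0 < σ) (x y : Space N) :
    rho σ (x - y) ≤ (1 + ‖y‖) ^ ((N : ℝ) + σ) * rho σ x := by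
  have hd : 0 ≤ (N : ℝ) + σ := by positivity
  unfold rho
  rw [Real.rpow_neg (by positivity), Real.rpow_neg (by positivity), ← div_eq_mul_inv,
    inv_eq_one_div, div_le_div_iff₀ (by positivity) (by positivity), one_mul,
    ← Real.mul_rpow (by positivity) (by positivity)]
  refine Real.rpow_le_rpow (by positivity) ?_ hd
  have : ‖x‖ ≤ ‖x - y‖ + ‖y‖ := by simpa using norm_add_le (x - y) y
  nlinarith [norm_nonneg (x - y), norm_nonneg y, mul_nonneg (norm_nonneg y) (norm_nonneg (x - y))]

lemma rho_le_of_half (hσ : 0 < σ) {x y : Space N} (h : ‖x‖ ≤ 2 * ‖y‖) :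
    rho σ y ≤ 2 ^ ((N : ℝ) + σ) * rho σ x := by
  have hd : 0 ≤ (N : ℝ) + σ := by positivity
  unfold rho
  rw [Real.rpow_neg (by positivity), Real.rpow_neg (by positivity), ← div_eq_mul_inv,
    inv_eq_one_div, div_le_div_iff₀ (by positivity) (by positivity), one_mul,
    ← Real.mul_rpow (by positivity) (by positivity)]
  exact Real.rpow_le_rpow (by positivity) (by linarith [norm_nonneg x]) hd

/-- At least one of `y`, `x - y` has norm `≥ ‖x‖ / 2`, and the weight at that point is at most
`2^{N+σ} ρ(x)`. Integrating in `y` gives `ρ * ρ ≤ C ρ`. -/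
lemma rho_mul_rho_le (hσ : 0 < σ) (x y : Space N) :
    rho σ (x - y) * rho σ y ≤ 2 ^ ((N : ℝ) + σ) * rho σ x * (rho σ (x - y) + rho σ y) := by
  have h1 := rho_nonneg (σ := σ) (x - y)
  have h2 := rho_nonneg (σ := σ) y
  have h3 := rho_nonneg (σ := σ) x
  have h4 : (0:ℝ) ≤ 2 ^ ((N : ℝ) + σ) := by positivity
  rcases le_total ‖x‖ (2 * ‖y‖) with h | h
  · calc _ ≤ rho σ (x - y) * (2 ^ ((N : ℝ) + σ) * rho σ x) := by
          gcongr; exact rho_le_of_half hσ h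
      _ ≤ _ := by nlinarith [mul_nonneg (mul_nonneg h4 h3) h2]
  · have h' : ‖x‖ ≤ 2 * ‖x - y‖ := by
      have : ‖x‖ ≤ ‖x - y‖ + ‖y‖ := by simpa using norm_add_le (x - y) y
      linarith
    calc _ ≤ (2 ^ ((N : ℝ) + σ) * rho σ x) * rho σ y := by
          gcongr; exact rho_le_of_half hσ h'
      _ ≤ _ := by nlinarith [mul_nonneg (mul_nonneg h4 h3) h1]

lemma integrable_rho_mul_rho (hσ : 0 < σ) (x : Space N) :
    Integrable (fun y : Space N => rho σ (x - y) * rho σ y) := by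
  refine (((integrable_rho hσ).comp_sub_left x).add (integrable_rho hσ)).const_mul
    (2 ^ ((N : ℝ) + σ) * rho σ x) |>.mono'
    ((continuous_rho.comp (by fun_prop)).mul continuous_rho).aestronglyMeasurable ?_
  refine .of_forall fun y => ?_
  rw [Real.norm_of_nonneg (mul_nonneg (rho_nonneg _) (rho_nonneg _))]
  exact rho_mul_rho_le hσ x y

/-- The constant of the inequality `ρ * ρ ≤ C ρ`. -/
noncomputable def rhoConst (N : ℕ) (σ : ℝ) : ℝ :=
  2 ^ ((N : ℝ) + σ) * (2 * ∫ y : Space N, rho σ y)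

lemma rhoConst_nonneg : 0 ≤ rhoConst N σ := by
  unfold rhoConst
  have : 0 ≤ ∫ y : Space N, rho σ y := integral_nonneg fun y => rho_nonneg y
  positivity

lemma integral_rho_mul_rho_le (hσ : 0 < σ) (x : Space N) :
    ∫ y : Space N, rho σ (x - y) * rho σ y ≤ rhoConst N σ * rho σ x := by
  have hi := integrable_rho (N := N) hσ
  calc _ ≤ ∫ y : Space N, 2 ^ ((N : ℝ) + σ) * rho σ x * (rho σ (x - y) + rho σ y) :=
        integral_mono (integrable_rho_mul_rho hσ x)
          (((hi.comp_sub_left x).add hi).const_mul _) fun y => rho_mul_rho_le hσ x y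
    _ = _ := by
        rw [integral_const_mul, integral_add (hi.comp_sub_left x) hi,
          integral_sub_left_eq_self (fun y => rho σ y) volume x]
        unfold rhoConst
        ring

end weight

/-! ### One-dimensional symbols -/

section symbols

open Real

/-- `|f^{(j)}(r)| ≤ C_j r^{s-j} (1+r)^{-k}` for `r > 0` -/
def DerivBound (f : ℝ → ℝ) (j : ℕ) (s k : ℝ) : Prop :=
  ∃ C : ℝ, ∀ r : ℝ, 0 < r →
    |iteratedDerivWithin j f (Ioi 0) r| ≤ C * (r ^ (s - j) * (1 + r) ^ (-k))

lemma DerivBound.mono_const {f : ℝ → ℝ} {j : ℕ} {s k : ℝ} (h : DerivBound f j s k) :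
    ∃ C : ℝ, 0 ≤ C ∧ ∀ r : ℝ, 0 < r →
      |iteratedDerivWithin j f (Ioi 0) r| ≤ C * (r ^ (s - j) * (1 + r) ^ (-k)) := by
  obtain ⟨C, hC⟩ := h
  refine ⟨|C|, abs_nonneg _, fun r hr => (hC r hr).trans ?_⟩
  gcongr
  exact le_abs_self C

/-- The derivative of `r^a exp(-r^β)` or `r^a (1+r)^{-k}` is a combination of two functions of the
same family. This lemma turns that remark into an induction on the order, without formulas for
higher derivatives. -/
lemma DerivBound.succ {f g h : ℝ → ℝ} {a b s k : ℝ} {j : ℕ}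
    (hf : ∀ r : ℝ, 0 < r → HasDerivAt f (a * g r + b * h r) r)
    (hg' : ContDiffOn ℝ ∞ g (Ioi 0)) (hh' : ContDiffOn ℝ ∞ h (Ioi 0))
    (hg : DerivBound g j (s - 1) k) (hh : DerivBound h j (s - 1) k) :
    DerivBound f (j + 1) s k := by
  obtain ⟨C, hC⟩ := hg
  obtain ⟨C', hC'⟩ := hh
  refine ⟨|a| * C + |b| * C', fun r hr => ?_⟩
  have hu : UniqueDiffOn ℝ (Ioi (0:ℝ)) := uniqueDiffOn_Ioi 0
  have e : EqOn (derivWithin f (Ioi 0)) (fun r => a * g r + b * h r) (Ioi 0) := fun r hr =>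
    ((hf r hr).hasDerivWithinAt).derivWithin (hu r hr)
  have hr' : r ∈ Ioi (0 : ℝ) := hr
  have hgj := ((hg' r hr).of_le (m := j) (by exact_mod_cast le_top))
  have hhj := ((hh' r hr).of_le (m := j) (by exact_mod_cast le_top))
  rw [iteratedDerivWithin_succ', iteratedDerivWithin_congr e hr',
    iteratedDerivWithin_fun_add hr' hu (contDiffWithinAt_const.mul hgj)
      (contDiffWithinAt_const.mul hhj),
    iteratedDerivWithin_const_mul hr' hu _ hgj, iteratedDerivWithin_const_mul hr' hu _ hhj]
  have e2 : s - ((j + 1 : ℕ) : ℝ) = s - 1 - j := by push_cast; ring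
  rw [e2]
  calc _ ≤ |a| * |iteratedDerivWithin j g (Ioi 0) r| + |b| * |iteratedDerivWithin j h (Ioi 0) r| := by
        rw [← abs_mul, ← abs_mul]; exact abs_add_le _ _
    _ ≤ |a| * (C * (r ^ (s - 1 - j) * (1 + r) ^ (-k)))
        + |b| * (C' * (r ^ (s - 1 - j) * (1 + r) ^ (-k))) := by
        gcongr
        · exact hC r hr
        · exact hC' r hr
    _ = _ := by ring

/-- Up to the shift by `j`, `s` is the exponent at the origin and `s - k` the exponent at infinity.
The bound may be relaxed at both ends, since `r ≤ 1 + r`. -/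
lemma DerivBound.weaken {f : ℝ → ℝ} {j : ℕ} {s k s' k' : ℝ} (h : DerivBound f j s k)
    (h1 : s' ≤ s) (h2 : s + k' ≤ s' + k) : DerivBound f j s' k' := by
  obtain ⟨C, hC0, hC⟩ := h.mono_const
  refine ⟨C, fun r hr => (hC r hr).trans ?_⟩
  gcongr ?_ * ?_
  have e : r ^ (s - j) * (1 + r) ^ (-k) = r ^ (s' - j) * (r ^ (s - s') * (1 + r) ^ (-k)) := by
    rw [← mul_assoc, ← Real.rpow_add hr]; ring_nf
  rw [e]
  gcongr
  calc r ^ (s - s') * (1 + r) ^ (-k) ≤ (1 + r) ^ (s - s') * (1 + r) ^ (-k) := by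
        gcongr
        linarith
    _ = (1 + r) ^ (s - s' - k) := by rw [← Real.rpow_add (by linarith)]; ring_nf
    _ ≤ _ := Real.rpow_le_rpow_of_exponent_le (by linarith) (by linarith)

/-- The symbol `r^a exp (-r^β)`. -/
noncomputable def expSym (β a : ℝ) (r : ℝ) : ℝ := r ^ a * Real.exp (-r ^ β)

/-- The symbol `r^a (1+r)^{-k}`. -/
noncomputable def powSym (a k : ℝ) (r : ℝ) : ℝ := r ^ a * (1 + r) ^ (-k)

lemma contDiffOn_rpow_Ioi (a : ℝ) : ContDiffOn ℝ ∞ (fun r : ℝ => r ^ a) (Ioi 0) :=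
  fun _ hr => (Real.contDiffAt_rpow_const_of_ne (ne_of_gt hr)).contDiffWithinAt

lemma contDiffOn_expSym (β a : ℝ) : ContDiffOn ℝ ∞ (expSym β a) (Ioi 0) :=
  (contDiffOn_rpow_Ioi a).mul (Real.contDiff_exp.comp_contDiffOn (contDiffOn_rpow_Ioi β).neg)

lemma contDiffOn_powSym (a k : ℝ) : ContDiffOn ℝ ∞ (powSym a k) (Ioi 0) := by
  refine (contDiffOn_rpow_Ioi a).mul ?_
  exact (contDiffOn_rpow_Ioi (-k)).comp (contDiffOn_const.add contDiffOn_id)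
    fun r (hr : 0 < r) => show (0:ℝ) < 1 + r by linarith

lemma exists_exp_neg_rpow_le {β : ℝ} (hβ : 0 < β) (k : ℝ) :
    ∃ C : ℝ, ∀ r : ℝ, 0 < r → Real.exp (-r ^ β) ≤ C * (1 + r) ^ (-k) := by
  obtain ⟨n, hn⟩ := exists_nat_ge (|k| / β)
  have hk : k ≤ β * n := by
    have := (div_le_iff₀ hβ).1 hn
    linarith [le_abs_self k]
  refine ⟨2 ^ (β * n) * (Real.exp 1 * n.factorial), fun r hr => ?_⟩
  have h1 : (1 + r) ^ (β * n) ≤ 2 ^ (β * n) * (Real.exp 1 * n.factorial * Real.exp (r ^ β)) := by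
    have h2 : (1 + r) ≤ 2 * max 1 r := by
      have := le_max_left 1 r; have := le_max_right 1 r; linarith
    have h3 : (max 1 r) ^ (β * n) ≤ Real.exp 1 * n.factorial * Real.exp (r ^ β) := by
      have h4 : (max 1 r) ^ β ≤ 1 + r ^ β := by
        rcases le_total 1 r with h | h
        · rw [max_eq_right h]; linarith
        · rw [max_eq_left h, Real.one_rpow]; linarith [Real.rpow_nonneg hr.le β]
      have h5 := Real.pow_div_factorial_le_exp (1 + r ^ β)
        (by linarith [Real.rpow_nonneg hr.le β]) n
      rw [div_le_iff₀ (by positivity), Real.exp_add] at h5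
      rw [Real.rpow_mul (by positivity), Real.rpow_natCast]
      calc _ ≤ (1 + r ^ β) ^ n := by gcongr
        _ ≤ _ := by linarith
    calc (1 + r) ^ (β * n) ≤ (2 * max 1 r) ^ (β * n) := by gcongr
      _ = 2 ^ (β * n) * (max 1 r) ^ (β * n) := Real.mul_rpow (by norm_num) (by positivity)
      _ ≤ _ := by gcongr
  have h6 : (1 + r) ^ k ≤ (1 + r) ^ (β * n) :=
    Real.rpow_le_rpow_of_exponent_le (by linarith) hk
  rw [Real.rpow_neg (by linarith), Real.exp_neg, ← div_eq_mul_inv, inv_eq_one_div,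
    div_le_div_iff₀ (by positivity) (by positivity), one_mul]
  calc _ ≤ _ := h6.trans h1
    _ = _ := by ring

lemma derivBound_expSym {β : ℝ} (hβ : 0 < β) (j : ℕ) (a k : ℝ) :
    DerivBound (expSym β a) j a k := by
  induction j generalizing a k with
  | zero =>
    obtain ⟨C, hC⟩ := exists_exp_neg_rpow_le hβ k
    refine ⟨C, fun r hr => ?_⟩
    rw [iteratedDerivWithin_zero, expSym, abs_of_nonneg (by positivity)]
    simp only [Nat.cast_zero, sub_zero]
    calc _ ≤ r ^ a * (C * (1 + r) ^ (-k)) := by gcongr; exact hC r hr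
      _ = _ := by ring
  | succ j ih =>
    -- The second summand has exponent `a + β - 1` at the origin. Taking it with the better decay `k
    -- + β` makes it comparable with the first.
    refine DerivBound.succ (a := a) (b := -β) (g := expSym β (a - 1))
      (h := expSym β (a + β - 1)) (fun r hr => ?_) (contDiffOn_expSym _ _)
      (contDiffOn_expSym _ _) (ih _ _) ((ih _ (k + β)).weaken (by linarith) (by linarith))
    have h1 := Real.hasDerivAt_rpow_const (p := a) (Or.inl hr.ne')
    have h2 : HasDerivAt (fun r => Real.exp (-r ^ β)) (Real.exp (-r ^ β) * -(β * r ^ (β - 1))) r :=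
      (Real.hasDerivAt_rpow_const (p := β) (Or.inl hr.ne')).neg.exp
    refine (h1.mul h2).congr_deriv ?_
    simp only [expSym]
    have : r ^ (a + β - 1) = r ^ a * r ^ (β - 1) := by
      rw [← Real.rpow_add hr]; ring_nf
    rw [this]
    ring

lemma derivBound_powSym (j : ℕ) (a k : ℝ) : DerivBound (powSym a k) j a k := by
  induction j generalizing a k with
  | zero =>
    refine ⟨1, fun r hr => ?_⟩
    rw [iteratedDerivWithin_zero, powSym, abs_of_nonneg (by positivity)]
    simp
  | succ j ih =>
    refine DerivBound.succ (a := a) (b := -k) (g := powSym (a - 1) k)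
      (h := powSym a (k + 1)) (fun r hr => ?_) (contDiffOn_powSym _ _)
      (contDiffOn_powSym _ _) (ih _ _) ((ih _ _).weaken (by linarith) (by linarith))
    have h1 := Real.hasDerivAt_rpow_const (p := a) (Or.inl hr.ne')
    have h2 : HasDerivAt (fun r => (1 + r) ^ (-k)) (1 * -k * (1 + r) ^ (-k - 1)) r :=
      ((hasDerivAt_id' r).const_add 1).rpow_const (p := -k) (Or.inl (by positivity))
    refine (h1.mul h2).congr_deriv ?_
    simp only [powSym]
    have : -(k + 1) = -k - 1 := by ring
    rw [this]
    ring

/-- `r^j |H^{(j)}(r)| ≤ w(r)` for `r > 0` and `j ≤ n`. -/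
def RadBound (n : ℕ) (w : ℝ → ℝ) (H : ℝ → ℝ) : Prop :=
  ∀ j ≤ n, ∀ r : ℝ, 0 < r → r ^ j * |iteratedDerivWithin j H (Ioi 0) r| ≤ w r

/-- Bounds on a symbol that behaves like `c₀ + O(r^β)` near `0` and like `r^{-M}` at infinity. -/
structure IsSymbol (n : ℕ) (β M c₀ B B' : ℝ) (H : ℝ → ℝ) : Prop where
  smooth : ContDiffOn ℝ ∞ H (Ioi 0)
  near : RadBound n (fun r => B * r ^ β) (fun r => H r - c₀)
  far : RadBound n (fun r => B' * (1 + r) ^ (-M)) H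

lemma exists_radBound_of_derivBound {n : ℕ} {H : ℝ → ℝ} {a k : ℝ}
    (h : ∀ j ≤ n, DerivBound H j a k) :
    ∃ B, 0 ≤ B ∧ RadBound n (fun r => B * (r ^ a * (1 + r) ^ (-k))) H := by
  choose! C hC using h
  refine ⟨∑ j ∈ Finset.range (n + 1), |C j|, Finset.sum_nonneg fun _ _ => abs_nonneg _,
    fun j hj r hr => ?_⟩
  have h1 : |C j| ≤ ∑ j ∈ Finset.range (n + 1), |C j| :=
    Finset.single_le_sum (f := fun j => |C j|) (fun _ _ => abs_nonneg _)
      (Finset.mem_range.2 (by omega))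
  calc _ ≤ r ^ j * (C j * (r ^ (a - j) * (1 + r) ^ (-k))) :=
        mul_le_mul_of_nonneg_left (hC j hj r hr) (by positivity)
    _ = C j * (r ^ a * (1 + r) ^ (-k)) := by
        rw [Real.rpow_sub hr, Real.rpow_natCast]; field_simp
    _ ≤ _ := mul_le_mul_of_nonneg_right ((le_abs_self _).trans h1) (by positivity)

lemma exists_isSymbol_of_derivBound {n : ℕ} {H : ℝ → ℝ} {β M a k : ℝ}
    (hs : ContDiffOn ℝ ∞ H (Ioi 0)) (h : ∀ j ≤ n, DerivBound H j a k) (hβ0 : 0 ≤ β) (hβ : β ≤ a) (ha : 0 ≤ a)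
    (hM : a + M ≤ k) (hM0 : 0 ≤ M) : ∃ B B', 0 ≤ B ∧ 0 ≤ B' ∧ IsSymbol n β M 0 B B' H := by
  obtain ⟨B, hB, h1⟩ := exists_radBound_of_derivBound
    fun j hj => (h j hj).weaken (k' := 0) hβ (by linarith)
  obtain ⟨B', hB', h2⟩ := exists_radBound_of_derivBound
    fun j hj => (h j hj).weaken (s' := 0) (k' := M) ha (by linarith)
  exact ⟨B, B', hB, hB', hs, by simpa using h1, by simpa using h2⟩

/-- The symbol of `P_σ` tends to `1`, not to `0`, at the origin, which is why the constant `c₀` is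
subtracted in `IsSymbol`. The order zero bound is `1 - y ≤ e^{-y}`; higher derivatives are those of
`-β r^{β-1} exp(-r^β)`. -/
lemma exists_isSymbol_expSym_zero {β : ℝ} (hβ : 0 < β) (n : ℕ) (M : ℝ) :
    ∃ B B', 0 ≤ B ∧ 0 ≤ B' ∧ IsSymbol n β M 1 B B' (expSym β 0) := by
  obtain ⟨B', hB', h2⟩ := exists_radBound_of_derivBound (n := n) (a := 0) (k := M)
    fun j _ => derivBound_expSym hβ j 0 M
  obtain ⟨B, hB, h1⟩ := exists_radBound_of_derivBound (n := n) (a := β - 1) (k := 0)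
    fun j _ => derivBound_expSym hβ j (β - 1) 0
  refine ⟨max 1 (β * B), B', by positivity, hB', contDiffOn_expSym _ _, ?_, by simpa using h2⟩
  intro j hj r hr
  have hr' : r ∈ Ioi (0 : ℝ) := hr
  rcases j with _ | j
  · simp only [pow_zero, iteratedDerivWithin_zero, one_mul, expSym, Real.rpow_zero]
    have h3 := Real.one_sub_le_exp_neg (r ^ β)
    have h4 : Real.exp (-r ^ β) ≤ 1 := Real.exp_le_one_iff.2 (by simpa using Real.rpow_nonneg hr.le β)
    rw [abs_of_nonpos (by linarith)]
    have h5 : 1 * r ^ β ≤ max 1 (β * B) * r ^ β := by gcongr; exact le_max_left _ _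
    linarith
  · have hu : UniqueDiffOn ℝ (Ioi (0:ℝ)) := uniqueDiffOn_Ioi 0
    have e : EqOn (derivWithin (fun r => expSym β 0 r - 1) (Ioi 0))
        (fun r => -β * expSym β (β - 1) r) (Ioi 0) := by
      intro r hr
      refine (HasDerivAt.hasDerivWithinAt ?_).derivWithin (hu r hr)
      have h2 : HasDerivAt (fun r => Real.exp (-r ^ β) - 1)
          (Real.exp (-r ^ β) * -(β * r ^ (β - 1))) r :=
        ((Real.hasDerivAt_rpow_const (p := β) (Or.inl (ne_of_gt hr))).neg.exp).sub_const 1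
      have h3 : (fun r => expSym β 0 r - 1) = fun r => Real.exp (-r ^ β) - 1 := by
        funext r; simp [expSym]
      rw [h3]
      refine h2.congr_deriv ?_
      simp only [expSym]; ring
    rw [iteratedDerivWithin_succ', iteratedDerivWithin_congr e hr',
      iteratedDerivWithin_const_mul hr' hu _
        ((contDiffOn_expSym β (β - 1) r hr).of_le (by exact_mod_cast le_top)), abs_mul, abs_neg,
      abs_of_pos hβ]
    have h3 := h1 j (by omega) r hr
    simp only [neg_zero, Real.rpow_zero, mul_one] at h3
    calc _ = β * r * (r ^ j * |iteratedDerivWithin j (expSym β (β - 1)) (Ioi 0) r|) := by ring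
      _ ≤ β * r * (B * r ^ (β - 1)) := mul_le_mul_of_nonneg_left h3 (by positivity)
      _ = β * B * r ^ β := by rw [Real.rpow_sub_one hr.ne']; field_simp
      _ ≤ _ := mul_le_mul_of_nonneg_right (le_max_right _ _) (by positivity)

/-- The quantities `r^j H^{(j)}(r)` are invariant under dilation, so only the weights on the right
change. The constant at the origin scales exactly by `c^β`, which will produce the decay of the
kernel. The loss in `B'` is harmless, because `B'` is only used to ensure integrability. -/
lemma IsSymbol.scale {n : ℕ} {β M c₀ B B' c : ℝ} {H : ℝ → ℝ} (h : IsSymbol n β M c₀ B B' H)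
    (hB' : 0 ≤ B') (hM : 0 ≤ M) (hc : 0 < c) :
    IsSymbol n β M c₀ (B * c ^ β) (B' * (min 1 c) ^ (-M)) (fun r => H (c * r)) := by
  have hmaps : MapsTo (c * ·) (Ioi (0:ℝ)) (Ioi 0) := fun r hr => mul_pos hc hr
  have hu : UniqueDiffOn ℝ (Ioi (0:ℝ)) := uniqueDiffOn_Ioi 0
  have key : ∀ G : ℝ → ℝ, ContDiffOn ℝ ∞ G (Ioi 0) → ∀ j : ℕ, ∀ r : ℝ, 0 < r →
      r ^ j * |iteratedDerivWithin j (fun r => G (c * r)) (Ioi 0) r| =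
        (c * r) ^ j * |iteratedDerivWithin j G (Ioi 0) (c * r)| := by
    intro G hG j r hr
    have hr' : r ∈ Ioi (0 : ℝ) := hr
    rw [iteratedDerivWithin_comp_const_smul hr' hu (hG.of_le (by exact_mod_cast le_top)) c hmaps,
      smul_eq_mul, abs_mul, abs_of_pos (pow_pos hc j), mul_pow]
    ring
  refine ⟨h.smooth.comp (contDiffOn_const.mul contDiffOn_id) hmaps, fun j hj r hr => ?_,
    fun j hj r hr => ?_⟩
  · rw [key (fun r => H r - c₀) (h.smooth.sub contDiffOn_const) j r hr]
    refine (h.near j hj (c * r) (by positivity)).trans (le_of_eq ?_)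
    simp only
    rw [Real.mul_rpow hc.le hr.le]
    ring
  · rw [key H h.smooth j r hr]
    refine (h.far j hj (c * r) (by positivity)).trans ?_
    have hm : 0 < min 1 c := by positivity
    simp only
    rw [mul_assoc, ← Real.mul_rpow hm.le (by linarith)]
    refine mul_le_mul_of_nonneg_left ?_ hB'
    refine Real.rpow_le_rpow_of_nonpos (by positivity) ?_ (by linarith)
    have h1 := min_le_left 1 c
    have h2 := min_le_right 1 c
    nlinarith

end symbols

/-! ### Radial symbols and the decay of their inverse Fourier transforms. -/

section radial
variable {N : ℕ}

open Real

/-- The function is quadratic, so its derivatives stop at order two. The geometric form `D^i` of the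
bound is what the estimate for derivatives of a composition requires. -/
lemma norm_iteratedFDeriv_normSq_le {x : Space N} (hx : x ≠ 0) (i : ℕ) (hi : 1 ≤ i) :
    ‖iteratedFDeriv ℝ i (fun y : Space N => (‖x‖ ^ 2)⁻¹ * ‖y‖ ^ 2) x‖ ≤ (2 / ‖x‖) ^ i := by
  have hx0 : 0 < ‖x‖ := norm_pos_iff.2 hx
  have e1 : fderiv ℝ (fun y : Space N => (‖x‖ ^ 2)⁻¹ * ‖y‖ ^ 2) =
      fun y => ((‖x‖ ^ 2)⁻¹ * 2) • innerSL ℝ y := by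
    funext y
    have h : DifferentiableAt ℝ (fun y : Space N => ‖y‖ ^ 2) y :=
      (contDiff_norm_sq ℝ (n := 1)).differentiable (by norm_num) y
    rw [fderiv_const_mul h, fderiv_norm_sq_apply, mul_smul]
    norm_num [two_smul]
  have e2 : fderiv ℝ (fun y : Space N => ((‖x‖ ^ 2)⁻¹ * 2) • innerSL ℝ y) =
      fun _ => ((‖x‖ ^ 2)⁻¹ * 2) • (innerSL ℝ (E := Space N)) := by
    funext y
    exact (((‖x‖ ^ 2)⁻¹ * 2) • (innerSL ℝ (E := Space N))).hasFDerivAt.fderiv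
  match i, hi with
  | 1, _ =>
    rw [← norm_iteratedFDeriv_fderiv, e1, norm_iteratedFDeriv_zero, norm_smul, innerSL_apply_norm,
      Real.norm_of_nonneg (by positivity)]
    apply le_of_eq
    field_simp
  | 2, _ =>
    rw [← norm_iteratedFDeriv_fderiv, e1, ← norm_iteratedFDeriv_fderiv, e2,
      norm_iteratedFDeriv_zero, norm_smul, Real.norm_of_nonneg (by positivity)]
    calc _ ≤ (‖x‖ ^ 2)⁻¹ * 2 * 1 := by gcongr; exact norm_innerSL_le _
      _ ≤ (2 / ‖x‖) ^ 2 := by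
        rw [div_pow, mul_one, inv_mul_eq_div]; gcongr; norm_num
  | i + 3, _ =>
    rw [← norm_iteratedFDeriv_fderiv, e1, ← norm_iteratedFDeriv_fderiv, e2,
      iteratedFDeriv_succ_const]
    simp only [Pi.zero_apply, norm_zero]
    positivity

/-- The radial function `ξ ↦ H(|2πξ|²)`. -/
noncomputable def radFun (H : ℝ → ℝ) (ξ : Space N) : ℝ := H ((2 * π * ‖ξ‖) ^ 2)

lemma contDiffOn_radFun {H : ℝ → ℝ} (hH : ContDiffOn ℝ ∞ H (Ioi 0)) :
    ContDiffOn ℝ ∞ (radFun H : Space N → ℝ) {0}ᶜ := by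
  have h : ContDiff ℝ ∞ (fun ξ : Space N => (2 * π * ‖ξ‖) ^ 2) := by
    simp_rw [mul_pow]
    exact contDiff_const.mul (contDiff_norm_sq ℝ)
  refine hH.comp h.contDiffOn fun ξ hξ => ?_
  have : 0 < ‖ξ‖ := norm_pos_iff.2 hξ
  show (0 : ℝ) < (2 * π * ‖ξ‖) ^ 2
  positivity

/-- With `r₀ = |2πξ|²`, the symbol is `u ↦ H(r₀ u)` composed with `y ↦ |y|²/|ξ|²`, whose value at
`ξ` is `1`. The outer derivatives at `1` are `r₀^j H^{(j)}(r₀)`, exactly the quantities in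
`RadBound`. The variable `|2πξ|²` is preferred to `|2πξ|` because the inner function is then a
polynomial. -/
lemma norm_iteratedFDeriv_radFun_le {H w : ℝ → ℝ} {n : ℕ} (hH : ContDiffOn ℝ ∞ H (Ioi 0))
    (hw : RadBound n w H) {q : ℕ} (hq : q ≤ n) {ξ : Space N} (hξ : ξ ≠ 0) :
    ‖iteratedFDeriv ℝ q (radFun H) ξ‖ ≤
      q.factorial * w ((2 * π * ‖ξ‖) ^ 2) * (2 / ‖ξ‖) ^ q := by
  have hx0 : 0 < ‖ξ‖ := norm_pos_iff.2 hξ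
  set r₀ := (2 * π * ‖ξ‖) ^ 2 with hr₀
  have hr₀p : 0 < r₀ := by positivity
  have hu : UniqueDiffOn ℝ (Ioi (0:ℝ)) := uniqueDiffOn_Ioi 0
  have ho : IsOpen ({0}ᶜ : Set (Space N)) := isOpen_compl_singleton
  have hmaps : MapsTo (r₀ * ·) (Ioi (0:ℝ)) (Ioi 0) := fun r hr => mul_pos hr₀p hr
  set f : Space N → ℝ := fun y => (‖ξ‖ ^ 2)⁻¹ * ‖y‖ ^ 2 with hf
  have hfs : ContDiff ℝ ∞ f := contDiff_const.mul (contDiff_norm_sq ℝ)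
  have e : (radFun H : Space N → ℝ) = (fun u => H (r₀ * u)) ∘ f := by
    funext y
    simp only [radFun, Function.comp, hf, hr₀]
    congr 1
    field_simp
  have hfx : f ξ = 1 := by simp only [hf]; field_simp
  rw [e, ← iteratedFDerivWithin_of_isOpen q ho hξ]
  refine norm_iteratedFDerivWithin_comp_le (N := ∞) (t := Ioi 0) (g := fun u => H (r₀ * u))
    (hH.comp (contDiffOn_const.mul contDiffOn_id) hmaps) hfs.contDiffOn
    (by exact_mod_cast le_top) hu ho.uniqueDiffOn ?_ hξ ?_ ?_
  · intro y hy
    have : 0 < ‖y‖ := norm_pos_iff.2 hy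
    show 0 < (‖ξ‖ ^ 2)⁻¹ * ‖y‖ ^ 2
    positivity
  · intro i hi
    rw [norm_iteratedFDerivWithin_eq_norm_iteratedDerivWithin, hfx,
      iteratedDerivWithin_comp_const_smul (by simp : (1:ℝ) ∈ Ioi 0) hu
        (hH.of_le (by exact_mod_cast le_top)) r₀ hmaps, mul_one, norm_smul, Real.norm_eq_abs,
      Real.norm_eq_abs, abs_of_pos (pow_pos hr₀p i)]
    exact hw i (hi.trans hq) r₀ hr₀p
  · intro i hi _
    rw [iteratedFDerivWithin_of_isOpen i ho hξ]
    exact norm_iteratedFDeriv_normSq_le hξ i hi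

/-- The symbol `ξ ↦ H(|2πξ|²)`, complex valued. -/
noncomputable def radSym (H : ℝ → ℝ) (ξ : Space N) : ℂ := (radFun H ξ : ℂ)

lemma measurable_radFun {H : ℝ → ℝ} (hN : 1 ≤ N) (hH : ContDiffOn ℝ ∞ H (Ioi 0)) :
    AEStronglyMeasurable (radFun H : Space N → ℝ) volume := by
  have : Nonempty (Fin N) := ⟨⟨0, hN⟩⟩
  have h := (contDiffOn_radFun (N := N) hH).continuousOn.aestronglyMeasurable (μ := volume)
    (measurableSet_singleton (0 : Space N)).compl
  rwa [Measure.restrict_eq_self_of_ae_mem] at h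
  exact (compl_mem_ae_iff.2 (measure_singleton _))

lemma one_add_sq_rpow_le {M : ℝ} (hM : 0 ≤ M) (ξ : Space N) :
    (1 + (2 * π * ‖ξ‖) ^ 2) ^ (-M) ≤ 2 ^ M * (1 + ‖ξ‖) ^ (-(2 * M)) := by
  have h1 : (1 + ‖ξ‖) ^ 2 ≤ 2 * (1 + (2 * π * ‖ξ‖) ^ 2) := by
    have h3 : (1:ℝ) ≤ 2 * π := by linarith [pi_gt_three]
    have h2 : ‖ξ‖ ≤ 2 * π * ‖ξ‖ := by nlinarith [norm_nonneg ξ]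
    nlinarith [norm_nonneg ξ, sq_nonneg (1 - ‖ξ‖)]
  have e : (1 + ‖ξ‖) ^ (-(2 * M)) = ((1 + ‖ξ‖) ^ 2) ^ (-M) := by
    rw [← Real.rpow_natCast, ← Real.rpow_mul (by positivity)]; push_cast; ring_nf
  rw [e, Real.rpow_neg (by positivity), Real.rpow_neg (by positivity), ← div_eq_mul_inv,
    inv_eq_one_div, div_le_div_iff₀ (by positivity) (by positivity), one_mul,
    ← Real.mul_rpow (by norm_num) (by positivity)]
  exact Real.rpow_le_rpow (by positivity) h1 hM

section symbol
variable {n : ℕ} {β M c₀ B B' : ℝ} {H : ℝ → ℝ}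

lemma IsSymbol.abs_radFun_le (h : IsSymbol n β M c₀ B B' H) (hB' : 0 ≤ B') (hM : 0 ≤ M)
    {ξ : Space N} (hξ : ξ ≠ 0) : |radFun H ξ| ≤ B' * (2 ^ M * (1 + ‖ξ‖) ^ (-(2 * M))) := by
  have hx0 : 0 < ‖ξ‖ := norm_pos_iff.2 hξ
  have h1 := h.far 0 (Nat.zero_le _) ((2 * π * ‖ξ‖) ^ 2) (by positivity)
  simp only [pow_zero, one_mul, iteratedDerivWithin_zero] at h1
  refine h1.trans ?_
  gcongr
  exact one_add_sq_rpow_le hM ξ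

lemma IsSymbol.integrable_radFun (h : IsSymbol n β M c₀ B B' H) (hN : 1 ≤ N) (hB' : 0 ≤ B')
    (hM : (N : ℝ) < 2 * M) : Integrable (radFun H : Space N → ℝ) := by
  have : Nonempty (Fin N) := ⟨⟨0, hN⟩⟩
  have hM0 : 0 ≤ M := by have : (0:ℝ) ≤ N := N.cast_nonneg
                         linarith
  have hi : Integrable (fun ξ : Space N => B' * (2 ^ M * (1 + ‖ξ‖) ^ (-(2 * M)))) :=
    ((integrable_one_add_norm (by simpa using hM)).const_mul _).const_mul _
  refine hi.mono' (measurable_radFun hN h.smooth) ?_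
  have : ∀ᵐ ξ : Space N, ξ ≠ 0 := compl_mem_ae_iff.2 (measure_singleton _)
  filter_upwards [this] with ξ hξ
  exact h.abs_radFun_le hB' hM0 hξ

lemma IsSymbol.integrable_radSym (h : IsSymbol n β M c₀ B B' H) (hN : 1 ≤ N) (hB' : 0 ≤ B')
    (hM : (N : ℝ) < 2 * M) : Integrable (radSym H : Space N → ℂ) :=
  (h.integrable_radFun hN hB' hM).ofReal

end symbol

/-- A smooth cutoff function equal to `1` on the unit ball. -/
noncomputable def cutoff (N : ℕ) : ContDiffBump (0 : Space N) := ⟨1, 2, one_pos, one_lt_two⟩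

lemma exists_cutoff_bound (N n : ℕ) : ∃ K : ℝ, 0 ≤ K ∧ ∀ j ≤ n, ∀ ξ : Space N,
    ‖ξ‖ ^ j * ‖iteratedFDeriv ℝ j (fun ξ => 1 - cutoff N ξ) ξ‖ ≤ K := by
  have h1 : ∀ j : ℕ, ∃ K : ℝ, ∀ ξ : Space N,
      ‖ξ‖ ^ j * ‖iteratedFDeriv ℝ j (fun ξ => 1 - cutoff N ξ) ξ‖ ≤ K := by
    intro j
    have hs : ContDiff ℝ ∞ (fun ξ => 1 - cutoff N ξ) := contDiff_const.sub (cutoff N).contDiff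
    rcases j with _ | j
    · refine ⟨1, fun ξ => ?_⟩
      have := (cutoff N).nonneg (x := ξ)
      have := (cutoff N).le_one (x := ξ)
      simp only [pow_zero, norm_iteratedFDeriv_zero, one_mul, Real.norm_eq_abs]
      rw [abs_of_nonneg (by linarith)]
      linarith
    · have hc : HasCompactSupport (iteratedFDeriv ℝ (j + 1) (fun ξ => 1 - cutoff N ξ)) := by
        have e : fderiv ℝ (fun ξ => 1 - cutoff N ξ) = fun ξ => - fderiv ℝ (cutoff N) ξ := by
          funext ξ
          exact fderiv_const_sub _
        have h2 : HasCompactSupport (fderiv ℝ (fun ξ => 1 - cutoff N ξ)) := by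
          rw [e]
          exact ((cutoff N).hasCompactSupport.fderiv ℝ).neg
        refine (h2.iteratedFDeriv (𝕜 := ℝ) j).mono fun ξ hξ => ?_
        rw [Function.mem_support, ← norm_ne_zero_iff] at hξ ⊢
        rwa [norm_iteratedFDeriv_fderiv]
      have hcont : Continuous (fun ξ : Space N =>
          ‖ξ‖ ^ (j + 1) * ‖iteratedFDeriv ℝ (j + 1) (fun ξ => 1 - cutoff N ξ) ξ‖) :=
        (continuous_norm.pow _).mul
          (hs.continuous_iteratedFDeriv (m := j + 1) (by exact_mod_cast le_top)).norm
      obtain ⟨C, hC⟩ := hcont.bounded_above_of_compact_support (hc.norm.mul_left)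
      exact ⟨C, fun ξ => (le_abs_self _).trans (hC ξ)⟩
  choose K hK using h1
  refine ⟨∑ j ∈ Finset.range (n + 1), |K j|, Finset.sum_nonneg fun _ _ => abs_nonneg _,
    fun j hj ξ => (hK j ξ).trans ((le_abs_self _).trans ?_)⟩
  exact Finset.single_le_sum (f := fun j => |K j|) (fun _ _ => abs_nonneg _)
      (Finset.mem_range.2 (by omega))

/-- Fourier decay from the integral of the top derivative. -/
lemma norm_fourier_le_of_norm_eq_one {G : Space N → ℂ} {n : ℕ} (hG : ContDiff ℝ ∞ G)
    (hi : ∀ q ≤ n, Integrable (iteratedFDeriv ℝ q G)) {w : Space N} (hw : ‖w‖ = 1) :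
    ‖𝓕 G w‖ ≤ ∫ ξ, ‖iteratedFDeriv ℝ n G ξ‖ := by
  have h1 := congrFun (Real.fourier_iteratedFDeriv (N := (n : ℕ∞)) (hG.of_le (by exact_mod_cast le_top))
    (fun q hq => hi q (by exact_mod_cast hq)) (le_refl _)) w
  -- Evaluated at `(w, …, w)` with `‖w‖ = 1`, the transform of `Dⁿ G` is `𝓕 G w` up to a factor of
  -- modulus `(2π)^n ≥ 1`.
  have h2 : ‖𝓕 (iteratedFDeriv ℝ n G) w (fun _ => w)‖ ≤ ∫ ξ, ‖iteratedFDeriv ℝ n G ξ‖ := by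
    refine (ContinuousMultilinearMap.le_opNorm _ _).trans ?_
    simp only [hw, Finset.prod_const_one, mul_one]
    exact VectorFourier.norm_fourierIntegral_le_integral_norm _ _ _ _ _
  rw [h1, VectorFourier.fourierPowSMulRight_apply, norm_smul, norm_smul, norm_pow, norm_neg] at h2
  have h3 : ‖∏ i : Fin n, (-innerSL ℝ w) w‖ = 1 := by
    simp [hw]
  have h4 : ‖(2 * (π : ℂ) * Complex.I)‖ = 2 * π := by
    simp [abs_of_pos pi_pos]
  have h5 : (1:ℝ) ≤ (2 * π) ^ n := one_le_pow₀ (by linarith [pi_gt_three])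
  refine le_trans ?_ h2
  rw [h4]
  have h6 : ‖∏ i : Fin n, ((-innerSL ℝ) w) w‖ = 1 := h3
  rw [h6, one_mul]
  exact le_mul_of_one_le_left (norm_nonneg _) h5

section decay
variable {n : ℕ} {β M c₀ B B' : ℝ} {H : ℝ → ℝ}

/-- The symbol with its singularity at the origin cut off. -/
noncomputable def cutSym (H : ℝ → ℝ) (c₀ : ℝ) (ξ : Space N) : ℝ :=
  (radFun H ξ - c₀) * (1 - cutoff N ξ)

lemma cutSym_eq_zero {ξ : Space N} (h : ‖ξ‖ ≤ 1) : cutSym H c₀ ξ = 0 := by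
  have : cutoff N ξ = 1 := (cutoff N).one_of_mem_closedBall (by simpa [cutoff] using h)
  simp [cutSym, this]

lemma contDiff_cutSym (hH : ContDiffOn ℝ ∞ H (Ioi 0)) :
    ContDiff ℝ ∞ (cutSym H c₀ : Space N → ℝ) := by
  rw [contDiff_iff_contDiffAt]
  intro ξ
  by_cases hξ : ξ = 0
  · have h : (cutSym H c₀ : Space N → ℝ) =ᶠ[𝓝 ξ] fun _ => 0 := by
      filter_upwards [Metric.ball_mem_nhds ξ one_pos] with y hy
      subst hξ
      exact cutSym_eq_zero (by simpa using (mem_ball_zero_iff.1 hy).le)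
    exact contDiffAt_const.congr_of_eventuallyEq h
  · exact (((contDiffOn_radFun hH).contDiffAt (isOpen_compl_singleton.mem_nhds hξ)).sub
      contDiffAt_const).mul (contDiffAt_const.sub (cutoff N).contDiff.contDiffAt)

lemma IsSymbol.norm_iteratedFDeriv_sub_le (h : IsSymbol n β M c₀ B B' H) {q : ℕ} (hq : q ≤ n)
    {ξ : Space N} (hξ : ξ ≠ 0) :
    ‖iteratedFDeriv ℝ q (fun ξ => radFun H ξ - c₀) ξ‖ ≤
      q.factorial * (B * (2 * π * ‖ξ‖) ^ (2 * β)) * (2 / ‖ξ‖) ^ q := by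
  have h1 := norm_iteratedFDeriv_radFun_le (h.smooth.sub contDiffOn_const) h.near hq hξ
  refine h1.trans (le_of_eq ?_)
  rw [← Real.rpow_natCast, ← Real.rpow_mul (by positivity)]
  norm_num

/-- Leibniz rule for the product with `1 - cutoff`. The order of quantifiers matters: `C` depends
only on `N`, `n`, `β`, and the bound is linear in `B`, so it applies to all dilates of one symbol at
once. -/
lemma exists_cutSym_bound (N : ℕ) (n : ℕ) (β : ℝ) : ∃ C : ℝ, 0 ≤ C ∧
    ∀ (H : ℝ → ℝ) (M c₀ B B' : ℝ), 0 ≤ B → IsSymbol n β M c₀ B B' H →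
      ∀ ξ : Space N, ‖iteratedFDeriv ℝ n (cutSym H c₀) ξ‖ ≤
        C * B * (1 + ‖ξ‖) ^ (2 * β - n) := by
  obtain ⟨K, hK0, hK⟩ := exists_cutoff_bound N n
  set S : ℝ := ∑ i ∈ Finset.range (n + 1),
    (n.choose i : ℝ) * (i.factorial * 2 ^ i * K) with hS
  have hS0 : 0 ≤ S := Finset.sum_nonneg fun _ _ => by positivity
  refine ⟨S * (2 * π) ^ (2 * β) * 2 ^ |2 * β - n|, by positivity,
    fun H M c₀ B B' hB h ξ => ?_⟩
  rcases lt_or_ge ‖ξ‖ 1 with hξ | hξ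
  · have h0 : (cutSym H c₀ : Space N → ℝ) =ᶠ[𝓝 ξ] fun _ => 0 := by
      filter_upwards [continuous_norm.continuousAt.eventually_lt
        (continuousAt_const (y := (1:ℝ))) hξ] with y hy
      exact cutSym_eq_zero hy.le
    rw [(h0.iteratedFDeriv ℝ n).eq_of_nhds]
    have : iteratedFDeriv ℝ n (fun _ : Space N => (0:ℝ)) ξ = 0 := by
      simp
    rw [this, norm_zero]
    positivity
  · have hx0 : 0 < ‖ξ‖ := by linarith
    have hξ0 : ξ ≠ 0 := norm_pos_iff.1 hx0
    have ho : IsOpen ({0}ᶜ : Set (Space N)) := isOpen_compl_singleton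
    have h1 : ‖iteratedFDeriv ℝ n (cutSym H c₀) ξ‖ ≤
        S * (B * (2 * π * ‖ξ‖) ^ (2 * β)) / ‖ξ‖ ^ n := by
      rw [← iteratedFDerivWithin_of_isOpen n ho hξ0]
      refine (norm_iteratedFDerivWithin_mul_le (N := ∞)
        ((contDiffOn_radFun h.smooth).sub contDiffOn_const)
        (contDiff_const.sub (cutoff N).contDiff).contDiffOn ho.uniqueDiffOn hξ0
        (by exact_mod_cast le_top)).trans ?_
      rw [hS, Finset.sum_mul, Finset.sum_div]
      refine Finset.sum_le_sum fun i hi => ?_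
      have hi' : i ≤ n := by simpa [Nat.lt_succ_iff] using hi
      rw [iteratedFDerivWithin_of_isOpen i ho hξ0, iteratedFDerivWithin_of_isOpen (n - i) ho hξ0]
      have h2 := h.norm_iteratedFDeriv_sub_le hi' hξ0
      have h3 : ‖iteratedFDeriv ℝ (n - i) (fun ξ => 1 - cutoff N ξ) ξ‖ ≤ K / ‖ξ‖ ^ (n - i) := by
        rw [le_div_iff₀ (by positivity), mul_comm]
        exact hK _ (Nat.sub_le _ _) ξ
      calc _ ≤ (n.choose i : ℝ) * (i.factorial * (B * (2 * π * ‖ξ‖) ^ (2 * β)) * (2 / ‖ξ‖) ^ i) *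
            (K / ‖ξ‖ ^ (n - i)) := by gcongr
        _ = _ := by
          have : ‖ξ‖ ^ n = ‖ξ‖ ^ i * ‖ξ‖ ^ (n - i) := by rw [← pow_add]; congr 1; omega
          rw [this, div_pow]
          field_simp
    refine h1.trans ?_
    have e : S * (B * (2 * π * ‖ξ‖) ^ (2 * β)) / ‖ξ‖ ^ n =
        S * (2 * π) ^ (2 * β) * B * ‖ξ‖ ^ (2 * β - n) := by
      rw [Real.mul_rpow (by positivity) (by positivity), Real.rpow_sub hx0, Real.rpow_natCast]
      field_simp
    rw [e]
    have h4 : ‖ξ‖ ^ (2 * β - n) ≤ 2 ^ |2 * β - n| * (1 + ‖ξ‖) ^ (2 * β - n) := by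
      rcases le_total 0 (2 * β - n) with hs | hs
      · have h5 : (1:ℝ) ≤ 2 ^ |2 * β - n| := Real.one_le_rpow (by norm_num) (abs_nonneg _)
        have h6 : ‖ξ‖ ^ (2 * β - n) ≤ (1 + ‖ξ‖) ^ (2 * β - n) := by
          gcongr
          linarith
        calc _ ≤ _ := h6
          _ ≤ _ := le_mul_of_one_le_left (by positivity) h5
      · rw [abs_of_nonpos hs, Real.rpow_neg (by norm_num), inv_mul_eq_div,
          ← Real.div_rpow (by positivity) (by norm_num)]
        exact Real.rpow_le_rpow_of_nonpos (by positivity) (by linarith) hs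
    calc _ ≤ S * (2 * π) ^ (2 * β) * B * (2 ^ |2 * β - n| * (1 + ‖ξ‖) ^ (2 * β - n)) := by gcongr
      _ = _ := by ring

/-- With `c₀` added back, the function coincides with the symbol itself outside the ball of radius
`2`, where the bounds at infinity apply; on the ball continuity is enough. -/
lemma IsSymbol.integrable_iteratedFDeriv_cutSym_add (h : IsSymbol n β M c₀ B B' H)
    (hM : (N : ℝ) < 2 * M) (hB' : 0 ≤ B') {q : ℕ} (hq : q ≤ n) :
    Integrable (iteratedFDeriv ℝ q (fun ξ : Space N => cutSym H c₀ ξ + c₀)) := by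
  have hM0 : 0 ≤ M := by
    have : (0:ℝ) ≤ N := N.cast_nonneg
    linarith
  have hs : ContDiff ℝ ∞ (fun ξ : Space N => cutSym H c₀ ξ + c₀) :=
    (contDiff_cutSym h.smooth).add contDiff_const
  have hcont : Continuous (iteratedFDeriv ℝ q (fun ξ : Space N => cutSym H c₀ ξ + c₀)) :=
    hs.continuous_iteratedFDeriv (by exact_mod_cast le_top)
  rw [← integrableOn_univ, ← union_compl_self (Metric.closedBall (0 : Space N) 2)]
  refine (hcont.continuousOn.integrableOn_compact (isCompact_closedBall _ _)).union ?_
  have hi : Integrable (fun ξ : Space N =>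
      q.factorial * (B' * (2 ^ M * (1 + ‖ξ‖) ^ (-(2 * M))))) :=
    (((integrable_one_add_norm (by simpa using hM)).const_mul _).const_mul _).const_mul _
  refine hi.integrableOn.mono' hcont.aestronglyMeasurable.restrict ?_
  refine (ae_restrict_iff' Metric.isClosed_closedBall.measurableSet.compl).2
    (.of_forall fun ξ hξ => ?_)
  have hξ' : 2 < ‖ξ‖ := by simpa using hξ
  have hx0 : 0 < ‖ξ‖ := by linarith
  have hξ0 : ξ ≠ 0 := norm_pos_iff.1 hx0
  have he : (fun ξ : Space N => cutSym H c₀ ξ + c₀) =ᶠ[𝓝 ξ] radFun H := by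
    filter_upwards [(continuousAt_const (y := (2:ℝ))).eventually_lt
      continuous_norm.continuousAt hξ'] with y hy
    have : cutoff N y = 0 := (cutoff N).zero_of_le_dist (by simpa [cutoff] using hy.le)
    simp [cutSym, this]
  rw [(he.iteratedFDeriv ℝ q).eq_of_nhds]
  refine (norm_iteratedFDeriv_radFun_le h.smooth h.far hq hξ0).trans ?_
  have h1 : (2 / ‖ξ‖) ^ q ≤ 1 := pow_le_one₀ (by positivity) (by rw [div_le_one hx0]; exact hξ'.le)
  have h2 := one_add_sq_rpow_le (N := N) hM0 ξ
  calc _ ≤ q.factorial * (B' * (2 ^ M * (1 + ‖ξ‖) ^ (-(2 * M)))) * 1 := by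
        gcongr
    _ = _ := mul_one _

/-- The Fourier transform of a symbol is bounded on the unit sphere. -/
lemma exists_fourier_bound_unit (hN : 1 ≤ N) (hβ : 0 ≤ β) (hn : (N : ℝ) + 2 * β < n) (hn0 : n ≠ 0) :
    ∃ C : ℝ, 0 ≤ C ∧ ∀ (H : ℝ → ℝ) (M c₀ B B' : ℝ), 0 ≤ B → 0 ≤ B' → (N : ℝ) < 2 * M →
      IsSymbol n β M c₀ B B' H → ∀ x : Space N, ‖x‖ = 1 → ‖𝓕⁻ (radSym H) x‖ ≤ C * B := by
  obtain ⟨C, hC0, hC⟩ := exists_cutSym_bound N n β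
  have hw : Integrable (fun ξ : Space N => (1 + ‖ξ‖) ^ (2 * β - n)) := by
    have := integrable_one_add_norm (E := Space N) (μ := volume) (r := n - 2 * β)
      (by simp; linarith)
    simpa using this
  have hcut : Integrable (fun ξ : Space N => (2 * π * 2) ^ (2 * β) * cutoff N ξ) :=
    ((cutoff N).continuous.integrable_of_hasCompactSupport (cutoff N).hasCompactSupport).const_mul _
  refine ⟨(∫ ξ : Space N, (2 * π * 2) ^ (2 * β) * cutoff N ξ) +
    C * ∫ ξ : Space N, (1 + ‖ξ‖) ^ (2 * β - n), ?_, fun H M c₀ B B' hB hB' hM h x hx => ?_⟩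
  · have h1 : 0 ≤ ∫ ξ : Space N, (2 * π * 2) ^ (2 * β) * cutoff N ξ :=
      integral_nonneg fun ξ => mul_nonneg (by positivity) (cutoff N).nonneg
    have h2 : 0 ≤ ∫ ξ : Space N, (1 + ‖ξ‖) ^ (2 * β - n) := integral_nonneg fun ξ => by positivity
    positivity
  have hm := h.integrable_radFun hN hB' hM
  -- Split the symbol as `lo + hi`. The part `lo` is supported near the origin and at most `B
  -- |2πξ|^{2β}`, so its transform is controlled by its `L¹` norm. The part `hi` is smooth, and its
  -- derivative of order `n > N + 2β` is integrable with norm linear in `B`.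
  set lo : Space N → ℝ := fun ξ => (radFun H ξ - c₀) * cutoff N ξ with hlo
  have hae : ∀ᵐ ξ : Space N, ξ ≠ 0 := by
    have : Nonempty (Fin N) := ⟨⟨0, hN⟩⟩
    exact compl_mem_ae_iff.2 (measure_singleton _)
  have hlob : ∀ᵐ ξ : Space N, ‖lo ξ‖ ≤ B * ((2 * π * 2) ^ (2 * β) * cutoff N ξ) := by
    filter_upwards [hae] with ξ hξ
    rw [hlo, norm_mul, Real.norm_of_nonneg (cutoff N).nonneg]
    rcases le_total 2 ‖ξ‖ with h2 | h2
    · have : cutoff N ξ = 0 := (cutoff N).zero_of_le_dist (by simpa [cutoff] using h2)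
      simp [this]
    · have h3 := h.norm_iteratedFDeriv_sub_le (Nat.zero_le _) hξ
      simp only [norm_iteratedFDeriv_zero, Nat.factorial_zero, Nat.cast_one, one_mul, pow_zero,
        mul_one] at h3
      rw [← mul_assoc]
      gcongr
      · exact (cutoff N).nonneg
      · refine h3.trans ?_
        gcongr
  have hloi : Integrable lo :=
    (hcut.const_mul B).mono' ((hm.aestronglyMeasurable.sub aestronglyMeasurable_const).mul
      (cutoff N).continuous.aestronglyMeasurable) hlob
  set hi : Space N → ℝ := fun ξ => cutSym H c₀ ξ + c₀ with hhi
  have hsum : ∀ ξ, radFun H ξ = lo ξ + hi ξ := fun ξ => by simp only [hlo, hhi, cutSym]; ring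
  have hhii : Integrable hi := by
    have : hi = radFun H - lo := by funext ξ; simp [hsum ξ]
    rw [this]
    exact hm.sub hloi
  have e : 𝓕⁻ (radSym H) x = 𝓕⁻ (fun ξ => (lo ξ : ℂ)) x + 𝓕⁻ (fun ξ => (hi ξ : ℂ)) x := by
    rw [fourierInv_eq_fourier_neg, fourierInv_eq_fourier_neg, fourierInv_eq_fourier_neg,
      fourier_eq, fourier_eq, fourier_eq,
      ← integral_add ((fourierIntegral_convergent_iff (-x)).2 hloi.ofReal)
        ((fourierIntegral_convergent_iff (-x)).2 hhii.ofReal)]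
    refine integral_congr_ae (.of_forall fun ξ => ?_)
    simp only [radSym, hsum ξ, Complex.ofReal_add, smul_add]
  have h1 : ‖𝓕⁻ (fun ξ => (lo ξ : ℂ)) x‖ ≤ (∫ ξ : Space N, (2 * π * 2) ^ (2 * β) * cutoff N ξ) * B := by
    rw [fourierInv_eq_fourier_neg]
    refine (VectorFourier.norm_fourierIntegral_le_integral_norm _ _ _ _ _).trans ?_
    rw [mul_comm, ← integral_const_mul]
    refine integral_mono_ae hloi.ofReal.norm (hcut.const_mul B) ?_
    filter_upwards [hlob] with ξ hξ
    simpa using hξ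
  have hGs : ContDiff ℝ ∞ (fun ξ : Space N => (hi ξ : ℂ)) :=
    Complex.ofRealCLM.contDiff.comp ((contDiff_cutSym h.smooth).add contDiff_const)
  have hnorm : ∀ q ξ, ‖iteratedFDeriv ℝ q (fun ξ : Space N => (hi ξ : ℂ)) ξ‖ =
      ‖iteratedFDeriv ℝ q hi ξ‖ := fun q ξ =>
    Complex.ofRealLI.norm_iteratedFDeriv_comp_left
      ((((contDiff_cutSym h.smooth).add contDiff_const).contDiffAt (n := ∞)))
      (by exact_mod_cast le_top)
  have h2 : ‖𝓕⁻ (fun ξ => (hi ξ : ℂ)) x‖ ≤ (C * ∫ ξ : Space N, (1 + ‖ξ‖) ^ (2 * β - n)) * B := by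
    rw [fourierInv_eq_fourier_neg]
    refine (norm_fourier_le_of_norm_eq_one (n := n) hGs (fun q hq => ?_) (by simpa using hx)).trans ?_
    · refine (h.integrable_iteratedFDeriv_cutSym_add hM hB' hq).norm.mono'
        (hGs.continuous_iteratedFDeriv (by exact_mod_cast le_top)).aestronglyMeasurable
        (.of_forall fun ξ => (hnorm q ξ).le)
    · have e2 : (C * ∫ ξ : Space N, (1 + ‖ξ‖) ^ (2 * β - n)) * B =
          ∫ ξ : Space N, C * B * (1 + ‖ξ‖) ^ (2 * β - n) := by rw [integral_const_mul]; ring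
      rw [e2]
      refine integral_mono_of_nonneg (.of_forall fun ξ => norm_nonneg _) (hw.const_mul _)
        (.of_forall fun ξ => ?_)
      simp only [hnorm]
      refine le_trans (le_of_eq ?_) (hC H M c₀ B B' hB h ξ)
      -- A derivative of order at least one does not see the constant `c₀`, so the bound for
      -- `cutSym` applies to `hi`.
      obtain ⟨k, rfl⟩ := Nat.exists_eq_succ_of_ne_zero hn0
      have e3 : fderiv ℝ hi = fderiv ℝ (cutSym H c₀) := by
        funext y; exact fderiv_add_const _
      rw [Nat.succ_eq_add_one, ← norm_iteratedFDeriv_fderiv, ← norm_iteratedFDeriv_fderiv, e3]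
  rw [e]
  calc _ ≤ _ := norm_add_le _ _
    _ ≤ _ := add_le_add h1 h2
    _ = _ := by ring

/-- Scaling of the inverse Fourier transform. -/
lemma fourierInv_comp_smul (m : Space N → ℂ) {c : ℝ} (hc : 0 < c) (x : Space N) :
    𝓕⁻ (fun ξ => m (c • ξ)) x = ((c ^ N)⁻¹ : ℝ) • 𝓕⁻ m (c⁻¹ • x) := by
  rw [fourierInv_eq, fourierInv_eq]
  have := Measure.integral_comp_smul_of_nonneg (μ := (volume : Measure (Space N)))
    (fun ξ => Real.fourierChar (inner ℝ ξ (c⁻¹ • x)) • m ξ) c (hR := hc.le)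
  rw [finrank_euclideanSpace, Fintype.card_fin] at this
  rw [← this]
  refine integral_congr_ae (.of_forall fun ξ => ?_)
  simp only [inner_smul_left, inner_smul_right]
  congr 3
  simp [hc.ne']

/-- The decay of the kernels of symbols with a singularity `|ξ|^{2β}` at the origin. -/
theorem exists_fourier_bound (hN : 1 ≤ N) (hβ : 0 ≤ β) (hn : (N : ℝ) + 2 * β < n) (hn0 : n ≠ 0)
    (hM : (N : ℝ) < 2 * M) (hB : 0 ≤ B) (hB' : 0 ≤ B') (h : IsSymbol n β M c₀ B B' H) :
    ∃ C : ℝ, 0 ≤ C ∧ ∀ x : Space N,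
      ‖𝓕⁻ (radSym H) x‖ ≤ C * (1 + ‖x‖) ^ (-((N : ℝ) + 2 * β)) := by
  obtain ⟨C, hC0, hC⟩ := exists_fourier_bound_unit (β := β) hN hβ hn hn0
  have hM0 : 0 ≤ M := by
    have : (0:ℝ) ≤ N := N.cast_nonneg
    linarith
  have hNn : (0:ℝ) ≤ N := N.cast_nonneg
  set I := ∫ ξ : Space N, ‖radSym H ξ‖ with hI
  have hI0 : 0 ≤ I := integral_nonneg fun _ => norm_nonneg _
  refine ⟨2 ^ ((N : ℝ) + 2 * β) * (I + C * B), by positivity, fun x => ?_⟩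
  have h1 : ‖𝓕⁻ (radSym H) x‖ ≤ I := by
    rw [fourierInv_eq_fourier_neg]
    exact VectorFourier.norm_fourierIntegral_le_integral_norm _ _ _ _ _
  rcases le_total ‖x‖ 1 with hx | hx
  · refine h1.trans ?_
    have h2 : (1:ℝ) ≤ 2 ^ ((N : ℝ) + 2 * β) * (1 + ‖x‖) ^ (-((N : ℝ) + 2 * β)) := by
      rw [Real.rpow_neg (by positivity), ← div_eq_mul_inv, ← Real.div_rpow (by norm_num) (by positivity)]
      refine Real.one_le_rpow ?_ (by positivity)
      rw [one_le_div (by positivity)]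
      linarith
    calc I ≤ I + C * B := by linarith [mul_nonneg hC0 hB]
      _ ≤ (I + C * B) * (2 ^ ((N : ℝ) + 2 * β) * (1 + ‖x‖) ^ (-((N : ℝ) + 2 * β))) :=
        le_mul_of_one_le_right (by positivity) h2
      _ = _ := by ring
  · have hx0 : 0 < ‖x‖ := by linarith
    -- Dilation by `‖x‖` moves `x` to the unit sphere. It replaces `B` by `B c^β = B ‖x‖^{-2β}`, and
    -- the Jacobian contributes `‖x‖^{-N}`.
    set c := (‖x‖ ^ 2)⁻¹ with hc
    have hc0 : 0 < c := by positivity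
    have h2 := hC (fun r => H (c * r)) M c₀ _ _ (by positivity) (by positivity) hM
      (h.scale hB' hM0 hc0) (‖x‖⁻¹ • x) (by rw [norm_smul]; simp [hx0.ne'])
    have e : (radSym (fun r => H (c * r)) : Space N → ℂ) = fun ξ => radSym H (‖x‖⁻¹ • ξ) := by
      funext ξ
      simp only [radSym, radFun, hc, norm_smul, norm_inv, norm_norm]
      congr 2
      field_simp
    rw [e, fourierInv_comp_smul _ (by positivity), inv_inv, smul_smul, mul_inv_cancel₀ hx0.ne',
      one_smul, norm_smul, Real.norm_of_nonneg (by positivity)] at h2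
    have e2 : c ^ β = ‖x‖ ^ (-(2 * β)) := by
      rw [hc, Real.inv_rpow (by positivity), ← Real.rpow_natCast, ← Real.rpow_mul hx0.le,
        Real.rpow_neg hx0.le]
      norm_num
    rw [inv_pow, inv_inv, e2] at h2
    have h3 : ‖𝓕⁻ (radSym H) x‖ ≤ C * B * ‖x‖ ^ (-((N : ℝ) + 2 * β)) := by
      rw [neg_add, Real.rpow_add hx0, Real.rpow_neg hx0.le (N : ℝ), Real.rpow_natCast]
      rw [← le_div_iff₀' (by positivity)] at h2
      refine h2.trans (le_of_eq ?_)
      field_simp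
    have h4 : ‖x‖ ^ (-((N : ℝ) + 2 * β)) ≤
        2 ^ ((N : ℝ) + 2 * β) * (1 + ‖x‖) ^ (-((N : ℝ) + 2 * β)) := by
      rw [Real.rpow_neg (by positivity), Real.rpow_neg (by positivity), ← div_eq_mul_inv,
        inv_eq_one_div, div_le_div_iff₀ (by positivity) (by positivity), one_mul,
        ← Real.mul_rpow (by positivity) (by positivity)]
      exact Real.rpow_le_rpow (by positivity) (by linarith) (by positivity)
    calc _ ≤ C * B * (2 ^ ((N : ℝ) + 2 * β) * (1 + ‖x‖) ^ (-((N : ℝ) + 2 * β))) :=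
          h3.trans (by gcongr)
      _ ≤ (I + C * B) * (2 ^ ((N : ℝ) + 2 * β) * (1 + ‖x‖) ^ (-((N : ℝ) + 2 * β))) := by
          gcongr; linarith
      _ = _ := by ring

end decay

end radial

/-! ### Fourier multipliers and real even convolution kernels. -/

section multiplier
variable {N : ℕ}

open Real

lemma continuous_fourierInv {m : Space N → ℂ} (hm : Integrable m) : Continuous (𝓕⁻ m) := by
  have h : Continuous (𝓕 m) := VectorFourier.fourierIntegral_continuous Real.continuous_fourierChar
    (by exact continuous_inner) hm
  have e : 𝓕⁻ m = fun x => 𝓕 m (-x) := by funext x; exact fourierInv_eq_fourier_neg m x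
  rw [e]
  exact h.comp continuous_neg

/-- Convolution with `𝓕⁻ m` is the Fourier multiplier `m`. -/
lemma integral_fourierInv_mul {m ψ : Space N → ℂ} (hm : Integrable m) (hψ : Integrable ψ)
    (x : Space N) : ∫ y, 𝓕⁻ m (x - y) * ψ y = 𝓕⁻ (fun ξ => m ξ * 𝓕 ψ ξ) x := by
  simp_rw [fourierInv_eq, fourier_eq, Circle.smul_def, smul_eq_mul]
  have hint : Integrable (fun z : Space N × Space N =>
      ((Real.fourierChar (inner ℝ z.2 (x - z.1)) : Circle) : ℂ) * (ψ z.1 * m z.2))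
      (volume.prod volume) := by
    refine (hψ.mul_prod hm).bdd_mul (c := 1) ?_ ?_
    · refine Continuous.aestronglyMeasurable ?_
      exact continuous_induced_dom.comp (Real.continuous_fourierChar.comp
        (continuous_snd.inner (continuous_const.sub continuous_fst)))
    · exact .of_forall fun z => (Circle.norm_coe _).le
  have h1 : ∀ y : Space N, (∫ ξ : Space N, ((Real.fourierChar (inner ℝ ξ (x - y)) : Circle) : ℂ) * m ξ) * ψ y =
      ∫ ξ : Space N, ((Real.fourierChar (inner ℝ ξ (x - y)) : Circle) : ℂ) * (ψ y * m ξ) := by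
    intro y
    rw [← integral_mul_const]
    exact integral_congr_ae (.of_forall fun ξ => by simp only; ring)
  simp_rw [h1]
  rw [integral_integral_swap hint]
  refine integral_congr_ae (.of_forall fun ξ => ?_)
  simp only
  rw [← integral_const_mul, ← integral_const_mul]
  refine integral_congr_ae (.of_forall fun y => ?_)
  simp only
  rw [inner_sub_right, sub_eq_add_neg, AddChar.map_add_eq_mul, Circle.coe_mul,
    real_inner_comm ξ y]
  ring

/-- The kernel with the radial symbol `H(|2πξ|²)`. -/
noncomputable def radKer (H : ℝ → ℝ) (x : Space N) : ℝ := (𝓕⁻ (radSym H) x).re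

lemma fourierInv_radSym (H : ℝ → ℝ) (x : Space N) : 𝓕⁻ (radSym H) x = (radKer H x : ℂ) := by
  have h : (starRingEnd ℂ) (𝓕⁻ (radSym H) x) = 𝓕⁻ (radSym H) x := by
    rw [fourierInv_eq', ← integral_conj]
    rw [← integral_neg_eq_self]
    refine integral_congr_ae (.of_forall fun ξ => ?_)
    simp only [smul_eq_mul, map_mul, ← Complex.exp_conj, Complex.conj_ofReal, Complex.conj_I,
      inner_neg_left, radSym, radFun, norm_neg]
    congr 2
    push_cast
    ring
  rw [radKer]
  exact (Complex.conj_eq_iff_re.1 h).symm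

lemma radKer_neg (H : ℝ → ℝ) (x : Space N) : radKer H (-x) = radKer H x := by
  have h : 𝓕⁻ (radSym H) (-x) = 𝓕⁻ (radSym H) x := by
    rw [fourierInv_eq, fourierInv_eq, ← integral_neg_eq_self]
    refine integral_congr_ae (.of_forall fun ξ => ?_)
    simp [radSym, radFun]
  rw [radKer, h, radKer]

lemma continuous_radKer {H : ℝ → ℝ} (h : Integrable (radSym H : Space N → ℂ)) :
    Continuous (radKer H : Space N → ℝ) :=
  Complex.continuous_re.comp (continuous_fourierInv h)

lemma fourier_radKer {H : ℝ → ℝ} (hc : Continuous (radSym H : Space N → ℂ))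
    (h : Integrable (radSym H : Space N → ℂ)) (hk : Integrable (radKer H : Space N → ℝ)) :
    𝓕 (fun x : Space N => (radKer H x : ℂ)) = radSym H := by
  have e : (fun x : Space N => (radKer H x : ℂ)) = 𝓕⁻ (radSym H) := by
    funext x; exact (fourierInv_radSym H x).symm
  have hk' : Integrable (𝓕⁻ (radSym H : Space N → ℂ)) := by rw [← e]; exact hk.ofReal
  have hF : Integrable (𝓕 (radSym H : Space N → ℂ)) := by
    have e2 : 𝓕 (radSym H : Space N → ℂ) = fun x => 𝓕⁻ (radSym H) (-x) := by
      funext x; rw [fourierInv_eq_fourier_neg, neg_neg]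
    rw [e2]
    exact hk'.comp_neg
  rw [e]
  exact hc.fourier_fourierInv_eq h hF

lemma abs_radKer_le (H : ℝ → ℝ) (x : Space N) : |radKer H x| = ‖𝓕⁻ (radSym H) x‖ := by
  rw [fourierInv_radSym, Complex.norm_real, Real.norm_eq_abs]

lemma integral_radKer_mul {H : ℝ → ℝ} {ψ : Space N → ℝ} (hm : Integrable (radSym H : Space N → ℂ))
    (hψ : Integrable ψ) (x : Space N) :
    ∫ y, radKer H (x - y) * ψ y =
      (𝓕⁻ (fun ξ => radSym H ξ * 𝓕 (fun y => (ψ y : ℂ)) ξ) x).re := by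
  have h : ∫ y, 𝓕⁻ (radSym H) (x - y) * (ψ y : ℂ) =
      𝓕⁻ (fun ξ => radSym H ξ * 𝓕 (fun y => (ψ y : ℂ)) ξ) x :=
    integral_fourierInv_mul hm hψ.ofReal x
  rw [← h]
  simp_rw [fourierInv_radSym, ← Complex.ofReal_mul]
  rw [integral_complex_ofReal, Complex.ofReal_re]

end multiplier

/-! ### The kernels `P_σ` and `A_σ`: self-similarity and decay. -/

section kernels
variable {N : ℕ} {σ : ℝ}

open Real

/-- The symbol of `P_σ(·,t)` as a function of `r = |2πξ|²`. -/
noncomputable def symP (σ t : ℝ) (r : ℝ) : ℝ := Real.exp (-(r ^ (σ / 2) * t))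

/-- The symbol of `A_σ(·,t)` as a function of `r = |2πξ|²`. -/
noncomputable def symA (σ t : ℝ) (r : ℝ) : ℝ := r ^ (σ / 2) * Real.exp (-(r ^ (σ / 2) * t))

lemma sq_rpow_half {a : ℝ} (ha : 0 ≤ a) (σ : ℝ) : (a ^ 2) ^ (σ / 2) = a ^ σ := by
  rw [← Real.rpow_natCast, ← Real.rpow_mul ha]; congr 1; push_cast; ring

lemma radFun_symP (t : ℝ) (ξ : Space N) :
    radFun (symP σ t) ξ = Real.exp (-((2 * π * ‖ξ‖) ^ σ * t)) := by
  rw [radFun, symP, sq_rpow_half (by positivity)]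

lemma radFun_symA (t : ℝ) (ξ : Space N) :
    radFun (symA σ t) ξ = (2 * π * ‖ξ‖) ^ σ * Real.exp (-((2 * π * ‖ξ‖) ^ σ * t)) := by
  rw [radFun, symA, sq_rpow_half (by positivity)]

lemma radFun_symA_eq (t : ℝ) (ξ : Space N) :
    radFun (symA σ t) ξ = (2 * π * ‖ξ‖) ^ σ * radFun (symP σ t) ξ := by
  rw [radFun_symA, radFun_symP]

lemma continuous_radSym_symP (hσ : 0 < σ) (t : ℝ) : Continuous (radSym (symP σ t) : Space N → ℂ) := by
  unfold radSym
  simp_rw [radFun_symP]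
  refine Complex.continuous_ofReal.comp (Real.continuous_exp.comp ?_)
  exact (((continuous_const.mul continuous_norm).rpow_const fun x => Or.inr hσ.le).mul
    continuous_const).neg

lemma continuous_radSym_symA (hσ : 0 < σ) (t : ℝ) : Continuous (radSym (symA σ t) : Space N → ℂ) := by
  unfold radSym
  simp_rw [radFun_symA]
  refine Complex.continuous_ofReal.comp (Continuous.mul ?_ (Real.continuous_exp.comp ?_))
  · exact (continuous_const.mul continuous_norm).rpow_const fun x => Or.inr hσ.le
  · exact (((continuous_const.mul continuous_norm).rpow_const fun x => Or.inr hσ.le).mul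
      continuous_const).neg

lemma isSymbol_symP (hσ : 0 < σ) (n : ℕ) (M : ℝ) :
    ∃ B B', 0 ≤ B ∧ 0 ≤ B' ∧ IsSymbol n (σ / 2) M 1 B B' (symP σ 1) := by
  have : symP σ 1 = expSym (σ / 2) 0 := by funext r; simp [symP, expSym]
  rw [this]
  exact exists_isSymbol_expSym_zero (by positivity) n M

lemma isSymbol_symA (hσ : 0 < σ) (n : ℕ) {M : ℝ} (hM : 0 ≤ M) :
    ∃ B B', 0 ≤ B ∧ 0 ≤ B' ∧ IsSymbol n (σ / 2) M 0 B B' (symA σ 1) := by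
  have : symA σ 1 = expSym (σ / 2) (σ / 2) := by funext r; simp [symA, expSym]
  rw [this]
  exact exists_isSymbol_of_derivBound (k := σ / 2 + M) (contDiffOn_expSym _ _)
    (fun j _ => derivBound_expSym (by positivity) j _ _) (by positivity) le_rfl (by positivity)
    le_rfl hM

/-- `s^{-N} ρ(x/s)` -/
noncomputable def dilRho (σ s : ℝ) (x : Space N) : ℝ := (s ^ N)⁻¹ * rho σ (s⁻¹ • x)

lemma dilRho_nonneg {s : ℝ} (hs : 0 < s) (x : Space N) : 0 ≤ dilRho σ s x :=
  mul_nonneg (by positivity) (rho_nonneg _)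

lemma radSym_symP_scale (hσ : 0 < σ) {t : ℝ} (ht : 0 < t) :
    (radSym (symP σ t) : Space N → ℂ) = fun ξ => radSym (symP σ 1) (t ^ (1 / σ) • ξ) := by
  funext ξ
  have : (2 * π * (t ^ (1 / σ) * ‖ξ‖)) ^ σ = (2 * π * ‖ξ‖) ^ σ * t := by
    rw [mul_left_comm, Real.mul_rpow (by positivity) (by positivity), ← Real.rpow_mul ht.le,
      one_div_mul_cancel hσ.ne', Real.rpow_one, mul_comm]
  simp only [radSym, radFun_symP, norm_smul, Real.norm_of_nonneg (Real.rpow_nonneg ht.le (1 / σ)),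
    this, mul_one]

lemma radSym_symA_scale (hσ : 0 < σ) {t : ℝ} (ht : 0 < t) :
    (radSym (symA σ t) : Space N → ℂ) =
      fun ξ => ((t⁻¹ : ℝ) : ℂ) * radSym (symA σ 1) (t ^ (1 / σ) • ξ) := by
  funext ξ
  have : (2 * π * (t ^ (1 / σ) * ‖ξ‖)) ^ σ = (2 * π * ‖ξ‖) ^ σ * t := by
    rw [mul_left_comm, Real.mul_rpow (by positivity) (by positivity), ← Real.rpow_mul ht.le,
      one_div_mul_cancel hσ.ne', Real.rpow_one, mul_comm]
  simp only [radSym, radFun_symA, norm_smul, Real.norm_of_nonneg (Real.rpow_nonneg ht.le (1 / σ)),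
    this, mul_one, ← Complex.ofReal_mul]
  congr 1
  field_simp

lemma radKer_symP_scale (hσ : 0 < σ) {t : ℝ} (ht : 0 < t) (x : Space N) :
    radKer (symP σ t) x = (((t ^ (1 / σ)) ^ N)⁻¹) * radKer (symP σ 1) ((t ^ (1 / σ))⁻¹ • x) := by
  rw [radKer, radSym_symP_scale hσ ht, fourierInv_comp_smul _ (Real.rpow_pos_of_pos ht _),
    Complex.smul_re, smul_eq_mul, radKer]

lemma radKer_symA_scale (hσ : 0 < σ) {t : ℝ} (ht : 0 < t) (x : Space N) :
    radKer (symA σ t) x =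
      t⁻¹ * ((((t ^ (1 / σ)) ^ N)⁻¹) * radKer (symA σ 1) ((t ^ (1 / σ))⁻¹ • x)) := by
  have h : 𝓕⁻ (fun ξ : Space N => ((t⁻¹ : ℝ) : ℂ) * radSym (symA σ 1) (t ^ (1 / σ) • ξ)) x =
      ((t⁻¹ : ℝ) : ℂ) * 𝓕⁻ (fun ξ : Space N => radSym (symA σ 1) (t ^ (1 / σ) • ξ)) x := by
    rw [fourierInv_eq, fourierInv_eq, ← integral_const_mul]
    refine integral_congr_ae (.of_forall fun ξ => ?_)
    simp only [Circle.smul_def, smul_eq_mul]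
    ring
  rw [radKer, radSym_symA_scale hσ ht, h, fourierInv_comp_smul _ (Real.rpow_pos_of_pos ht _),
    Complex.re_ofReal_mul, Complex.smul_re, smul_eq_mul, radKer]

section bounds
variable (hN : 1 ≤ N) (hσ : 0 < σ)
include hN hσ

/-- For `t = 1` this is the decay theorem with `β = σ/2`; self-similarity gives the other times with
the same constant. -/
lemma exists_abs_radKer_symP_le : ∃ C : ℝ, 0 ≤ C ∧ ∀ t : ℝ, 0 < t → ∀ x : Space N,
    |radKer (symP σ t) x| ≤ C * dilRho σ (t ^ (1 / σ)) x := by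
  obtain ⟨n, hn⟩ := exists_nat_gt ((N : ℝ) + 2 * (σ / 2))
  have hn0 : n ≠ 0 := by rintro rfl; have : (0:ℝ) ≤ N := N.cast_nonneg
                         push_cast at hn; linarith
  obtain ⟨B, B', hB, hB', h⟩ := isSymbol_symP hσ n (N + 1)
  obtain ⟨C, hC0, hC⟩ := exists_fourier_bound hN (by positivity) hn hn0
    (by have : (0:ℝ) ≤ N := N.cast_nonneg
        linarith) hB hB' h
  refine ⟨C, hC0, fun t ht x => ?_⟩
  have hs : 0 < t ^ (1 / σ) := Real.rpow_pos_of_pos ht _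
  rw [radKer_symP_scale hσ ht, abs_mul, abs_of_pos (by positivity), dilRho, mul_left_comm]
  gcongr
  rw [abs_radKer_le]
  refine (hC _).trans (le_of_eq ?_)
  rw [rho, mul_div_cancel₀ _ (two_ne_zero)]

lemma exists_abs_radKer_symA_le : ∃ C : ℝ, 0 ≤ C ∧ ∀ t : ℝ, 0 < t → ∀ x : Space N,
    |radKer (symA σ t) x| ≤ C * (t⁻¹ * dilRho σ (t ^ (1 / σ)) x) := by
  obtain ⟨n, hn⟩ := exists_nat_gt ((N : ℝ) + 2 * (σ / 2))
  have hn0 : n ≠ 0 := by rintro rfl; have : (0:ℝ) ≤ N := N.cast_nonneg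
                         push_cast at hn; linarith
  obtain ⟨B, B', hB, hB', h⟩ := isSymbol_symA (M := N + 1) hσ n (by positivity)
  obtain ⟨C, hC0, hC⟩ := exists_fourier_bound hN (by positivity) hn hn0
    (by have : (0:ℝ) ≤ N := N.cast_nonneg
        linarith) hB hB' h
  refine ⟨C, hC0, fun t ht x => ?_⟩
  have hs : 0 < t ^ (1 / σ) := Real.rpow_pos_of_pos ht _
  rw [radKer_symA_scale hσ ht, abs_mul, abs_mul, abs_of_pos (inv_pos.2 ht),
    abs_of_pos (inv_pos.2 (pow_pos hs N)), dilRho]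
  have h1 : |radKer (symA σ 1) ((t ^ (1 / σ))⁻¹ • x)| ≤ C * rho σ ((t ^ (1 / σ))⁻¹ • x) := by
    rw [abs_radKer_le]
    refine (hC _).trans (le_of_eq ?_)
    rw [rho, mul_div_cancel₀ _ (two_ne_zero)]
  calc _ ≤ t⁻¹ * (((t ^ (1 / σ)) ^ N)⁻¹ * (C * rho σ ((t ^ (1 / σ))⁻¹ • x))) := by gcongr
    _ = _ := by ring

lemma integrable_radSym_symP {t : ℝ} (ht : 0 < t) : Integrable (radSym (symP σ t) : Space N → ℂ) := by
  obtain ⟨B, B', hB, hB', h⟩ := isSymbol_symP hσ 0 (N + 1)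
  have := h.integrable_radSym hN hB' (by have : (0:ℝ) ≤ N := N.cast_nonneg
                                         linarith)
  rw [radSym_symP_scale hσ ht]
  exact this.comp_smul (Real.rpow_pos_of_pos ht _).ne'

lemma integrable_radSym_symA {t : ℝ} (ht : 0 < t) : Integrable (radSym (symA σ t) : Space N → ℂ) := by
  obtain ⟨B, B', hB, hB', h⟩ := isSymbol_symA (M := N + 1) hσ 0 (by positivity)
  have := h.integrable_radSym hN hB' (by have : (0:ℝ) ≤ N := N.cast_nonneg
                                         linarith)
  rw [radSym_symA_scale hσ ht]
  exact (this.comp_smul (Real.rpow_pos_of_pos ht _).ne').const_mul _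

end bounds

lemma integrable_dilRho (hσ : 0 < σ) {s : ℝ} (hs : 0 < s) : Integrable (dilRho σ s : Space N → ℝ) :=
  ((integrable_rho hσ).comp_smul (inv_ne_zero hs.ne')).const_mul _

lemma integral_dilRho_mul {s : ℝ} (hs : 0 < s) (g : Space N → ℝ) :
    ∫ x : Space N, dilRho σ s x * g (s⁻¹ • x) = ∫ x : Space N, rho σ x * g x := by
  have h := Measure.integral_comp_inv_smul_of_nonneg (μ := (volume : Measure (Space N)))
    (fun x => rho σ x * g x) hs.le
  rw [finrank_euclideanSpace, Fintype.card_fin] at h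
  simp only [dilRho, mul_assoc]
  rw [integral_const_mul, h, smul_eq_mul, inv_mul_cancel_left₀ (by positivity)]

lemma integral_dilRho {s : ℝ} (hs : 0 < s) :
    ∫ x : Space N, dilRho σ s x = ∫ x : Space N, rho σ x := by
  simpa using integral_dilRho_mul (σ := σ) hs (fun _ : Space N => 1)

lemma dilRho_le_rho (hσ : 0 < σ) {s : ℝ} (hs : 0 < s) (x : Space N) :
    dilRho σ s x ≤ ((s ^ N)⁻¹ + s ^ σ) * rho σ x := by
  have hd : 0 ≤ (N : ℝ) + σ := by positivity
  have e : ‖s⁻¹ • x‖ = ‖x‖ / s := by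
    rw [norm_smul, norm_inv, Real.norm_of_nonneg hs.le, inv_mul_eq_div]
  rw [add_mul]
  rcases le_total s 1 with h | h
  · have h1 : rho σ (s⁻¹ • x) ≤ rho σ x := by
      refine Real.rpow_le_rpow_of_nonpos (by positivity) ?_ (by linarith)
      rw [e]
      gcongr
      exact le_div_self (norm_nonneg _) hs h
    have h2 : 0 ≤ s ^ σ * rho σ x := mul_nonneg (by positivity) (rho_nonneg _)
    have h3 : dilRho σ s x ≤ (s ^ N)⁻¹ * rho σ x := by unfold dilRho; gcongr
    linarith
  · have h1 : rho σ (s⁻¹ • x) ≤ s ^ ((N : ℝ) + σ) * rho σ x := by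
      unfold rho
      rw [e, Real.rpow_neg (by positivity), Real.rpow_neg (by positivity), ← div_eq_mul_inv,
        inv_eq_one_div, div_le_div_iff₀ (by positivity) (by positivity), one_mul,
        ← Real.mul_rpow (by positivity) (by positivity)]
      refine Real.rpow_le_rpow (by positivity) ?_ hd
      have : s * (1 + ‖x‖ / s) = s + ‖x‖ := by field_simp
      linarith
    have h2 : 0 ≤ (s ^ N)⁻¹ * rho σ x := mul_nonneg (by positivity) (rho_nonneg _)
    have h3 : dilRho σ s x ≤ (s ^ N)⁻¹ * (s ^ ((N : ℝ) + σ) * rho σ x) := by unfold dilRho; gcongr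
    rw [Real.rpow_add hs, Real.rpow_natCast, ← mul_assoc, inv_mul_cancel_left₀ (by positivity)] at h3
    linarith

/-- Away from the origin the dilated weight gains `s^σ`. For `s = t^{1/σ}` this is a factor `t`,
which cancels the `t^{-1}` in the bound for `A_σ`. -/
lemma dilRho_le_of_one_le_norm (hσ : 0 < σ) {s : ℝ} (hs : 0 < s) {x : Space N} (hx : 1 ≤ ‖x‖) :
    dilRho σ s x ≤ 2 ^ ((N : ℝ) + σ) * (s ^ σ * rho σ x) := by
  have hd : 0 ≤ (N : ℝ) + σ := by positivity
  have e : ‖s⁻¹ • x‖ = ‖x‖ / s := by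
    rw [norm_smul, norm_inv, Real.norm_of_nonneg hs.le, inv_mul_eq_div]
  have h1 : rho σ (s⁻¹ • x) ≤ 2 ^ ((N : ℝ) + σ) * (s ^ ((N : ℝ) + σ) * rho σ x) := by
    unfold rho
    rw [e, Real.rpow_neg (by positivity), Real.rpow_neg (by positivity), ← mul_assoc,
      ← Real.mul_rpow (by positivity) (by positivity), ← div_eq_mul_inv,
      inv_eq_one_div, div_le_div_iff₀ (by positivity) (by positivity), one_mul,
      ← Real.mul_rpow (by positivity) (by positivity)]
    refine Real.rpow_le_rpow (by positivity) ?_ hd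
    have : 2 * s * (1 + ‖x‖ / s) = 2 * s + 2 * ‖x‖ := by field_simp
    linarith
  have h3 : dilRho σ s x ≤ (s ^ N)⁻¹ * (2 ^ ((N : ℝ) + σ) * (s ^ ((N : ℝ) + σ) * rho σ x)) := by
    unfold dilRho; gcongr
  refine h3.trans (le_of_eq ?_)
  rw [Real.rpow_add hs, Real.rpow_natCast]
  field_simp

end kernels

/-! ### Weighted estimates, moments and cancellation for the kernels. -/

section kernelBounds
variable {N : ℕ} {σ : ℝ}

open Real

lemma kernelP_eq (x : Space N) (t : ℝ) : kernelP σ x t = radKer (symP σ t) x := by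
  unfold kernelP radKer radSym
  simp_rw [radFun_symP]

lemma integrable_radKer_symP (hN : 1 ≤ N) (hσ : 0 < σ) {t : ℝ} (ht : 0 < t) :
    Integrable (radKer (symP σ t) : Space N → ℝ) := by
  obtain ⟨C, hC0, hC⟩ := exists_abs_radKer_symP_le hN hσ
  exact ((integrable_dilRho hσ (Real.rpow_pos_of_pos ht (1 / σ))).const_mul C).mono'
    (continuous_radKer (integrable_radSym_symP hN hσ ht)).aestronglyMeasurable
    (.of_forall fun x => hC t ht x)

lemma integrable_radKer_symA (hN : 1 ≤ N) (hσ : 0 < σ) {t : ℝ} (ht : 0 < t) :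
    Integrable (radKer (symA σ t) : Space N → ℝ) := by
  obtain ⟨C, hC0, hC⟩ := exists_abs_radKer_symA_le hN hσ
  exact (((integrable_dilRho hσ (Real.rpow_pos_of_pos ht (1 / σ))).const_mul t⁻¹).const_mul C).mono'
    (continuous_radKer (integrable_radSym_symA hN hσ ht)).aestronglyMeasurable
    (.of_forall fun x => hC t ht x)

lemma kernelA_eq (hN : 1 ≤ N) (hσ : 0 < σ) (x : Space N) {t : ℝ} (ht : 0 < t) :
    kernelA σ x t = radKer (symA σ t) x := by
  unfold kernelA fracLaplacian
  simp_rw [kernelP_eq]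
  rw [fourier_radKer (continuous_radSym_symP hσ t) (integrable_radSym_symP hN hσ ht)
    (integrable_radKer_symP hN hσ ht), radKer]
  have e : (radSym (symA σ t) : Space N → ℂ) =
      fun ξ => (((2 * π * ‖ξ‖) ^ σ : ℝ) : ℂ) * radSym (symP σ t) ξ := by
    funext ξ
    rw [radSym, radSym, radFun_symA_eq, Complex.ofReal_mul]
  rw [e]

lemma rpow_one_div_rpow (hσ : 0 < σ) {t : ℝ} (ht : 0 < t) : (t ^ (1 / σ)) ^ σ = t := by
  rw [← Real.rpow_mul ht.le, one_div_mul_cancel hσ.ne', Real.rpow_one]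

/-- Convolution with the dilated weight preserves the weight. -/
lemma dilRho_mul_rho_le (hσ : 0 < σ) {s : ℝ} (hs : 0 < s) (x y : Space N) :
    dilRho σ s (x - y) * rho σ y ≤
      2 ^ ((N : ℝ) + σ) * (rho σ x * dilRho σ s (x - y) + s ^ σ * (rho σ (x - y) * rho σ y)) := by
  have hd : 0 ≤ (N : ℝ) + σ := by positivity
  have h0 := dilRho_nonneg (σ := σ) hs (x - y)
  have h1 := rho_nonneg (σ := σ) x
  have h2 := rho_nonneg (σ := σ) y
  have h3 := rho_nonneg (σ := σ) (x - y)
  rcases le_total ‖x - y‖ 1 with h | h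
  · have h4 : rho σ y ≤ 2 ^ ((N : ℝ) + σ) * rho σ x := by
      have := rho_sub_le hσ x (x - y)
      rw [sub_sub_cancel] at this
      refine this.trans ?_
      gcongr
      linarith
    calc _ ≤ dilRho σ s (x - y) * (2 ^ ((N : ℝ) + σ) * rho σ x) := by gcongr
      _ = 2 ^ ((N : ℝ) + σ) * (rho σ x * dilRho σ s (x - y)) := by ring
      _ ≤ _ := by gcongr; exact le_add_of_nonneg_right (by positivity)
  · calc _ ≤ (2 ^ ((N : ℝ) + σ) * (s ^ σ * rho σ (x - y))) * rho σ y := by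
          gcongr; exact dilRho_le_of_one_le_norm hσ hs h
      _ = 2 ^ ((N : ℝ) + σ) * (s ^ σ * (rho σ (x - y) * rho σ y)) := by ring
      _ ≤ _ := by gcongr; exact le_add_of_nonneg_left (by positivity)

/-- The heat semigroup preserves the weight on bounded time intervals. The part with `|x - y| ≤ 1`
is controlled by the mass of the dilated weight, which does not depend on `t`; the tail is at most a
multiple of `t (ρ * ρ)(x)`. -/
lemma exists_heat_bound (hN : 1 ≤ N) (hσ : 0 < σ) (T : ℝ) : ∃ C : ℝ, 0 ≤ C ∧
    ∀ t : ℝ, 0 < t → t ≤ T → ∀ x : Space N,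
      Integrable (fun y : Space N => |radKer (symP σ t) (x - y)| * rho σ y) ∧
        ∫ y : Space N, |radKer (symP σ t) (x - y)| * rho σ y ≤ C * rho σ x := by
  obtain ⟨C, hC0, hC⟩ := exists_abs_radKer_symP_le hN hσ
  have hI : 0 ≤ ∫ x : Space N, rho σ x := integral_nonneg fun _ => rho_nonneg _
  have hR := rhoConst_nonneg (N := N) (σ := σ)
  refine ⟨C * (2 ^ ((N : ℝ) + σ) * ((∫ x : Space N, rho σ x) + |T| * rhoConst N σ)), by positivity,
    fun t ht htT x => ?_⟩
  set s := t ^ (1 / σ) with hs_def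
  have hs : 0 < s := Real.rpow_pos_of_pos ht _
  have hsσ : s ^ σ = t := rpow_one_div_rpow hσ ht
  have hi : Integrable (fun y : Space N => C * (2 ^ ((N : ℝ) + σ) *
      (rho σ x * dilRho σ s (x - y) + s ^ σ * (rho σ (x - y) * rho σ y)))) :=
    (((((integrable_dilRho hσ hs).comp_sub_left x).const_mul _).add
      ((integrable_rho_mul_rho hσ x).const_mul _)).const_mul _).const_mul _
  have hb : ∀ y : Space N, |radKer (symP σ t) (x - y)| * rho σ y ≤ C * (2 ^ ((N : ℝ) + σ) *
      (rho σ x * dilRho σ s (x - y) + s ^ σ * (rho σ (x - y) * rho σ y))) := fun y => by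
    calc _ ≤ (C * dilRho σ s (x - y)) * rho σ y := by
          gcongr
          · exact rho_nonneg y
          · exact hC t ht _
      _ = C * (dilRho σ s (x - y) * rho σ y) := by ring
      _ ≤ _ := mul_le_mul_of_nonneg_left (dilRho_mul_rho_le hσ hs x y) hC0
  have hi2 : Integrable (fun y : Space N => |radKer (symP σ t) (x - y)| * rho σ y) := by
    refine hi.mono' ?_ (.of_forall fun y => ?_)
    · exact (((continuous_radKer (integrable_radSym_symP hN hσ ht)).comp (by fun_prop)).abs.mul
        continuous_rho).aestronglyMeasurable
    · rw [Real.norm_of_nonneg (mul_nonneg (abs_nonneg _) (rho_nonneg _))]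
      exact hb y
  refine ⟨hi2, (integral_mono hi2 hi hb).trans ?_⟩
  rw [integral_const_mul, integral_const_mul, integral_add
    (((integrable_dilRho hσ hs).comp_sub_left x).const_mul _)
    ((integrable_rho_mul_rho hσ x).const_mul _), integral_const_mul, integral_const_mul,
    integral_sub_left_eq_self (fun y => dilRho σ s y) volume x, integral_dilRho hs, hsσ]
  have h1 := integral_rho_mul_rho_le hσ x
  have h2 := rho_nonneg (σ := σ) x
  have h3 : t ≤ |T| := htT.trans (le_abs_self T)
  calc _ ≤ C * (2 ^ ((N : ℝ) + σ) * (rho σ x * (∫ x : Space N, rho σ x)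
          + |T| * (rhoConst N σ * rho σ x))) := by
        refine mul_le_mul_of_nonneg_left (mul_le_mul_of_nonneg_left
          (add_le_add le_rfl (mul_le_mul h3 h1 ?_ (abs_nonneg T))) (by positivity)) hC0
        exact integral_nonneg fun y => mul_nonneg (rho_nonneg _) (rho_nonneg _)
    _ = _ := by ring

lemma exists_abs_radKer_symP_le_rho (hN : 1 ≤ N) (hσ : 0 < σ) {t : ℝ} (ht : 0 < t) :
    ∃ C : ℝ, 0 ≤ C ∧ ∀ x : Space N, |radKer (symP σ t) x| ≤ C * rho σ x := by
  obtain ⟨C, hC0, hC⟩ := exists_abs_radKer_symP_le hN hσ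
  have hs : 0 < t ^ (1 / σ) := Real.rpow_pos_of_pos ht _
  refine ⟨C * (((t ^ (1 / σ)) ^ N)⁻¹ + (t ^ (1 / σ)) ^ σ), by positivity, fun x => ?_⟩
  refine (hC t ht x).trans ?_
  rw [mul_assoc]
  gcongr
  exact dilRho_le_rho hσ hs x

lemma exists_abs_radKer_symA_le_rho (hN : 1 ≤ N) (hσ : 0 < σ) {t : ℝ} (ht : 0 < t) :
    ∃ C : ℝ, 0 ≤ C ∧ ∀ x : Space N, |radKer (symA σ t) x| ≤ C * rho σ x := by
  obtain ⟨C, hC0, hC⟩ := exists_abs_radKer_symA_le hN hσ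
  have hs : 0 < t ^ (1 / σ) := Real.rpow_pos_of_pos ht _
  refine ⟨C * (t⁻¹ * (((t ^ (1 / σ)) ^ N)⁻¹ + (t ^ (1 / σ)) ^ σ)), by positivity, fun x => ?_⟩
  refine (hC t ht x).trans ?_
  rw [mul_assoc, mul_assoc]
  gcongr
  exact dilRho_le_rho hσ hs x

lemma exists_abs_radKer_symA_le_far (hN : 1 ≤ N) (hσ : 0 < σ) :
    ∃ C : ℝ, 0 ≤ C ∧ ∀ t : ℝ, 0 < t → ∀ x : Space N, 1 ≤ ‖x‖ →
      |radKer (symA σ t) x| ≤ C * rho σ x := by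
  obtain ⟨C, hC0, hC⟩ := exists_abs_radKer_symA_le hN hσ
  refine ⟨C * 2 ^ ((N : ℝ) + σ), by positivity, fun t ht x hx => ?_⟩
  have hs : 0 < t ^ (1 / σ) := Real.rpow_pos_of_pos ht _
  calc _ ≤ _ := hC t ht x
    _ ≤ C * (t⁻¹ * (2 ^ ((N : ℝ) + σ) * ((t ^ (1 / σ)) ^ σ * rho σ x))) := by
        gcongr; exact dilRho_le_of_one_le_norm hσ hs hx
    _ = _ := by rw [rpow_one_div_rpow hσ ht]; field_simp

lemma integrable_rho_mul_norm_rpow {a : ℝ} (ha : 0 ≤ a) (haσ : a < σ) :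
    Integrable (fun x : Space N => rho σ x * ‖x‖ ^ a) := by
  have h : Integrable (fun x : Space N => (1 + ‖x‖) ^ (-((N : ℝ) + σ - a))) :=
    integrable_one_add_norm (by simp; linarith)
  refine h.mono' ((continuous_rho.mul (continuous_norm.rpow_const fun x =>
    Or.inr ha)).aestronglyMeasurable) (.of_forall fun x => ?_)
  rw [Real.norm_of_nonneg (mul_nonneg (rho_nonneg _) (by positivity))]
  have e : (1 + ‖x‖) ^ (-((N : ℝ) + σ - a)) = rho σ x * (1 + ‖x‖) ^ a := by
    rw [rho, ← Real.rpow_add (by positivity)]; congr 1; ring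
  rw [e]
  have := rho_nonneg (σ := σ) x
  gcongr
  linarith

/-- The moments of the kernel `A_σ`. -/
lemma exists_moment_symA (hN : 1 ≤ N) (hσ : 0 < σ) {a : ℝ} (ha : 0 ≤ a) (haσ : a < σ) :
    ∃ C : ℝ, 0 ≤ C ∧ ∀ t : ℝ, 0 < t →
      Integrable (fun x : Space N => |radKer (symA σ t) x| * ‖x‖ ^ a) ∧
        ∫ x : Space N, |radKer (symA σ t) x| * ‖x‖ ^ a ≤ C * t ^ (a / σ - 1) := by
  obtain ⟨C, hC0, hC⟩ := exists_abs_radKer_symA_le hN hσ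
  have hI : 0 ≤ ∫ x : Space N, rho σ x * ‖x‖ ^ a :=
    integral_nonneg fun _ => mul_nonneg (rho_nonneg _) (by positivity)
  refine ⟨C * ∫ x : Space N, rho σ x * ‖x‖ ^ a, by positivity, fun t ht => ?_⟩
  set s := t ^ (1 / σ) with hs_def
  have hs : 0 < s := Real.rpow_pos_of_pos ht _
  have e : ∀ x : Space N, dilRho σ s x * ‖x‖ ^ a = s ^ a * (dilRho σ s x * ‖s⁻¹ • x‖ ^ a) := by
    intro x
    rw [norm_smul, Real.mul_rpow (by positivity) (by positivity), norm_inv,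
      Real.norm_of_nonneg hs.le, Real.inv_rpow hs.le]
    have : s ^ a ≠ 0 := (Real.rpow_pos_of_pos hs a).ne'
    field_simp
  have hi0 : Integrable (fun x : Space N => dilRho σ s x * ‖s⁻¹ • x‖ ^ a) := by
    have := ((integrable_rho_mul_norm_rpow (N := N) ha haσ).comp_smul
      (inv_ne_zero hs.ne')).const_mul (s ^ N)⁻¹
    refine this.congr (.of_forall fun x => ?_)
    simp only [dilRho]
    ring
  have hi : Integrable (fun x : Space N => dilRho σ s x * ‖x‖ ^ a) := by
    simp_rw [e]
    exact hi0.const_mul _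
  have hb : ∀ x : Space N, |radKer (symA σ t) x| * ‖x‖ ^ a ≤
      C * (t⁻¹ * (dilRho σ s x * ‖x‖ ^ a)) := fun x => by
    calc _ ≤ C * (t⁻¹ * dilRho σ s x) * ‖x‖ ^ a := by gcongr; exact hC t ht x
      _ = _ := by ring
  have hi2 : Integrable (fun x : Space N => |radKer (symA σ t) x| * ‖x‖ ^ a) := by
    refine ((hi.const_mul t⁻¹).const_mul C).mono' ?_ (.of_forall fun x => ?_)
    · exact ((continuous_radKer (integrable_radSym_symA hN hσ ht)).abs.mul
        (continuous_norm.rpow_const fun x => Or.inr ha)).aestronglyMeasurable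
    · rw [Real.norm_of_nonneg (by positivity)]
      exact hb x
  refine ⟨hi2, (integral_mono hi2 ((hi.const_mul t⁻¹).const_mul C) hb).trans (le_of_eq ?_)⟩
  rw [integral_const_mul, integral_const_mul]
  simp_rw [e]
  rw [integral_const_mul, integral_dilRho_mul hs (fun x : Space N => ‖x‖ ^ a),
    Real.rpow_sub_one ht.ne', hs_def, ← Real.rpow_mul ht.le]
  have : 1 / σ * a = a / σ := by ring
  rw [this]
  field_simp

/-- The integral is the value of the symbol at the origin. This cancellation makes the source term
converge. -/
lemma integral_radKer_symA (hN : 1 ≤ N) (hσ : 0 < σ) {t : ℝ} (ht : 0 < t) :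
    ∫ x : Space N, radKer (symA σ t) x = 0 := by
  have h := congrFun (fourier_radKer (continuous_radSym_symA hσ t) (integrable_radSym_symA hN hσ ht)
    (integrable_radKer_symA hN hσ ht)) 0
  rw [fourier_eq] at h
  simp only [inner_zero_right, neg_zero, AddChar.map_zero_eq_one, one_smul, radSym, radFun_symA,
    norm_zero, mul_zero, Real.zero_rpow hσ.ne', zero_mul, Complex.ofReal_zero] at h
  rw [integral_complex_ofReal] at h
  exact_mod_cast h

lemma measurable_radKer_symA (hσ : 0 < σ) :
    Measurable (fun p : Space N × ℝ => radKer (symA σ p.2) p.1) := by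
  unfold radKer radSym
  refine Complex.measurable_re.comp ?_
  simp_rw [fourierInv_eq, radFun_symA, Circle.smul_def, smul_eq_mul]
  refine (StronglyMeasurable.integral_prod_right (f := fun (p : Space N × ℝ) (ξ : Space N) =>
    ((Real.fourierChar (inner ℝ ξ p.1) : Circle) : ℂ) *
      (((2 * π * ‖ξ‖) ^ σ * Real.exp (-((2 * π * ‖ξ‖) ^ σ * p.2)) : ℝ) : ℂ)) ?_).measurable
  refine Continuous.stronglyMeasurable ?_
  have hc : Continuous fun p : (Space N × ℝ) × Space N => (2 * π * ‖p.2‖) ^ σ :=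
    (continuous_const.mul (continuous_norm.comp continuous_snd)).rpow_const fun x => Or.inr hσ.le
  refine Continuous.mul ?_ ?_
  · exact continuous_induced_dom.comp (Real.continuous_fourierChar.comp
      (continuous_snd.inner (continuous_fst.comp continuous_fst)))
  · refine Complex.continuous_ofReal.comp (hc.mul (Real.continuous_exp.comp ?_))
    exact (hc.mul (continuous_snd.comp continuous_fst)).neg

end kernelBounds

/-! ### Fractional powers of the Laplacian and the heat semigroup on test functions. -/

section fracPow
variable {N : ℕ} {σ : ℝ}

open Real SchwartzMap

/-- The symbol `r^a exp (-r^{σ/2} t)` of `(-Δ)^a e^{-t (-Δ)^{σ/2}}`, with `r = |2πξ|²`. -/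
noncomputable def symE (σ a t : ℝ) (r : ℝ) : ℝ := r ^ a * Real.exp (-(r ^ (σ / 2) * t))

lemma symE_half (σ t : ℝ) : symE σ (σ / 2) t = symA σ t := rfl

lemma continuous_radSym_symE (hσ : 0 < σ) {a : ℝ} (ha : 0 ≤ a) :
    Continuous (fun p : ℝ × Space N => radSym (symE σ a p.1) p.2) := by
  unfold radSym radFun symE
  have h : Continuous fun p : ℝ × Space N => (2 * π * ‖p.2‖) ^ 2 := by fun_prop
  refine Complex.continuous_ofReal.comp (Continuous.mul ?_ (Real.continuous_exp.comp ?_))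
  · exact h.rpow_const fun x => Or.inr ha
  · exact ((h.rpow_const fun x => Or.inr (by positivity)).mul continuous_fst).neg

lemma norm_radSym_symE_le {a t : ℝ} (ht : 0 ≤ t) (ξ : Space N) :
    ‖radSym (symE σ a t) ξ‖ ≤ ((2 * π * ‖ξ‖) ^ 2) ^ a := by
  have h0 : 0 ≤ ((2 * π * ‖ξ‖) ^ 2) ^ a := by positivity
  rw [radSym, Complex.norm_real, radFun, symE, Real.norm_eq_abs, abs_of_nonneg (by positivity)]
  refine mul_le_of_le_one_right h0 (Real.exp_le_one_iff.2 ?_)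
  have : 0 ≤ ((2 * π * ‖ξ‖) ^ 2) ^ (σ / 2) * t := by positivity
  linarith

/-- `(-Δ)^a e^{-t (-Δ)^{σ/2}} φ`, complex valued. -/
noncomputable def heatC (σ a t : ℝ) (φ : Space N → ℝ) (x : Space N) : ℂ :=
  𝓕⁻ (fun ξ => radSym (symE σ a t) ξ * 𝓕 (fun y => (φ y : ℂ)) ξ) x

/-- `(-Δ)^a e^{-t (-Δ)^{σ/2}} φ` -/
noncomputable def heatMul (σ a t : ℝ) (φ : Space N → ℝ) (x : Space N) : ℝ :=
  (heatC σ a t φ x).re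

lemma fracLaplacian_eq (φ : Space N → ℝ) (x : Space N) :
    fracLaplacian σ φ x = heatMul σ (σ / 2) 0 φ x := by
  unfold fracLaplacian heatMul heatC radSym
  simp_rw [symE_half, radFun_symA]
  simp

lemma fourier_real_conj (φ : Space N → ℝ) (ξ : Space N) :
    (starRingEnd ℂ) (𝓕 (fun y => (φ y : ℂ)) (-ξ)) = 𝓕 (fun y => (φ y : ℂ)) ξ := by
  rw [fourier_eq', fourier_eq', ← integral_conj]
  refine integral_congr_ae (.of_forall fun y => ?_)
  simp only [smul_eq_mul, map_mul, ← Complex.exp_conj, Complex.conj_ofReal, Complex.conj_I,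
    inner_neg_right]
  congr 2
  push_cast
  ring

lemma heatC_eq_ofReal (a t : ℝ) (φ : Space N → ℝ) (x : Space N) :
    heatC σ a t φ x = (heatMul σ a t φ x : ℂ) := by
  have h : (starRingEnd ℂ) (heatC σ a t φ x) = heatC σ a t φ x := by
    unfold heatC
    rw [fourierInv_eq', ← integral_conj]
    rw [← integral_neg_eq_self]
    refine integral_congr_ae (.of_forall fun ξ => ?_)
    simp only [smul_eq_mul, map_mul, fourier_real_conj, ← Complex.exp_conj, Complex.conj_ofReal,
      Complex.conj_I, inner_neg_left, radSym, radFun, norm_neg]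
    congr 2
    push_cast
    ring
  exact (Complex.conj_eq_iff_re.1 h).symm

/-- The Schwartz function defined by a test function. -/
noncomputable def toSchwartz {φ : Space N → ℝ} (hφ : ContDiff ℝ ∞ φ) (hc : HasCompactSupport φ) :
    𝓢(Space N, ℂ) :=
  HasCompactSupport.toSchwartzMap (f := fun x => (φ x : ℂ)) (hc.comp_left Complex.ofReal_zero)
    (Complex.ofRealCLM.contDiff.comp hφ)

lemma toSchwartz_apply {φ : Space N → ℝ} (hφ : ContDiff ℝ ∞ φ) (hc : HasCompactSupport φ) :
    (toSchwartz hφ hc : Space N → ℂ) = fun x => (φ x : ℂ) := rfl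

lemma sq_rpow_le_one_add {a : ℝ} (ha : 0 ≤ a) (ξ : Space N) :
    ((2 * π * ‖ξ‖) ^ 2) ^ a ≤ (2 * π) ^ (2 * a) * (1 + ‖ξ‖ ^ ⌈2 * a⌉₊) := by
  have e : ((2 * π * ‖ξ‖) ^ 2) ^ a = (2 * π) ^ (2 * a) * ‖ξ‖ ^ (2 * a) := by
    rw [← Real.rpow_natCast, ← Real.rpow_mul (by positivity), Real.mul_rpow (by positivity)
      (by positivity)]
    norm_num
  rw [e]
  gcongr
  rcases le_total ‖ξ‖ 1 with h | h
  · have h1 : ‖ξ‖ ^ (2 * a) ≤ 1 := Real.rpow_le_one (norm_nonneg _) h (by positivity)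
    have h2 : 0 ≤ ‖ξ‖ ^ ⌈2 * a⌉₊ := by positivity
    linarith
  · have h1 : ‖ξ‖ ^ (2 * a) ≤ ‖ξ‖ ^ ((⌈2 * a⌉₊ : ℕ) : ℝ) :=
      Real.rpow_le_rpow_of_exponent_le h (Nat.le_ceil _)
    rw [Real.rpow_natCast] at h1
    linarith

section testFunction
variable {φ : Space N → ℝ} (hφ : ContDiff ℝ ∞ φ) (hc : HasCompactSupport φ)
include hφ hc

lemma continuous_fourier_test : Continuous (𝓕 (fun y => (φ y : ℂ)) : Space N → ℂ) :=
  (𝓕 (toSchwartz hφ hc)).continuous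

lemma integrable_pow_mul_fourier_test {a : ℝ} (ha : 0 ≤ a) :
    Integrable (fun ξ : Space N => ((2 * π * ‖ξ‖) ^ 2) ^ a * ‖𝓕 (fun y => (φ y : ℂ)) ξ‖) := by
  have h0 := (𝓕 (toSchwartz hφ hc)).integrable_pow_mul volume 0
  have h1 := (𝓕 (toSchwartz hφ hc)).integrable_pow_mul volume ⌈2 * a⌉₊
  rw [SchwartzMap.fourier_coe, toSchwartz_apply] at h0 h1
  refine ((h0.add h1).const_mul ((2 * π) ^ (2 * a))).mono' ?_ (.of_forall fun ξ => ?_)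
  · refine (Continuous.mul ?_ (continuous_fourier_test hφ hc).norm).aestronglyMeasurable
    have h : Continuous fun ξ : Space N => (2 * π * ‖ξ‖) ^ 2 := by fun_prop
    exact h.rpow_const fun x => Or.inr ha
  · rw [Real.norm_of_nonneg (by positivity)]
    calc _ ≤ ((2 * π) ^ (2 * a) * (1 + ‖ξ‖ ^ ⌈2 * a⌉₊)) * ‖𝓕 (fun y => (φ y : ℂ)) ξ‖ := by
          gcongr; exact sq_rpow_le_one_add ha ξ
      _ = _ := by simp only [Pi.add_apply, pow_zero]; ring

lemma continuous_symE_mul_fourier (hσ : 0 < σ) {a : ℝ} (ha : 0 ≤ a) (t : ℝ) :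
    Continuous (fun ξ : Space N => radSym (symE σ a t) ξ * 𝓕 (fun y => (φ y : ℂ)) ξ) :=
  ((continuous_radSym_symE hσ ha).comp (continuous_const.prodMk continuous_id)).mul
    (continuous_fourier_test hφ hc)

omit hφ hc in
lemma norm_symE_mul_fourier_le {a t : ℝ} (ht : 0 ≤ t) (ξ : Space N) :
    ‖radSym (symE σ a t) ξ * 𝓕 (fun y => (φ y : ℂ)) ξ‖ ≤
      ((2 * π * ‖ξ‖) ^ 2) ^ a * ‖𝓕 (fun y => (φ y : ℂ)) ξ‖ := by
  rw [norm_mul]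
  gcongr
  exact norm_radSym_symE_le ht ξ

lemma integrable_symE_mul_fourier (hσ : 0 < σ) {a t : ℝ} (ha : 0 ≤ a) (ht : 0 ≤ t) :
    Integrable (fun ξ : Space N => radSym (symE σ a t) ξ * 𝓕 (fun y => (φ y : ℂ)) ξ) :=
  (integrable_pow_mul_fourier_test hφ hc ha).mono'
    (continuous_symE_mul_fourier hφ hc hσ ha t).aestronglyMeasurable
    (.of_forall fun ξ => norm_symE_mul_fourier_le ht ξ)

lemma heatMul_zero_zero (x : Space N) : heatMul σ 0 0 φ x = φ x := by
  have e : (fun ξ : Space N => radSym (symE σ 0 0) ξ * 𝓕 (fun y => (φ y : ℂ)) ξ) =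
      𝓕 (fun y => (φ y : ℂ)) := by
    funext ξ
    simp [radSym, radFun, symE]
  have h : 𝓕⁻ (𝓕 (toSchwartz hφ hc)) x = toSchwartz hφ hc x := by
    rw [FourierTransform.fourierInv_fourier_eq]
  rw [heatMul, heatC, e]
  rw [SchwartzMap.fourierInv_coe, SchwartzMap.fourier_coe, toSchwartz_apply] at h
  rw [h, Complex.ofReal_re]

/-- Joint continuity of the heat evolution of a test function. -/
lemma continuous_heatC (hσ : 0 < σ) {a : ℝ} (ha : 0 ≤ a) :
    Continuous (fun p : Space N × ℝ => heatC σ a |p.2| φ p.1) := by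
  unfold heatC
  simp_rw [fourierInv_eq, Circle.smul_def, smul_eq_mul]
  refine continuous_of_dominated (bound := fun ξ => ((2 * π * ‖ξ‖) ^ 2) ^ a *
    ‖𝓕 (fun y => (φ y : ℂ)) ξ‖) (fun p => ?_) (fun p => .of_forall fun ξ => ?_)
    (integrable_pow_mul_fourier_test hφ hc ha) (.of_forall fun ξ => ?_)
  · have h1 : Continuous fun ξ : Space N => ((Real.fourierChar (inner ℝ ξ p.1) : Circle) : ℂ) :=
      continuous_induced_dom.comp (Real.continuous_fourierChar.comp
        (continuous_id.inner continuous_const))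
    exact (h1.mul (continuous_symE_mul_fourier hφ hc hσ ha |p.2|)).aestronglyMeasurable
  · rw [norm_mul, Circle.norm_coe, one_mul]
    exact norm_symE_mul_fourier_le (abs_nonneg _) ξ
  · have h1 : Continuous fun p : Space N × ℝ =>
        ((Real.fourierChar (inner ℝ ξ p.1) : Circle) : ℂ) :=
      continuous_induced_dom.comp (Real.continuous_fourierChar.comp
        (continuous_const.inner continuous_fst))
    have h2 : Continuous fun p : Space N × ℝ => radSym (symE σ a |p.2|) ξ :=
      Continuous.comp (g := fun q : ℝ × Space N => radSym (symE σ a q.1) q.2)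
        (f := fun p : Space N × ℝ => (|p.2|, ξ)) (continuous_radSym_symE hσ ha)
        (continuous_snd.abs.prodMk continuous_const)
    exact h1.mul (h2.mul continuous_const)

/-- Writing the time as `|t|` gives a continuous function on the whole of space-time: the
exponential factor stays bounded by `1`, which would fail for negative times. -/
lemma continuous_heatMul (hσ : 0 < σ) {a : ℝ} (ha : 0 ≤ a) :
    Continuous (fun p : Space N × ℝ => heatMul σ a |p.2| φ p.1) :=
  Complex.continuous_re.comp (continuous_heatC hφ hc hσ ha)

lemma continuous_heatMul_space (hσ : 0 < σ) {a : ℝ} (ha : 0 ≤ a) :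
    Continuous (heatMul σ a 0 φ) := by
  have h := (continuous_heatMul hφ hc hσ ha).comp
    (continuous_id.prodMk (continuous_const (y := (0 : ℝ))))
  simpa [Function.comp_def] using h

/-- Differentiating the heat evolution in time produces `(-Δ)^{σ/2}`; integrated form. -/
lemma heatMul_sub_eq_integral (hσ : 0 < σ) {a : ℝ} (ha : 0 ≤ a) {τ : ℝ} (hτ : 0 ≤ τ)
    (x : Space N) :
    heatMul σ a 0 φ x - heatMul σ a τ φ x = ∫ r in (0:ℝ)..τ, heatMul σ (a + σ / 2) r φ x := by
  have haσ : 0 ≤ a + σ / 2 := by positivity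
  have hC : heatC σ a 0 φ x - heatC σ a τ φ x = ∫ r in (0:ℝ)..τ, heatC σ (a + σ / 2) r φ x := by
    unfold heatC
    simp_rw [fourierInv_eq, Circle.smul_def, smul_eq_mul]
    have hcE : Continuous fun ξ : Space N => ((Real.fourierChar (inner ℝ ξ x) : Circle) : ℂ) :=
      continuous_induced_dom.comp (Real.continuous_fourierChar.comp
        (continuous_id.inner continuous_const))
    have hintE : ∀ t, 0 ≤ t → Integrable (fun ξ : Space N =>
        ((Real.fourierChar (inner ℝ ξ x) : Circle) : ℂ) *
          (radSym (symE σ a t) ξ * 𝓕 (fun y => (φ y : ℂ)) ξ)) := fun t ht =>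
      (integrable_symE_mul_fourier hφ hc hσ ha ht).bdd_mul (c := 1) hcE.aestronglyMeasurable
        (.of_forall fun ξ => (Circle.norm_coe _).le)
    rw [intervalIntegral.integral_of_le hτ, ← integral_sub (hintE 0 le_rfl) (hintE τ hτ),
      integral_integral_swap]
    · refine integral_congr_ae (.of_forall fun ξ => ?_)
      simp only
      rw [integral_const_mul, integral_mul_const, ← mul_sub, ← sub_mul]
      congr 2
      set r₀ := (2 * π * ‖ξ‖) ^ 2 with hr₀
      have hr0 : 0 ≤ r₀ := by positivity
      simp only [radSym, radFun, ← hr₀, symE]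
      rw [integral_complex_ofReal, ← Complex.ofReal_sub]
      congr 1
      rw [← intervalIntegral.integral_of_le hτ]
      have hd : ∀ s ∈ uIcc 0 τ, HasDerivAt (fun s => -(r₀ ^ a * Real.exp (-(r₀ ^ (σ / 2) * s))))
          (r₀ ^ (a + σ / 2) * Real.exp (-(r₀ ^ (σ / 2) * s))) s := by
        intro s _
        have h1 : HasDerivAt (fun s => Real.exp (-(r₀ ^ (σ / 2) * s)))
            (Real.exp (-(r₀ ^ (σ / 2) * s)) * -(r₀ ^ (σ / 2) * 1)) s :=
          (((hasDerivAt_id' s).const_mul (r₀ ^ (σ / 2))).neg).exp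
        refine ((h1.const_mul (r₀ ^ a)).neg).congr_deriv ?_
        have : r₀ ^ (a + σ / 2) = r₀ ^ a * r₀ ^ (σ / 2) :=
          Real.rpow_add_of_nonneg hr0 ha (by positivity)
        rw [this]
        ring
      rw [intervalIntegral.integral_eq_sub_of_hasDerivAt hd]
      · simp only [mul_zero]
        ring
      · refine Continuous.intervalIntegrable ?_ _ _
        fun_prop
    · have hbound : Integrable (fun z : ℝ × Space N => ((2 * π * ‖z.2‖) ^ 2) ^ (a + σ / 2) *
          ‖𝓕 (fun y => (φ y : ℂ)) z.2‖) ((volume.restrict (Ioc 0 τ)).prod volume) :=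
        (integrable_pow_mul_fourier_test hφ hc haσ).comp_snd _
      refine hbound.mono' ?_ ?_
      · refine Continuous.aestronglyMeasurable ?_
        refine (hcE.comp continuous_snd).mul (Continuous.mul ?_
          ((continuous_fourier_test hφ hc).comp continuous_snd))
        exact continuous_radSym_symE hσ haσ
      · have h1 : ∀ᵐ z ∂((volume.restrict (Ioc 0 τ)).prod (volume : Measure (Space N))),
            z.1 ∈ Ioc 0 τ :=
          Measure.quasiMeasurePreserving_fst.ae (ae_restrict_mem measurableSet_Ioc)
        filter_upwards [h1] with z hz
        simp only [Function.uncurry]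
        rw [norm_mul, Circle.norm_coe, one_mul]
        exact norm_symE_mul_fourier_le hz.1.le z.2
  simp_rw [heatC_eq_ofReal] at hC
  rw [intervalIntegral.integral_ofReal] at hC
  exact_mod_cast hC

end testFunction

/-- The weighted bound for fractional powers of the Laplacian on Schwartz functions. -/
lemma exists_fracPow_seminorm_bound (hN : 1 ≤ N) (hσ : 0 < σ) {b : ℝ} (hb : σ / 2 ≤ b) :
    ∃ (s : Finset (ℕ × ℕ)) (C : ℝ), 0 ≤ C ∧ ∀ (Φ : 𝓢(Space N, ℂ)) (x : Space N),
      ‖𝓕⁻ (fun ξ => radSym (symE σ b 0) ξ * 𝓕 (Φ : Space N → ℂ) ξ) x‖ ≤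
        C * (s.sup (schwartzSeminormFamily ℂ (Space N) ℂ)) Φ * rho σ x := by
  have hb0 : 0 < b := by linarith
  have hN0 : (0:ℝ) ≤ N := N.cast_nonneg
  -- Factor `r^b = r^b (1+r)^{-k} · (1+r)^k`. For this `k` the first factor is an integrable symbol
  -- vanishing at the origin at least like `r^{σ/2}`, so its kernel is `O(ρ)`. The second is
  -- polynomial in `ξ` and preserves Schwartz functions, which are `O(ρ)` as well. The estimate `ρ *
  -- ρ ≤ C ρ` concludes.
  obtain ⟨k, hk⟩ := exists_nat_ge (b + (N + 1))
  obtain ⟨n, hn⟩ := exists_nat_gt ((N : ℝ) + 2 * (σ / 2))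
  have hn0 : n ≠ 0 := by rintro rfl; push_cast at hn; linarith
  obtain ⟨B, B', hB, hB', h⟩ := exists_isSymbol_of_derivBound (n := n) (β := σ / 2) (M := N + 1)
    (contDiffOn_powSym b k) (fun j _ => derivBound_powSym j b k) (by positivity) hb hb0.le
    hk (by positivity)
  obtain ⟨C₁, hC₁0, hC₁⟩ := exists_fourier_bound hN (by positivity) hn hn0 (by linarith) hB hB' h
  have hmint : Integrable (radSym (powSym b k) : Space N → ℂ) :=
    h.integrable_radSym hN hB' (by linarith)
  set g : Space N → ℂ := fun ξ => (((1 + (2 * π) ^ 2 * ‖ξ‖ ^ 2) ^ k : ℝ) : ℂ) with hg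
  have hgt : g.HasTemperateGrowth := by
    have : Function.HasTemperateGrowth (fun ξ : Space N => ((1 + (2 * π) ^ 2 * ‖ξ‖ ^ 2) ^ k : ℝ)) := by
      fun_prop
    exact Complex.ofRealCLM.hasTemperateGrowth.comp this
  set T := SchwartzMap.fourierMultiplierCLM ℂ g with hT
  have hTF : ∀ Φ : 𝓢(Space N, ℂ), ∀ ξ, 𝓕 (T Φ : Space N → ℂ) ξ = g ξ * 𝓕 (Φ : Space N → ℂ) ξ := by
    intro Φ ξ
    rw [← SchwartzMap.fourier_coe, hT, SchwartzMap.fourierMultiplierCLM_apply,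
      FourierTransform.fourier_fourierInv_eq, SchwartzMap.smulLeftCLM_apply_apply hgt,
      SchwartzMap.fourier_coe, smul_eq_mul]
  obtain ⟨m, hm⟩ := exists_nat_ge ((N : ℝ) + σ)
  -- This seminorm controls `(1 + |y|^m) |T Φ(y)|` with `m ≥ N + σ`. Its continuity bounds it by
  -- finitely many Schwartz seminorms of `Φ`, so the final estimate is uniform in `Φ`.
  set q : Seminorm ℂ 𝓢(Space N, ℂ) := (SchwartzMap.seminorm ℂ 0 0 + SchwartzMap.seminorm ℂ m 0).comp
    T.toLinearMap with hq
  have hqc : Continuous q := by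
    have h1 := (schwartz_withSeminorms ℂ (Space N) ℂ).continuous_seminorm (0, 0)
    have h2 := (schwartz_withSeminorms ℂ (Space N) ℂ).continuous_seminorm (m, 0)
    exact (h1.add h2).comp T.continuous
  obtain ⟨s, C₂, -, hC₂⟩ := Seminorm.bound_of_continuous (schwartz_withSeminorms ℂ (Space N) ℂ) q hqc
  have hpt : ∀ (Φ : 𝓢(Space N, ℂ)) (y : Space N), ‖T Φ y‖ ≤ 2 ^ m * q Φ * rho σ y := by
    intro Φ y
    have h0 := SchwartzMap.le_seminorm ℂ 0 0 (T Φ) y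
    have h1 := SchwartzMap.le_seminorm ℂ m 0 (T Φ) y
    simp only [pow_zero, one_mul, norm_iteratedFDeriv_zero] at h0 h1
    have h2 : (1 + ‖y‖) ^ m ≤ 2 ^ m * (1 + ‖y‖ ^ m) := by
      have h4 : 1 + ‖y‖ ≤ 2 * max 1 ‖y‖ := by
        have := le_max_left 1 ‖y‖; have := le_max_right 1 ‖y‖; linarith
      have h5 : (max 1 ‖y‖) ^ m ≤ 1 + ‖y‖ ^ m := by
        rcases le_total 1 ‖y‖ with h | h
        · rw [max_eq_right h]; linarith
        · rw [max_eq_left h, one_pow]; linarith [pow_nonneg (norm_nonneg y) m]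
      calc _ ≤ (2 * max 1 ‖y‖) ^ m := by gcongr
        _ = 2 ^ m * (max 1 ‖y‖) ^ m := mul_pow _ _ _
        _ ≤ _ := by gcongr
    have h3 : (1 + ‖y‖) ^ m * ‖T Φ y‖ ≤ 2 ^ m * q Φ := by
      calc _ ≤ 2 ^ m * (1 + ‖y‖ ^ m) * ‖T Φ y‖ := by gcongr
        _ = 2 ^ m * (‖T Φ y‖ + ‖y‖ ^ m * ‖T Φ y‖) := by ring
        _ ≤ 2 ^ m * (SchwartzMap.seminorm ℂ 0 0 (T Φ) + SchwartzMap.seminorm ℂ m 0 (T Φ)) := by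
          gcongr
        _ = _ := rfl
    have h4 : (1 + ‖y‖) ^ ((N : ℝ) + σ) ≤ (1 + ‖y‖) ^ m := by
      rw [← Real.rpow_natCast]
      exact Real.rpow_le_rpow_of_exponent_le (by linarith [norm_nonneg y]) hm
    unfold rho
    rw [Real.rpow_neg (by positivity), ← div_eq_mul_inv, le_div_iff₀ (by positivity)]
    calc ‖T Φ y‖ * (1 + ‖y‖) ^ ((N : ℝ) + σ) ≤ ‖T Φ y‖ * (1 + ‖y‖) ^ m := by gcongr
      _ ≤ _ := by rw [mul_comm]; exact h3
  have hR := rhoConst_nonneg (N := N) (σ := σ)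
  refine ⟨s, C₁ * 2 ^ m * C₂ * rhoConst N σ, by positivity, fun Φ x => ?_⟩
  have e : (fun ξ => radSym (symE σ b 0) ξ * 𝓕 (Φ : Space N → ℂ) ξ) =
      fun ξ => radSym (powSym b k) ξ * 𝓕 (T Φ : Space N → ℂ) ξ := by
    funext ξ
    rw [hTF, ← mul_assoc]
    congr 1
    simp only [radSym, radFun, symE, powSym, hg, ← Complex.ofReal_mul]
    congr 1
    have h1 : 1 + (2 * π) ^ 2 * ‖ξ‖ ^ 2 = 1 + (2 * π * ‖ξ‖) ^ 2 := by ring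
    have h2 : (1 + (2 * π * ‖ξ‖) ^ 2) ^ k ≠ 0 := by positivity
    rw [h1, Real.rpow_neg (by positivity), Real.rpow_natCast, mul_zero, neg_zero, Real.exp_zero,
      mul_one, mul_assoc (((2 * π * ‖ξ‖) ^ 2) ^ b), inv_mul_cancel₀ h2, mul_one]
  rw [e, ← integral_fourierInv_mul hmint (T Φ).integrable]
  have hq0 : 0 ≤ q Φ := apply_nonneg q Φ
  have hqs : q Φ ≤ C₂ * (s.sup (schwartzSeminormFamily ℂ (Space N) ℂ)) Φ := hC₂ Φ
  have hrx := rho_nonneg (σ := σ) x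
  generalize (s.sup (schwartzSeminormFamily ℂ (Space N) ℂ)) Φ = S at hqs ⊢
  have hC₂0 : (0:ℝ) ≤ C₂ := C₂.2
  clear_value q
  calc _ ≤ ∫ y, C₁ * (2 ^ m * q Φ) * (rho σ (x - y) * rho σ y) := by
        refine norm_integral_le_of_norm_le ((integrable_rho_mul_rho hσ x).const_mul _)
          (.of_forall fun y => ?_)
        rw [norm_mul]
        have h1 : ‖𝓕⁻ (radSym (powSym b k)) (x - y)‖ ≤ C₁ * rho σ (x - y) := by
          refine (hC₁ _).trans (le_of_eq ?_)
          rw [rho, mul_div_cancel₀ _ (two_ne_zero)]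
        have := rho_nonneg (σ := σ) (x - y)
        have := rho_nonneg (σ := σ) y
        calc _ ≤ (C₁ * rho σ (x - y)) * (2 ^ m * q Φ * rho σ y) := by gcongr; exact hpt Φ y
          _ = _ := by ring
    _ = C₁ * (2 ^ m * q Φ) * ∫ y, rho σ (x - y) * rho σ y := integral_const_mul _ _
    _ ≤ C₁ * (2 ^ m * (C₂ * S)) * (rhoConst N σ * rho σ x) := by
        have h1 : C₁ * (2 ^ m * q Φ) ≤ C₁ * (2 ^ m * (C₂ * S)) := by gcongr
        refine mul_le_mul h1 (integral_rho_mul_rho_le hσ x) (integral_nonneg fun y =>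
          mul_nonneg (rho_nonneg _) (rho_nonneg _)) ((by positivity : (0:ℝ) ≤ _).trans h1)
    _ = _ := by ring

end fracPow

/-! ### Heat evolution of test functions, dominated by the weight. -/

section heatTest
variable {N : ℕ} {σ : ℝ} {φ : Space N → ℝ}

open Real SchwartzMap

lemma heatC_translate (a t : ℝ) (φ : Space N → ℝ) (y x : Space N) :
    heatC σ a t (fun z => φ (z - y)) x = heatC σ a t φ (x - y) := by
  have e : ∀ ξ : Space N, 𝓕 (fun z => ((φ (z - y) : ℝ) : ℂ)) ξ =
      (Real.fourierChar (inner ℝ (-y) ξ) : ℂ) * 𝓕 (fun z => (φ z : ℂ)) ξ := fun ξ => by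
    have := congrFun (VectorFourier.fourierIntegral_comp_add_right Real.fourierChar
      (volume : Measure (Space N)) (innerₗ (Space N)) (fun z => (φ z : ℂ)) (-y)) ξ
    simp only [Function.comp_def, ← sub_eq_add_neg] at this
    exact this
  unfold heatC
  simp_rw [e, fourierInv_eq, Circle.smul_def, smul_eq_mul]
  refine integral_congr_ae (.of_forall fun ξ => ?_)
  have h : (Real.fourierChar (inner ℝ ξ (x - y)) : ℂ) =
      (Real.fourierChar (inner ℝ ξ x) : ℂ) * (Real.fourierChar (inner ℝ (-y) ξ) : ℂ) := by
    rw [← Circle.coe_mul, ← AddChar.map_add_eq_mul, sub_eq_add_neg, inner_add_right,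
      real_inner_comm ξ (-y)]
  simp only [h]
  ring

lemma heatMul_translate (a t : ℝ) (φ : Space N → ℝ) (y x : Space N) :
    heatMul σ a t (fun z => φ (z - y)) x = heatMul σ a t φ (x - y) := by
  rw [heatMul, heatC_translate, heatMul]

lemma heatMul_const_mul (a t c : ℝ) (φ : Space N → ℝ) (x : Space N) :
    heatMul σ a t (fun z => c * φ z) x = c * heatMul σ a t φ x := by
  have e : ∀ ξ : Space N, 𝓕 (fun z => ((c * φ z : ℝ) : ℂ)) ξ =
      (c : ℂ) * 𝓕 (fun z => (φ z : ℂ)) ξ := fun ξ => by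
    rw [fourier_eq, fourier_eq, ← integral_const_mul]
    refine integral_congr_ae (.of_forall fun y => ?_)
    simp only [Circle.smul_def, smul_eq_mul]
    push_cast
    ring
  have h : heatC σ a t (fun z => c * φ z) x = (c : ℂ) * heatC σ a t φ x := by
    unfold heatC
    simp_rw [e]
    rw [fourierInv_eq, fourierInv_eq, ← integral_const_mul]
    refine integral_congr_ae (.of_forall fun y => ?_)
    simp only [Circle.smul_def, smul_eq_mul]
    ring
  rw [heatMul, h, Complex.re_ofReal_mul, heatMul]

/-- A bounded function of compact support is dominated by the weight. -/
lemma exists_le_rho_of_hasCompactSupport {g : Space N → ℝ} (hg : Continuous g)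
    (hc : HasCompactSupport g) : ∃ C : ℝ, 0 ≤ C ∧ ∀ x, |g x| ≤ C * rho σ x := by
  have h : Continuous fun x => g x / rho σ x :=
    hg.div continuous_rho fun x => (rho_pos x).ne'
  obtain ⟨C, hC⟩ := h.bounded_above_of_compact_support (hc.mono fun x hx h0 => hx (by simp [h0]))
  refine ⟨C, (norm_nonneg _).trans (hC 0), fun x => ?_⟩
  have := hC x
  rwa [norm_div, Real.norm_eq_abs, Real.norm_of_nonneg (rho_nonneg x),
    div_le_iff₀ (rho_pos x)] at this

/-- The exponents `a` for which `(-Δ)^a φ` is dominated by the weight. -/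
def GoodExp (σ a : ℝ) : Prop := a = 0 ∨ σ / 2 ≤ a

lemma GoodExp.nonneg (hσ : 0 < σ) {a : ℝ} (ha : GoodExp σ a) : 0 ≤ a := by
  rcases ha with rfl | h
  · rfl
  · linarith

lemma GoodExp.add (hσ : 0 < σ) {a : ℝ} (ha : GoodExp σ a) : GoodExp σ (a + σ / 2) :=
  Or.inr (by linarith [ha.nonneg hσ])

section bounds
variable (hN : 1 ≤ N) (hσ : 0 < σ) (hφ : ContDiff ℝ ∞ φ) (hc : HasCompactSupport φ)
include hN hσ hφ hc

/-- For `a = 0` the function has compact support. Exponents `0 < a < σ/2` are excluded because the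
decay of `(-Δ)^a φ` is in general only of order `|x|^{-(N+2a)}`. -/
lemma exists_abs_heatMul_le {a : ℝ} (ha : GoodExp σ a) :
    ∃ C : ℝ, 0 ≤ C ∧ ∀ x, |heatMul σ a 0 φ x| ≤ C * rho σ x := by
  rcases ha with rfl | ha
  · simp_rw [heatMul_zero_zero hφ hc]
    exact exists_le_rho_of_hasCompactSupport hφ.continuous hc
  · obtain ⟨s, C, hC0, hC⟩ := exists_fracPow_seminorm_bound hN hσ ha
    refine ⟨C * (s.sup (schwartzSeminormFamily ℂ (Space N) ℂ)) (toSchwartz hφ hc), ?_, fun x => ?_⟩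
    · exact mul_nonneg hC0 (apply_nonneg _ _)
    · have h := hC (toSchwartz hφ hc) x
      rw [toSchwartz_apply] at h
      have e : ‖heatC σ a 0 φ x‖ = |heatMul σ a 0 φ x| := by
        rw [heatC_eq_ofReal, Complex.norm_real, Real.norm_eq_abs]
      rw [← e]
      exact h

lemma integrable_heatMul {a : ℝ} (ha : GoodExp σ a) : Integrable (heatMul σ a 0 φ) := by
  obtain ⟨C, -, hC⟩ := exists_abs_heatMul_le hN hσ hφ hc ha
  exact ((integrable_rho hσ).const_mul C).mono'
    (continuous_heatMul_space hφ hc hσ (ha.nonneg hσ)).aestronglyMeasurable (.of_forall hC)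

lemma fourier_heatMul {a : ℝ} (ha : GoodExp σ a) :
    𝓕 (fun x => (heatMul σ a 0 φ x : ℂ)) =
      fun ξ => radSym (symE σ a 0) ξ * 𝓕 (fun y => (φ y : ℂ)) ξ := by
  have ha0 := ha.nonneg hσ
  set m : Space N → ℂ := fun ξ => radSym (symE σ a 0) ξ * 𝓕 (fun y => (φ y : ℂ)) ξ with hm
  have hmc : Continuous m := continuous_symE_mul_fourier hφ hc hσ ha0 0
  have hmi : Integrable m := integrable_symE_mul_fourier hφ hc hσ ha0 le_rfl
  have e : (fun x => (heatMul σ a 0 φ x : ℂ)) = 𝓕⁻ m := by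
    funext x; exact (heatC_eq_ofReal a 0 φ x).symm
  have hi : Integrable (𝓕⁻ m) := by
    rw [← e]; exact (integrable_heatMul hN hσ hφ hc ha).ofReal
  have hi' : Integrable (𝓕 m) := by
    have : (fun x => 𝓕 m x) = fun x => 𝓕⁻ m (-x) := by
      funext x; rw [fourierInv_eq_fourier_neg, neg_neg]
    have h2 := hi.comp_neg
    rwa [← this] at h2
  rw [e, hmc.fourier_fourierInv_eq hmi hi']

lemma integral_symP_mul_heatMul {a : ℝ} (ha : GoodExp σ a) {t : ℝ} (ht : 0 < t) (x : Space N) :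
    ∫ y, radKer (symP σ t) (x - y) * heatMul σ a 0 φ y = heatMul σ a t φ x := by
  rw [integral_radKer_mul (integrable_radSym_symP hN hσ ht) (integrable_heatMul hN hσ hφ hc ha),
    fourier_heatMul hN hσ hφ hc ha, heatMul, heatC]
  refine congrArg (fun m : Space N → ℂ => (𝓕⁻ m x).re) (funext fun ξ => ?_)
  simp only
  rw [← mul_assoc]
  congr 1
  simp only [radSym, radFun, symP, symE, ← Complex.ofReal_mul]
  congr 1
  simp [mul_comm]

lemma integral_symA_mul_heatMul {a : ℝ} (ha : GoodExp σ a) {t : ℝ} (ht : 0 < t) (x : Space N) :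
    ∫ y, radKer (symA σ t) (x - y) * heatMul σ a 0 φ y = heatMul σ (a + σ / 2) t φ x := by
  rw [integral_radKer_mul (integrable_radSym_symA hN hσ ht) (integrable_heatMul hN hσ hφ hc ha),
    fourier_heatMul hN hσ hφ hc ha, heatMul, heatC]
  refine congrArg (fun m : Space N → ℂ => (𝓕⁻ m x).re) (funext fun ξ => ?_)
  simp only
  rw [← mul_assoc]
  congr 1
  simp only [radSym, radFun, symA, symE, ← Complex.ofReal_mul]
  congr 1
  rw [Real.rpow_add_of_nonneg (by positivity) (ha.nonneg hσ) (by positivity)]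
  simp only [mul_zero, neg_zero, Real.exp_zero, mul_one]
  ring

/-- The heat evolution of a test function is dominated by the weight, uniformly in time. -/
lemma exists_abs_heatMul_le_uniform {a : ℝ} (ha : GoodExp σ a) (T : ℝ) :
    ∃ C : ℝ, 0 ≤ C ∧ ∀ t, 0 ≤ t → t ≤ T → ∀ x, |heatMul σ a t φ x| ≤ C * rho σ x := by
  obtain ⟨C₁, hC₁0, hC₁⟩ := exists_abs_heatMul_le hN hσ hφ hc ha
  obtain ⟨C₂, hC₂0, hC₂⟩ := exists_heat_bound hN hσ T
  refine ⟨max C₁ (C₁ * C₂), hC₁0.trans (le_max_left _ _), fun t ht htT x => ?_⟩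
  have hr := rho_nonneg (σ := σ) x
  rcases ht.eq_or_lt with rfl | ht
  · exact (hC₁ x).trans (by gcongr; exact le_max_left _ _)
  · obtain ⟨h1, h2⟩ := hC₂ t ht htT x
    rw [← integral_symP_mul_heatMul hN hσ hφ hc ha ht, ← Real.norm_eq_abs]
    calc _ ≤ ∫ y, C₁ * (|radKer (symP σ t) (x - y)| * rho σ y) := by
          refine norm_integral_le_of_norm_le (h1.const_mul _) (.of_forall fun y => ?_)
          rw [norm_mul, Real.norm_eq_abs, Real.norm_eq_abs, mul_left_comm]
          gcongr
          exact hC₁ y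
      _ = C₁ * ∫ y, |radKer (symP σ t) (x - y)| * rho σ y := integral_const_mul _ _
      _ ≤ C₁ * (C₂ * rho σ x) := by gcongr
      _ = (C₁ * C₂) * rho σ x := by ring
      _ ≤ _ := by gcongr; exact le_max_right _ _

end bounds
end heatTest

/-! ### Time slices of space-time test functions. -/

section slices
variable {N : ℕ} {σ : ℝ} {ζ : Space N × ℝ → ℝ}

open SchwartzMap

lemma contDiff_slice (hζ : ContDiff ℝ ∞ ζ) (t : ℝ) : ContDiff ℝ ∞ fun x => ζ (x, t) :=
  hζ.comp (contDiff_id.prodMk contDiff_const)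

lemma hasCompactSupport_slice (hc : HasCompactSupport ζ) (t : ℝ) :
    HasCompactSupport fun x => ζ (x, t) := by
  refine HasCompactSupport.intro (hc.isCompact.image continuous_fst) fun x hx => ?_
  by_contra h
  exact hx ⟨(x, t), subset_tsupport _ h, rfl⟩

/-- Schwartz seminorms of the slices of a test function depend continuously on time. -/
lemma continuous_toSchwartz_slice (hζ : ContDiff ℝ ∞ ζ) (hc : HasCompactSupport ζ) :
    Continuous fun t => toSchwartz (contDiff_slice hζ t) (hasCompactSupport_slice hc t) := by
  rw [continuous_iff_continuousAt]
  intro t₀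
  refine ((schwartz_withSeminorms ℂ (Space N) ℂ).tendsto_nhds _ _).2 ?_
  rintro ⟨k, j⟩ ε hε
  obtain ⟨R, hR0, hR⟩ : ∃ R : ℝ, 0 < R ∧ ∀ p ∈ tsupport ζ, ‖p.1‖ ≤ R := by
    obtain ⟨R, hR⟩ := (hc.isCompact.image continuous_fst).isBounded.exists_norm_le
    exact ⟨max R 1, by positivity, fun p hp => (hR _ ⟨p, hp, rfl⟩).trans (le_max_left _ _)⟩
  set ζC : Space N × ℝ → ℂ := fun p => (ζ p : ℂ) with hζC
  have hζC1 : ContDiff ℝ ∞ ζC := Complex.ofRealCLM.contDiff.comp hζ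
  have hζC2 : HasCompactSupport ζC := hc.comp_left Complex.ofReal_zero
  set D : Space N × ℝ → _ := iteratedFDeriv ℝ j ζC with hD
  have hDc : Continuous D := hζC1.continuous_iteratedFDeriv (by exact_mod_cast le_top)
  have hDs : HasCompactSupport D := hζC2.iteratedFDeriv j
  have hDu : UniformContinuous D := hDs.uniformContinuous_of_continuous hDc
  set M : ℝ := ‖ContinuousLinearMap.inl ℝ (Space N) ℝ‖ ^ j with hM
  have hM0 : 0 ≤ M := by positivity
  set δ := ε / (2 * (R ^ k * (M + 1))) with hδ
  have hδ0 : 0 < δ := by positivity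
  obtain ⟨η, hη0, hη⟩ := Metric.uniformContinuous_iff.1 hDu δ hδ0
  filter_upwards [Metric.ball_mem_nhds t₀ hη0] with t ht
  -- The derivatives of a slice are those of `ζ` restricted to spatial directions. Uniform
  -- continuity of the full derivative therefore makes slices at close times close, uniformly in
  -- `x`, and compact support absorbs the factor `‖x‖^k`.
  have hsl : ∀ s x, iteratedFDeriv ℝ j (fun x => ζC (x, s)) x =
      (D (x, s)).compContinuousLinearMap fun _ => ContinuousLinearMap.inl ℝ (Space N) ℝ := by
    intro s x
    have e : (fun x => ζC (x, s)) = (fun p => ζC (p + ((0 : Space N), s))) ∘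
        (ContinuousLinearMap.inl ℝ (Space N) ℝ) := by
      funext x; simp
    have h1 : ContDiff ℝ ∞ (fun p => ζC (p + ((0 : Space N), s))) :=
      hζC1.comp (contDiff_id.add contDiff_const)
    rw [e, ContinuousLinearMap.iteratedFDeriv_comp_right _ h1 x (by exact_mod_cast le_top),
      iteratedFDeriv_comp_add_right]
    simp [hD]
  change SchwartzMap.seminorm ℂ k j (_ - _) < ε
  refine lt_of_le_of_lt (SchwartzMap.seminorm_le_bound ℂ k j _ (M := R ^ k * (δ * M))
    (by positivity) fun x => ?_) ?_
  · have e : iteratedFDeriv ℝ j (⇑(toSchwartz (contDiff_slice hζ t) (hasCompactSupport_slice hc t) -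
        toSchwartz (contDiff_slice hζ t₀) (hasCompactSupport_slice hc t₀))) x =
        (D (x, t) - D (x, t₀)).compContinuousLinearMap
          fun _ => ContinuousLinearMap.inl ℝ (Space N) ℝ := by
      have hs : ∀ s, ContDiff ℝ ∞ fun x => ζC (x, s) := fun s =>
        hζC1.comp (contDiff_id.prodMk contDiff_const)
      have e1 : ⇑(toSchwartz (contDiff_slice hζ t) (hasCompactSupport_slice hc t) -
          toSchwartz (contDiff_slice hζ t₀) (hasCompactSupport_slice hc t₀)) =
          (fun x => ζC (x, t)) - fun x => ζC (x, t₀) := rfl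
      rw [e1, iteratedFDeriv_sub ((hs t).of_le (by exact_mod_cast le_top))
        ((hs t₀).of_le (by exact_mod_cast le_top)), Pi.sub_apply, hsl, hsl]
      rfl
    rw [e]
    have h1 : ‖(D (x, t) - D (x, t₀)).compContinuousLinearMap
        fun _ => ContinuousLinearMap.inl ℝ (Space N) ℝ‖ ≤ ‖D (x, t) - D (x, t₀)‖ * M := by
      refine (ContinuousMultilinearMap.norm_compContinuousLinearMap_le _ _).trans ?_
      simp [hM]
    have h2 : ‖D (x, t) - D (x, t₀)‖ ≤ δ := by
      rw [← dist_eq_norm]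
      refine (hη ?_).le
      rw [Prod.dist_eq]
      simpa [hη0] using ht
    by_cases hx : ‖x‖ ≤ R
    · gcongr
      exact h1.trans (by gcongr)
    · have h0 : ∀ s, D (x, s) = 0 := fun s => by
        by_contra h
        exact hx (hR (x, s) (tsupport_comp_subset Complex.ofReal_zero ζ
          (support_iteratedFDeriv_subset (𝕜 := ℝ) j h)))
      rw [h0, h0, sub_zero] at h1 ⊢
      rw [norm_zero, zero_mul] at h1
      have : ‖(0 : ContinuousMultilinearMap ℝ (fun _ : Fin j => Space N × ℝ)
        ℂ).compContinuousLinearMap fun _ => ContinuousLinearMap.inl ℝ (Space N) ℝ‖ = 0 :=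
        le_antisymm h1 (norm_nonneg _)
      rw [this, mul_zero]
      positivity
  · calc R ^ k * (δ * M) ≤ R ^ k * (δ * (M + 1)) := by gcongr; linarith
      _ = ε / 2 := by rw [hδ]; field_simp
      _ < ε := by linarith

lemma continuous_finset_sup_seminorm (F : Finset (ℕ × ℕ)) :
    Continuous fun Φ : 𝓢(Space N, ℂ) => (F.sup (schwartzSeminormFamily ℂ (Space N) ℂ)) Φ := by
  classical
  induction F using Finset.induction_on with
  | empty => simpa using continuous_const
  | insert i F _ ih =>
    simp only [Finset.sup_insert, Seminorm.sup_apply]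
    exact ((schwartz_withSeminorms ℂ (Space N) ℂ).continuous_seminorm i).sup ih

/-- The fractional Laplacian of the slices of a test function is continuous in time, uniformly
with respect to the weight. -/
lemma exists_fracLaplacian_slice_bound (hN : 1 ≤ N) (hσ : 0 < σ) (hζ : ContDiff ℝ ∞ ζ)
    (hc : HasCompactSupport ζ) :
    ∃ q : ℝ → ℝ → ℝ, (∀ s, Continuous (q s)) ∧ (∀ s, q s s = 0) ∧ ∀ s t x,
      |fracLaplacian σ (fun y => ζ (y, t)) x - fracLaplacian σ (fun y => ζ (y, s)) x| ≤
        q s t * rho σ x := by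
  obtain ⟨F, C, hC0, hC⟩ := exists_fracPow_seminorm_bound hN hσ (le_refl (σ / 2))
  set Z := fun t => toSchwartz (contDiff_slice hζ t) (hasCompactSupport_slice hc t) with hZ
  have hZc : Continuous Z := continuous_toSchwartz_slice hζ hc
  have hq : Continuous fun Φ : 𝓢(Space N, ℂ) => (F.sup (schwartzSeminormFamily ℂ (Space N) ℂ)) Φ :=
    continuous_finset_sup_seminorm F
  refine ⟨fun s t => C * (F.sup (schwartzSeminormFamily ℂ (Space N) ℂ)) (Z t - Z s),
    fun s => continuous_const.mul (hq.comp (hZc.sub continuous_const)), fun s => by simp,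
    fun s t x => ?_⟩
  refine le_trans (le_of_eq ?_) (hC (Z t - Z s) x)
  have hI : ∀ s, Integrable (fun ξ => radSym (symE σ (σ / 2) 0) ξ *
      𝓕 (fun y => ((ζ (y, s) : ℝ) : ℂ)) ξ) := fun s =>
    integrable_symE_mul_fourier (contDiff_slice hζ s) (hasCompactSupport_slice hc s) hσ
      (by positivity) le_rfl
  have e : 𝓕⁻ (fun ξ => radSym (symE σ (σ / 2) 0) ξ * 𝓕 (⇑(Z t - Z s)) ξ) x =
      heatC σ (σ / 2) 0 (fun y => ζ (y, t)) x - heatC σ (σ / 2) 0 (fun y => ζ (y, s)) x := by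
    have h1 : ∀ ξ, 𝓕 (⇑(Z t - Z s)) ξ = 𝓕 (fun y => ((ζ (y, t) : ℝ) : ℂ)) ξ -
        𝓕 (fun y => ((ζ (y, s) : ℝ) : ℂ)) ξ := fun ξ => by
      have h0 : 𝓕 (Z t - Z s) = 𝓕 (Z t) - 𝓕 (Z s) :=
        (FourierTransform.fourierCLM ℂ 𝓢(Space N, ℂ)).map_sub _ _
      rw [← SchwartzMap.fourier_coe, h0, sub_apply]
      rfl
    simp_rw [h1, mul_sub]
    have hI' : ∀ s, Integrable (fun ξ => Real.fourierChar (inner ℝ ξ x) •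
        (radSym (symE σ (σ / 2) 0) ξ * 𝓕 (fun y => ((ζ (y, s) : ℝ) : ℂ)) ξ)) := fun s => by
      simp_rw [Circle.smul_def, smul_eq_mul]
      refine (hI s).bdd_mul (c := 1) (Continuous.aestronglyMeasurable ?_)
        (.of_forall fun ξ => (Circle.norm_coe _).le)
      exact continuous_induced_dom.comp (Real.continuous_fourierChar.comp
        (continuous_id.inner continuous_const))
    unfold heatC
    rw [Real.fourierInv_eq, Real.fourierInv_eq, Real.fourierInv_eq, ← integral_sub (hI' t) (hI' s)]
    simp only [smul_sub]
  rw [e, heatC_eq_ofReal, heatC_eq_ofReal, ← fracLaplacian_eq, ← fracLaplacian_eq,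
    ← Complex.ofReal_sub, Complex.norm_real, Real.norm_eq_abs]

end slices

/-! ### The space `L¹(ρ dx)` and its pairing with functions dominated by `ρ` -/

section pairing
variable {N : ℕ} {σ : ℝ}

/-- Membership in `L¹(ρ dx)`. -/
def MemRho (σ : ℝ) (h : Space N → ℝ) : Prop := Integrable fun x => h x * rho σ x

/-- The norm of `L¹(ρ dx)`. -/
noncomputable def rhoNorm (σ : ℝ) (h : Space N → ℝ) : ℝ := ∫ x, |h x| * rho σ x

lemma rhoMeasure_eq : rhoMeasure N σ = volume.withDensity fun x => ENNReal.ofReal (rho σ x) := rfl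

lemma measurable_ofReal_rho : Measurable fun x : Space N => ENNReal.ofReal (rho σ x) :=
  ENNReal.measurable_ofReal.comp continuous_rho.measurable

lemma integrable_rhoMeasure_iff {h : Space N → ℝ} :
    Integrable h (rhoMeasure N σ) ↔ MemRho σ h := by
  rw [rhoMeasure_eq, integrable_withDensity_iff measurable_ofReal_rho
    (.of_forall fun _ => ENNReal.ofReal_lt_top)]
  simp_rw [ENNReal.toReal_ofReal (rho_nonneg _)]
  rfl

lemma integral_rhoMeasure (h : Space N → ℝ) :
    ∫ x, h x ∂(rhoMeasure N σ) = ∫ x, h x * rho σ x := by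
  rw [rhoMeasure_eq, integral_withDensity_eq_integral_toReal_smul measurable_ofReal_rho
    (.of_forall fun _ => ENNReal.ofReal_lt_top)]
  simp_rw [ENNReal.toReal_ofReal (rho_nonneg _), smul_eq_mul, mul_comm]

lemma rhoMeasure_absolutelyContinuous : rhoMeasure N σ ≪ volume :=
  withDensity_absolutelyContinuous _ _

lemma absolutelyContinuous_rhoMeasure : volume ≪ rhoMeasure N σ := by
  rw [rhoMeasure_eq]
  refine withDensity_absolutelyContinuous' measurable_ofReal_rho.aemeasurable
    (.of_forall fun x => ?_)
  simpa using rho_pos x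

lemma ae_rhoMeasure_iff {p : Space N → Prop} :
    (∀ᵐ x ∂(rhoMeasure N σ), p x) ↔ ∀ᵐ x, p x :=
  ⟨fun h => absolutelyContinuous_rhoMeasure.ae_le h, fun h => rhoMeasure_absolutelyContinuous.ae_le h⟩

lemma MemRho.aestronglyMeasurable {h : Space N → ℝ} (hh : MemRho σ h) : AEStronglyMeasurable h := by
  have e : h = fun x => h x * rho σ x * (rho σ x)⁻¹ := by
    funext x; rw [mul_inv_cancel_right₀ (rho_pos x).ne']
  rw [e]
  exact Integrable.aestronglyMeasurable hh |>.mul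
    (continuous_rho.inv₀ fun x => (rho_pos x).ne').aestronglyMeasurable

lemma MemRho.abs_mul {h : Space N → ℝ} (hh : MemRho σ h) :
    Integrable fun x => |h x| * rho σ x := by
  refine (Integrable.abs hh).congr (.of_forall fun x => ?_)
  simp only [_root_.abs_mul, abs_of_nonneg (rho_nonneg x)]

lemma MemRho.sub {h k : Space N → ℝ} (hh : MemRho σ h) (hk : MemRho σ k) :
    MemRho σ fun x => h x - k x := by
  refine (Integrable.sub hh hk).congr (.of_forall fun x => ?_)
  simp [sub_mul]

lemma MemRho.add {h k : Space N → ℝ} (hh : MemRho σ h) (hk : MemRho σ k) :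
    MemRho σ fun x => h x + k x := by
  refine (Integrable.add hh hk).congr (.of_forall fun x => ?_)
  simp [add_mul]

lemma rhoNorm_congr {h k : Space N → ℝ} (e : ∀ᵐ x, h x = k x) : rhoNorm σ h = rhoNorm σ k := by
  refine integral_congr_ae ?_
  filter_upwards [e] with x hx
  rw [hx]

lemma rhoNorm_nonneg (h : Space N → ℝ) : 0 ≤ rhoNorm σ h :=
  integral_nonneg fun _ => mul_nonneg (abs_nonneg _) (rho_nonneg _)

lemma rhoNorm_add_le {h k : Space N → ℝ} (hh : MemRho σ h) (hk : MemRho σ k) :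
    rhoNorm σ (fun x => h x + k x) ≤ rhoNorm σ h + rhoNorm σ k := by
  unfold rhoNorm
  rw [← integral_add hh.abs_mul hk.abs_mul]
  refine integral_mono (hh.add hk).abs_mul (hh.abs_mul.add hk.abs_mul) fun x => ?_
  simp only [← add_mul]
  exact mul_le_mul_of_nonneg_right (abs_add_le _ _) (rho_nonneg _)

lemma rhoNorm_sub_comm (h k : Space N → ℝ) :
    rhoNorm σ (fun x => h x - k x) = rhoNorm σ (fun x => k x - h x) := by
  unfold rhoNorm; simp_rw [abs_sub_comm]

lemma rhoNorm_le_add_sub {h k : Space N → ℝ} (hh : MemRho σ h) (hk : MemRho σ k) :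
    rhoNorm σ h ≤ rhoNorm σ k + rhoNorm σ (fun x => h x - k x) := by
  simpa using rhoNorm_add_le hk (hh.sub hk)

lemma MemRho.mul_of_le {h g : Space N → ℝ} {C : ℝ} (hh : MemRho σ h) (hg : AEStronglyMeasurable g)
    (hC : ∀ x, |g x| ≤ C * rho σ x) : Integrable fun x => h x * g x := by
  refine (hh.abs_mul.const_mul C).mono' (hh.aestronglyMeasurable.mul hg) (.of_forall fun x => ?_)
  rw [norm_mul, Real.norm_eq_abs, Real.norm_eq_abs, mul_left_comm]
  exact mul_le_mul_of_nonneg_left (hC x) (abs_nonneg _)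

lemma MemRho.abs_integral_mul_le {h g : Space N → ℝ} {C : ℝ} (hh : MemRho σ h)
    (hC : ∀ x, |g x| ≤ C * rho σ x) : |∫ x, h x * g x| ≤ C * rhoNorm σ h := by
  rw [← Real.norm_eq_abs, rhoNorm, ← integral_const_mul]
  refine norm_integral_le_of_norm_le (hh.abs_mul.const_mul C) (.of_forall fun x => ?_)
  rw [norm_mul, Real.norm_eq_abs, Real.norm_eq_abs, mul_left_comm]
  exact mul_le_mul_of_nonneg_left (hC x) (abs_nonneg _)

/-- The pairing is continuous for strong convergence of one factor and dominated pointwise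
convergence of the other one. -/
lemma tendsto_integral_mul {ι : Type*} {l : Filter ι} [l.IsCountablyGenerated]
    {U : ι → Space N → ℝ} {U₀ : Space N → ℝ} {g : ι → Space N → ℝ} {g₀ : Space N → ℝ} {C : ℝ}
    (hU : ∀ᶠ i in l, MemRho σ (U i)) (hU₀ : MemRho σ U₀)
    (hlim : Tendsto (fun i => rhoNorm σ fun x => U i x - U₀ x) l (𝓝 0))
    (hg : ∀ᶠ i in l, AEStronglyMeasurable (g i)) (hC : ∀ᶠ i in l, ∀ x, |g i x| ≤ C * rho σ x)
    (hgl : ∀ x, Tendsto (fun i => g i x) l (𝓝 (g₀ x))) :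
    Tendsto (fun i => ∫ x, U i x * g i x) l (𝓝 (∫ x, U₀ x * g₀ x)) := by
  have h1 : Tendsto (fun i => ∫ x, U₀ x * g i x) l (𝓝 (∫ x, U₀ x * g₀ x)) := by
    refine tendsto_integral_filter_of_dominated_convergence (fun x => C * (|U₀ x| * rho σ x)) ?_ ?_
      (hU₀.abs_mul.const_mul C) (.of_forall fun x => (hgl x).const_mul _)
    · filter_upwards [hg] with i hi using hU₀.aestronglyMeasurable.mul hi
    · filter_upwards [hC] with i hi
      refine .of_forall fun x => ?_
      rw [norm_mul, Real.norm_eq_abs, Real.norm_eq_abs, mul_left_comm]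
      exact mul_le_mul_of_nonneg_left (hi x) (abs_nonneg _)
  have h2 : Tendsto (fun i => ∫ x, (U i x - U₀ x) * g i x) l (𝓝 0) := by
    have h3 : Tendsto (fun i => C * rhoNorm σ fun x => U i x - U₀ x) l (𝓝 0) := by
      simpa using hlim.const_mul C
    refine squeeze_zero_norm' ?_ h3
    filter_upwards [hU, hC] with i hi hi'
    exact (hi.sub hU₀).abs_integral_mul_le hi'
  have h3 := h2.add h1
  rw [zero_add] at h3
  refine h3.congr' ?_
  filter_upwards [hU, hg, hC] with i hi hi' hi''
  rw [← integral_add ((hi.sub hU₀).mul_of_le hi' hi'') (hU₀.mul_of_le hi' hi'')]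
  refine integral_congr_ae (.of_forall fun x => ?_)
  simp only
  ring

lemma integral_mul_intervalIntegral {h : Space N → ℝ} (hh : MemRho σ h) {G : ℝ → Space N → ℝ}
    (hG : Continuous fun p : Space N × ℝ => G p.2 p.1) {C a b : ℝ} (hab : a ≤ b)
    (hC : ∀ r, a ≤ r → r ≤ b → ∀ x, |G r x| ≤ C * rho σ x) :
    ∫ x, h x * (∫ r in a..b, G r x) = ∫ r in a..b, ∫ x, h x * G r x := by
  simp_rw [intervalIntegral.integral_of_le hab, ← integral_const_mul]
  refine integral_integral_swap ?_
  have hb : Integrable (fun p : Space N × ℝ => C * (|h p.1| * rho σ p.1))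
      (volume.prod (volume.restrict (Ioc a b))) := (hh.abs_mul.comp_fst _).const_mul C
  refine hb.mono' ?_ ?_
  · exact hh.aestronglyMeasurable.comp_fst.mul hG.aestronglyMeasurable
  · have h1 : ∀ᵐ z ∂((volume : Measure (Space N)).prod (volume.restrict (Ioc a b))),
        z.2 ∈ Ioc a b := Measure.quasiMeasurePreserving_snd.ae (ae_restrict_mem measurableSet_Ioc)
    filter_upwards [h1] with z hz
    simp only [Function.uncurry]
    rw [norm_mul, Real.norm_eq_abs, Real.norm_eq_abs, mul_left_comm]
    exact mul_le_mul_of_nonneg_left (hC _ hz.1.le hz.2 _) (abs_nonneg _)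

end pairing

/-! ### Convolution operators on `L¹(ρ dx)` -/

section kernel
variable {N : ℕ} {σ : ℝ} {K : Space N → ℝ} {C : ℝ}

/-- An even kernel whose convolution operator is bounded by `C` on `L¹(ρ dx)`. -/
structure RhoKernel (σ : ℝ) (K : Space N → ℝ) (C : ℝ) : Prop where
  cont : Continuous K
  even : ∀ x, K (-x) = K x
  dom : ∃ D, 0 ≤ D ∧ ∀ x, |K x| ≤ D * rho σ x
  nonneg : 0 ≤ C
  bound : ∀ x, ∫ y, |K (x - y)| * rho σ y ≤ C * rho σ x

lemma RhoKernel.of_le (hσ : 0 < σ) {D : ℝ} (hc : Continuous K) (he : ∀ x, K (-x) = K x)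
    (hD0 : 0 ≤ D) (hD : ∀ x, |K x| ≤ D * rho σ x) : RhoKernel σ K (D * rhoConst N σ) := by
  refine ⟨hc, he, ⟨D, hD0, hD⟩, mul_nonneg hD0 rhoConst_nonneg, fun x => ?_⟩
  rw [mul_assoc]
  refine le_trans ?_ (mul_le_mul_of_nonneg_left (integral_rho_mul_rho_le hσ x) hD0)
  rw [← integral_const_mul]
  refine integral_mono_of_nonneg (.of_forall fun y => mul_nonneg (abs_nonneg _) (rho_nonneg _))
    ((integrable_rho_mul_rho hσ x).const_mul D) (.of_forall fun y => ?_)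
  simp only [← mul_assoc]
  exact mul_le_mul_of_nonneg_right (hD _) (rho_nonneg _)

/-- The constant is allowed to depend on `t` without control as `t → 0`. The lemma serves only at a
fixed time; integrability in time comes from `exists_rhoNorm_conv_symA_le`. -/
lemma rhoKernel_symA (hN : 1 ≤ N) (hσ : 0 < σ) {t : ℝ} (ht : 0 < t) :
    ∃ C, RhoKernel σ (radKer (symA σ t) : Space N → ℝ) C := by
  obtain ⟨D, hD0, hD⟩ := exists_abs_radKer_symA_le_rho hN hσ ht
  exact ⟨_, .of_le hσ (continuous_radKer (integrable_radSym_symA hN hσ ht)) (radKer_neg _) hD0 hD⟩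

lemma rhoKernel_symP (hN : 1 ≤ N) (hσ : 0 < σ) (T : ℝ) :
    ∃ C, ∀ t, 0 < t → t ≤ T → RhoKernel σ (radKer (symP σ t) : Space N → ℝ) C := by
  obtain ⟨C, hC0, hC⟩ := exists_heat_bound hN hσ T
  exact ⟨C, fun t ht htT => ⟨continuous_radKer (integrable_radSym_symP hN hσ ht), radKer_neg _,
    exists_abs_radKer_symP_le_rho hN hσ ht, hC0, fun x => (hC t ht htT x).2⟩⟩

lemma rho_sub_le' (hσ : 0 < σ) (x y : Space N) :
    rho σ (x - y) ≤ (1 + ‖x‖) ^ ((N : ℝ) + σ) * rho σ y := by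
  rw [← rho_neg, neg_sub]
  exact rho_sub_le hσ y x

namespace RhoKernel

lemma integrable_mul (hK : RhoKernel σ K C) (hσ : 0 < σ) {h : Space N → ℝ} (hh : MemRho σ h)
    (x : Space N) : Integrable fun y => K (x - y) * h y := by
  obtain ⟨D, hD0, hD⟩ := hK.dom
  have h1 := hh.mul_of_le (g := fun y => K (x - y)) (C := D * (1 + ‖x‖) ^ ((N : ℝ) + σ))
    (hK.cont.comp (continuous_const.sub continuous_id)).aestronglyMeasurable fun y => by
      rw [mul_assoc]
      exact (hD _).trans (mul_le_mul_of_nonneg_left (rho_sub_le' hσ x y) hD0)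
  simpa only [mul_comm] using h1

/-- Integrating in `x` first, evenness of `K` turns the inner integral into `∫ |K(y - x)| ρ(x) dx ≤
C ρ(y)`. Preservation of the weight is thus dual to boundedness on `L¹(ρ dx)`. -/
lemma integrable_prod (hK : RhoKernel σ K C) (hσ : 0 < σ) {h : Space N → ℝ} (hh : MemRho σ h) :
    Integrable (fun p : Space N × Space N => K (p.1 - p.2) * h p.2 * rho σ p.1)
      (volume.prod volume) := by
  have hm : AEStronglyMeasurable (fun p : Space N × Space N => K (p.1 - p.2) * h p.2 * rho σ p.1)
      (volume.prod volume) :=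
    ((hK.cont.comp (continuous_fst.sub continuous_snd)).aestronglyMeasurable.mul
      hh.aestronglyMeasurable.comp_snd).mul (continuous_rho.comp continuous_fst).aestronglyMeasurable
  obtain ⟨D, hD0, hD⟩ := hK.dom
  rw [integrable_prod_iff' hm]
  have e : ∀ x y : Space N, ‖K (x - y) * h y * rho σ x‖ = |h y| * (|K (y - x)| * rho σ x) := by
    intro x y
    rw [norm_mul, norm_mul, Real.norm_eq_abs, Real.norm_eq_abs, Real.norm_of_nonneg (rho_nonneg x),
      ← hK.even (x - y), neg_sub]
    ring
  constructor
  · refine .of_forall fun y => ?_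
    have hc : Continuous fun x => K (x - y) * h y * rho σ x :=
      ((hK.cont.comp (continuous_id.sub continuous_const)).mul continuous_const).mul continuous_rho
    refine (((integrable_rho_mul_rho hσ y).const_mul D).const_mul |h y|).mono'
      hc.aestronglyMeasurable (.of_forall fun x => ?_)
    rw [e, ← mul_assoc D]
    exact mul_le_mul_of_nonneg_left (mul_le_mul_of_nonneg_right (hD _) (rho_nonneg _))
      (abs_nonneg _)
  · refine (hh.abs_mul.const_mul C).mono' hm.norm.prod_swap.integral_prod_right'
      (.of_forall fun y => ?_)
    rw [Real.norm_of_nonneg (integral_nonneg fun _ => norm_nonneg _)]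
    simp only [e]
    rw [integral_const_mul, mul_left_comm]
    exact mul_le_mul_of_nonneg_left (hK.bound y) (abs_nonneg _)

lemma memRho_conv (hK : RhoKernel σ K C) (hσ : 0 < σ) {h : Space N → ℝ} (hh : MemRho σ h) :
    MemRho σ fun x => ∫ y, K (x - y) * h y := by
  refine (hK.integrable_prod hσ hh).integral_prod_left.congr (.of_forall fun x => ?_)
  simp only [integral_mul_const]

lemma rhoNorm_conv_le (hK : RhoKernel σ K C) (hσ : 0 < σ) {h : Space N → ℝ} (hh : MemRho σ h) :
    rhoNorm σ (fun x => ∫ y, K (x - y) * h y) ≤ C * rhoNorm σ h := by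
  have hi := (hK.integrable_prod hσ hh).norm
  calc rhoNorm σ (fun x => ∫ y, K (x - y) * h y)
      ≤ ∫ x, ∫ y, ‖K (x - y) * h y * rho σ x‖ := by
        refine integral_mono (hK.memRho_conv hσ hh).abs_mul hi.integral_prod_left fun x => ?_
        simp only [norm_mul, integral_mul_const, Real.norm_of_nonneg (rho_nonneg x)]
        refine mul_le_mul_of_nonneg_right ?_ (rho_nonneg x)
        have h1 := norm_integral_le_integral_norm (μ := volume) fun y => K (x - y) * h y
        simpa only [norm_mul, Real.norm_eq_abs] using h1
    _ = ∫ y, ∫ x, ‖K (x - y) * h y * rho σ x‖ := integral_integral_swap hi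
    _ ≤ ∫ y, C * (|h y| * rho σ y) := by
        refine integral_mono hi.integral_prod_right (hh.abs_mul.const_mul C) fun y => ?_
        have e : ∀ x, ‖K (x - y) * h y * rho σ x‖ = |h y| * (|K (y - x)| * rho σ x) := by
          intro x
          rw [norm_mul, norm_mul, Real.norm_eq_abs, Real.norm_eq_abs,
            Real.norm_of_nonneg (rho_nonneg x), ← hK.even (x - y), neg_sub]
          ring
        simp only [e]
        rw [integral_const_mul, mul_left_comm]
        exact mul_le_mul_of_nonneg_left (hK.bound y) (abs_nonneg _)
    _ = C * rhoNorm σ h := integral_const_mul _ _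

/-- Convolution with an even kernel is symmetric. -/
lemma integral_conv_mul (hK : RhoKernel σ K C) (hσ : 0 < σ) {h g : Space N → ℝ} {D : ℝ}
    (hh : MemRho σ h) (hg : AEStronglyMeasurable g) (hD : ∀ x, |g x| ≤ D * rho σ x) :
    ∫ x, (∫ y, K (x - y) * h y) * g x = ∫ y, h y * ∫ x, K (y - x) * g x := by
  have hi : Integrable (fun p : Space N × Space N => K (p.1 - p.2) * h p.2 * g p.1)
      (volume.prod volume) := by
    refine ((hK.integrable_prod hσ hh).norm.const_mul D).mono' ?_ (.of_forall fun p => ?_)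
    · exact ((hK.cont.comp (continuous_fst.sub continuous_snd)).aestronglyMeasurable.mul
        hh.aestronglyMeasurable.comp_snd).mul hg.comp_fst
    · rw [norm_mul, norm_mul (_ * _) (rho σ _), mul_left_comm,
        Real.norm_of_nonneg (rho_nonneg p.1)]
      exact mul_le_mul_of_nonneg_left (hD _) (norm_nonneg _)
  simp_rw [← integral_mul_const]
  rw [integral_integral_swap hi]
  refine integral_congr_ae (.of_forall fun y => ?_)
  simp only
  rw [← integral_const_mul]
  refine integral_congr_ae (.of_forall fun x => ?_)
  simp only
  rw [← hK.even (x - y), neg_sub]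
  ring

lemma conv_sub (hK : RhoKernel σ K C) (hσ : 0 < σ) {h k : Space N → ℝ} (hh : MemRho σ h)
    (hk : MemRho σ k) (x : Space N) :
    ∫ y, K (x - y) * (h y - k y) = (∫ y, K (x - y) * h y) - ∫ y, K (x - y) * k y := by
  rw [← integral_sub (hK.integrable_mul hσ hh x) (hK.integrable_mul hσ hk x)]
  simp only [mul_sub]

end RhoKernel
end kernel

/-! ### Elements of `L¹(ρ dx)` as functions -/

section Lp
variable {N : ℕ} {σ : ℝ}

lemma memRho_coeFn (u : Lp ℝ 1 (rhoMeasure N σ)) : MemRho σ u :=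
  integrable_rhoMeasure_iff.1 (L1.integrable_coeFn u)

lemma rhoNorm_sub_coeFn (u v : Lp ℝ 1 (rhoMeasure N σ)) :
    rhoNorm σ (fun x => u x - v x) = ‖u - v‖ := by
  rw [L1.norm_eq_integral_norm, integral_rhoMeasure, rhoNorm]
  refine integral_congr_ae ?_
  filter_upwards [ae_rhoMeasure_iff.1 (Lp.coeFn_sub u v)] with x hx
  rw [hx, Pi.sub_apply, Real.norm_eq_abs]

/-- The element of `L¹(ρ dx)` defined by a function. -/
noncomputable def MemRho.toLp {h : Space N → ℝ} (hh : MemRho σ h) : Lp ℝ 1 (rhoMeasure N σ) :=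
  (integrable_rhoMeasure_iff.2 hh).toL1 h

lemma MemRho.coeFn_toLp {h : Space N → ℝ} (hh : MemRho σ h) : ∀ᵐ x, hh.toLp x = h x :=
  ae_rhoMeasure_iff.1 (Integrable.coeFn_toL1 (integrable_rhoMeasure_iff.2 hh))

lemma MemRho.norm_toLp_sub {h k : Space N → ℝ} (hh : MemRho σ h) (hk : MemRho σ k) :
    ‖hh.toLp - hk.toLp‖ = rhoNorm σ fun x => h x - k x := by
  rw [← rhoNorm_sub_coeFn]
  refine rhoNorm_congr ?_
  filter_upwards [hh.coeFn_toLp, hk.coeFn_toLp] with x h1 h2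
  rw [h1, h2]

end Lp

/-! ### Calculus lemmas in time -/

section time

/-- The chain rule along a curve `s ↦ (s, c s)` for a function with continuous partial
derivatives. -/
lemma hasDerivAt_diag {B H₁ H₂ : ℝ → ℝ → ℝ} {c : ℝ → ℝ} {c' s : ℝ}
    (h₁ : ∀ᶠ v : ℝ × ℝ in 𝓝 (s, c s), HasDerivAt (fun r => B r v.2) (H₁ v.1 v.2) v.1)
    (h₂ : ∀ᶠ v : ℝ × ℝ in 𝓝 (s, c s), HasDerivAt (fun r => B v.1 r) (H₂ v.1 v.2) v.2)
    (k₁ : ContinuousAt (fun v : ℝ × ℝ => H₁ v.1 v.2) (s, c s))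
    (k₂ : ContinuousAt (fun v : ℝ × ℝ => H₂ v.1 v.2) (s, c s)) (hc : HasDerivAt c c' s) :
    HasDerivAt (fun r => B r (c r)) (H₁ s (c s) + c' * H₂ s (c s)) s := by
  have e : ∀ {f : ℝ → ℝ} {f' x : ℝ}, HasDerivAt f f' x →
      HasFDerivAt f (f' • (1 : ℝ →L[ℝ] ℝ)) x := fun hf => by
    refine hf.hasFDerivAt.congr_fderiv ?_
    ext
    simp
  have h := hasStrictFDerivAt_uncurry_coprod (𝕜 := ℝ) (u := (s, c s)) (f := B)
    (f₁ := fun a b => H₁ a b • (1 : ℝ →L[ℝ] ℝ)) (f₂ := fun a b => H₂ a b • (1 : ℝ →L[ℝ] ℝ))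
    (h₁.mono fun v hv => e hv) (h₂.mono fun v hv => e hv) (k₁.smul continuousAt_const)
    (k₂.smul continuousAt_const)
  have h3 := h.hasFDerivAt.comp_hasDerivAt s ((hasDerivAt_id s).prodMk hc)
  refine h3.congr_deriv ?_
  simp [Function.HasUncurry.uncurry, mul_comm]

/-- The lemma of du Bois-Reymond on the half-line, in integrated form. -/
lemma eq_sub_integral_of_weak_deriv {m n : ℝ → ℝ} (hm : Continuous m) (hn : Continuous n)
    (h : ∀ θ : ℝ → ℝ, ContDiff ℝ ∞ θ → HasCompactSupport θ → tsupport θ ⊆ Ioi 0 →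
      ∫ t, deriv θ t * m t = ∫ t, θ t * n t) {t : ℝ} (ht : 0 ≤ t) :
    m t = m 0 - ∫ s in (0:ℝ)..t, n s := by
  have hN : ∀ t, HasDerivAt (fun t => ∫ s in (0:ℝ)..t, n s) (n t) t := fun t =>
    intervalIntegral.integral_hasDerivAt_right (hn.intervalIntegrable _ _)
      (hn.stronglyMeasurableAtFilter _ _) hn.continuousAt
  -- The distributional derivative of `M` vanishes on the open half-line, so `M` is constant there,
  -- and by continuity also at `0`.
  set M : ℝ → ℝ := fun t => m t + ∫ s in (0:ℝ)..t, n s with hM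
  have hNc : Continuous fun t => ∫ s in (0:ℝ)..t, n s :=
    continuous_iff_continuousAt.2 fun t => (hN t).continuousAt
  have hMc : Continuous M := hm.add hNc
  have hMθ : ∀ θ : ℝ → ℝ, ContDiff ℝ ∞ θ → HasCompactSupport θ → tsupport θ ⊆ Ioi 0 →
      ∫ t, deriv θ t * M t = 0 := by
    intro θ hθ hθc hθs
    have hd : Continuous (deriv θ) := hθ.continuous_deriv (by simp)
    have i1 : Integrable fun t => deriv θ t * m t :=
      (hd.mul hm).integrable_of_hasCompactSupport hθc.deriv.mul_right
    have i2 : Integrable fun t => deriv θ t * ∫ s in (0:ℝ)..t, n s :=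
      (hd.mul hNc).integrable_of_hasCompactSupport hθc.deriv.mul_right
    have i3 : Integrable fun t => θ t * n t :=
      (hθ.continuous.mul hn).integrable_of_hasCompactSupport hθc.mul_right
    have i4 : Integrable fun t => θ t * ∫ s in (0:ℝ)..t, n s :=
      (hθ.continuous.mul hNc).integrable_of_hasCompactSupport hθc.mul_right
    have hp := integral_mul_deriv_eq_deriv_mul_of_integrable (u := θ) (v := fun t =>
      ∫ s in (0:ℝ)..t, n s) (fun t _ => (hθ.differentiable (by simp) t).hasDerivAt)
      (fun t _ => hN t) i3 i2 i4
    simp only [hM, mul_add]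
    rw [integral_add i1 i2, h θ hθ hθc hθs, hp, neg_add_cancel]
  -- A bump of integral one supported in `[1, 3]`, inside the half-line. The constant value of `M`
  -- must be its average against it.
  set b : ContDiffBump (2 : ℝ) := ⟨1 / 2, 1, by norm_num, by norm_num⟩
  set ψ : ℝ → ℝ := b.normed volume with hψ
  have hψ1 : ∫ t, ψ t = 1 := b.integral_normed
  have hψs : tsupport ψ ⊆ Ioi 0 := by
    rw [hψ, b.tsupport_normed_eq]
    intro x hx
    rw [Metric.mem_closedBall, Real.dist_eq] at hx
    have : |x - 2| ≤ 1 := hx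
    rw [abs_le] at this
    simp only [mem_Ioi]; linarith
  have hψc : HasCompactSupport ψ := b.hasCompactSupport_normed
  have hψd : ContDiff ℝ ∞ ψ := b.contDiff_normed
  set c : ℝ := ∫ t, ψ t * M t with hc
  have hae : ∀ᵐ t, t ∈ Ioi (0:ℝ) → M t - c = 0 := by
    refine isOpen_Ioi.ae_eq_zero_of_integral_contDiff_smul_eq_zero
      ((hMc.sub continuous_const).locallyIntegrable.locallyIntegrableOn _) fun g hg hgc hgs => ?_
    -- Subtracting a multiple of `ψ` makes the integral zero, so the primitive of `k` from `0` has
    -- compact support in the open half-line and is an admissible test function.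
    set k : ℝ → ℝ := fun t => g t - (∫ s, g s) * ψ t with hk
    have hkd : ContDiff ℝ ∞ k := hg.sub (contDiff_const.mul hψd)
    have hkc : HasCompactSupport k := hgc.sub hψc.mul_left
    have hks : tsupport k ⊆ Ioi 0 := by
      refine (tsupport_sub _ _).trans (union_subset hgs ?_)
      exact (closure_mono (Function.support_mul_subset_right _ _)).trans hψs
    have hgi : Integrable g := hg.continuous.integrable_of_hasCompactSupport hgc
    have hψi : Integrable ψ := hψd.continuous.integrable_of_hasCompactSupport hψc
    have hki : ∫ t, k t = 0 := by
      rw [integral_sub hgi (hψi.const_mul _), integral_const_mul, hψ1, mul_one, sub_self]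
    set θ : ℝ → ℝ := fun t => ∫ s in (0:ℝ)..t, k s with hθ
    have hθd : ∀ t, HasDerivAt θ (k t) t := fun t =>
      intervalIntegral.integral_hasDerivAt_right (hkd.continuous.intervalIntegrable _ _)
        (hkd.continuous.stronglyMeasurableAtFilter _ _) hkd.continuous.continuousAt
    have hθ' : deriv θ = k := funext fun t => (hθd t).deriv
    have hθs : ContDiff ℝ ∞ θ :=
      contDiff_infty_iff_deriv.2 ⟨fun t => (hθd t).differentiableAt, by rwa [hθ']⟩
    obtain ⟨r, hr0, hr⟩ : ∃ r, 0 < r ∧ tsupport k ⊆ Ici r := by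
      rcases (tsupport k).eq_empty_or_nonempty with he | hne
      · exact ⟨1, one_pos, by simp [he]⟩
      · obtain ⟨r, hr, hr'⟩ := hkc.isCompact.exists_isLeast hne
        exact ⟨r, hks hr, hr'⟩
    obtain ⟨R, hR⟩ := hkc.isCompact.bddAbove
    have hk0 : ∀ t, t < r → k t = 0 := fun t ht =>
      image_eq_zero_of_notMem_tsupport fun h => absurd (hr h) (not_le.2 ht)
    have hk1 : ∀ t, R < t → k t = 0 := fun t ht =>
      image_eq_zero_of_notMem_tsupport fun h => absurd (hR h) (not_le.2 ht)
    have hθ0 : ∀ t, t < r → θ t = 0 := fun t ht => by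
      refine intervalIntegral.integral_zero_ae (.of_forall fun s hs => hk0 s ?_)
      rcases le_total 0 t with h0 | h0
      · rw [uIoc_of_le h0] at hs; exact hs.2.trans_lt ht
      · rw [uIoc_of_ge h0] at hs; exact hs.2.trans_lt hr0
    have hθ1 : ∀ t, R < t → θ t = 0 := fun t ht => by
      rcases le_or_gt r t with h0 | h0
      · simp only [hθ]
        rw [intervalIntegral.integral_of_le (hr0.le.trans h0)]
        refine Eq.trans ?_ hki
        refine setIntegral_eq_integral_of_forall_compl_eq_zero fun s hs => ?_
        rw [mem_Ioc, not_and_or, not_lt, not_le] at hs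
        rcases hs with hs | hs
        · exact hk0 s (hs.trans_lt hr0)
        · exact hk1 s (ht.trans hs)
      · exact hθ0 t h0
    have hsub : tsupport θ ⊆ Icc r R := by
      refine closure_minimal (fun t ht => ?_) isClosed_Icc
      by_contra hn
      rw [mem_Icc, not_and_or, not_le, not_le] at hn
      exact ht (hn.elim (hθ0 t) (hθ1 t))
    have hθc : HasCompactSupport θ := isCompact_Icc.of_isClosed_subset (isClosed_tsupport _) hsub
    have h1 := hMθ θ hθs hθc (hsub.trans fun x hx => hr0.trans_le hx.1)
    rw [hθ'] at h1
    have i1 : Integrable fun t => g t * M t :=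
      (hg.continuous.mul hMc).integrable_of_hasCompactSupport hgc.mul_right
    have i2 : Integrable fun t => ψ t * M t :=
      (hψd.continuous.mul hMc).integrable_of_hasCompactSupport hψc.mul_right
    have h2 : ∫ t, k t * M t = (∫ t, g t * M t) - (∫ s, g s) * c := by
      rw [hc, ← integral_const_mul, ← integral_sub i1 (i2.const_mul _)]
      refine integral_congr_ae (.of_forall fun t => ?_)
      simp only [hk]
      ring
    rw [h2] at h1
    simp only [smul_eq_mul, mul_sub]
    rw [integral_sub i1 (hgi.mul_const c), integral_mul_const, h1]
  have hEq : EqOn M (fun _ => c) (Ioi 0) := by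
    refine Measure.eqOn_open_of_ae_eq (μ := volume) ?_ isOpen_Ioi hMc.continuousOn
      continuousOn_const
    rw [EventuallyEq, ae_restrict_iff' measurableSet_Ioi]
    filter_upwards [hae] with t ht h0 using sub_eq_zero.1 (ht h0)
  have hEq' : EqOn M (fun _ => c) (Ici 0) := by
    rw [← closure_Ioi]
    exact hEq.closure hMc continuous_const
  have e1 := hEq' (mem_Ici.2 ht)
  have e2 := hEq' (mem_Ici.2 (le_refl (0:ℝ)))
  simp only [hM, intervalIntegral.integral_same, add_zero] at e1 e2
  linarith

end time

/-! ### Pairing with the heat evolution of a test function -/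

section heatPairing
variable {N : ℕ} {σ : ℝ} {φ : Space N → ℝ}

attribute [local irreducible] heatMul heatC

lemma continuous_heatMul_time (hφ : ContDiff ℝ ∞ φ) (hc : HasCompactSupport φ) (hσ : 0 < σ)
    {a : ℝ} (ha : 0 ≤ a) (x : Space N) : Continuous fun t : ℝ => heatMul σ a |t| φ x :=
  Continuous.comp (g := fun p : Space N × ℝ => heatMul σ a |p.2| φ p.1) (f := fun t : ℝ => (x, t))
    (continuous_heatMul hφ hc hσ ha) (by fun_prop)

lemma continuous_heatMul_of_nonneg (hφ : ContDiff ℝ ∞ φ) (hc : HasCompactSupport φ) (hσ : 0 < σ)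
    {a : ℝ} (ha : 0 ≤ a) {t : ℝ} (ht : 0 ≤ t) : Continuous (heatMul σ a t φ) := by
  have h := Continuous.comp (g := fun p : Space N × ℝ => heatMul σ a |p.2| φ p.1)
    (f := fun x : Space N => (x, t)) (continuous_heatMul hφ hc hσ ha) (by fun_prop)
  simpa only [Function.comp_def, abs_of_nonneg ht] using h

lemma tendsto_integral_mul_heatMul (hN : 1 ≤ N) (hσ : 0 < σ) (hφ : ContDiff ℝ ∞ φ)
    (hc : HasCompactSupport φ) {a : ℝ} (ha : GoodExp σ a) {ι : Type*} {l : Filter ι}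
    [l.IsCountablyGenerated] {U : ι → Space N → ℝ} {U₀ : Space N → ℝ} {τ : ι → ℝ} {τ₀ : ℝ}
    (hU : ∀ᶠ i in l, MemRho σ (U i)) (hU₀ : MemRho σ U₀)
    (hlim : Tendsto (fun i => rhoNorm σ fun x => U i x - U₀ x) l (𝓝 0))
    (hτ : Tendsto τ l (𝓝 τ₀)) :
    Tendsto (fun i => ∫ x, U i x * heatMul σ a |τ i| φ x) l
      (𝓝 (∫ x, U₀ x * heatMul σ a |τ₀| φ x)) := by
  obtain ⟨C, -, hC⟩ := exists_abs_heatMul_le_uniform hN hσ hφ hc ha (|τ₀| + 1)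
  refine tendsto_integral_mul (g := fun i => heatMul σ a |τ i| φ) (g₀ := heatMul σ a |τ₀| φ)
    (C := C) hU hU₀ hlim (.of_forall fun i => ?_) ?_ fun x => ?_
  · exact (continuous_heatMul_of_nonneg hφ hc hσ (ha.nonneg hσ)
      (abs_nonneg _)).aestronglyMeasurable
  · have : ∀ᶠ i in l, |τ i| < |τ₀| + 1 :=
      hτ.abs.eventually_lt tendsto_const_nhds (by linarith)
    filter_upwards [this] with i hi using hC _ (abs_nonneg _) hi.le
  · exact ((continuous_heatMul_time hφ hc hσ (ha.nonneg hσ) x).tendsto τ₀).comp hτ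

/-- The fundamental theorem of calculus for the semigroup, paired with `h`. The domination by `ρ`,
uniform in time, allows the exchange of the integrals. -/
lemma integral_mul_heatMul_sub (hN : 1 ≤ N) (hσ : 0 < σ) (hφ : ContDiff ℝ ∞ φ)
    (hc : HasCompactSupport φ) {a : ℝ} (ha : GoodExp σ a) {h : Space N → ℝ} (hh : MemRho σ h)
    {τ : ℝ} (hτ : 0 ≤ τ) :
    (∫ x, h x * heatMul σ a 0 φ x) - ∫ x, h x * heatMul σ a τ φ x =
      ∫ r in (0:ℝ)..τ, ∫ x, h x * heatMul σ (a + σ / 2) r φ x := by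
  obtain ⟨C, -, hC⟩ := exists_abs_heatMul_le_uniform hN hσ hφ hc ha τ
  obtain ⟨C', -, hC'⟩ := exists_abs_heatMul_le_uniform hN hσ hφ hc (ha.add hσ) τ
  have ha0 := ha.nonneg hσ
  have hm : ∀ t, 0 ≤ t → AEStronglyMeasurable (heatMul σ a t φ) := fun t ht =>
    (continuous_heatMul_of_nonneg hφ hc hσ ha0 ht).aestronglyMeasurable
  rw [← integral_sub (hh.mul_of_le (hm 0 le_rfl) (hC 0 le_rfl hτ))
    (hh.mul_of_le (hm τ hτ) (hC τ hτ le_rfl))]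
  have e : ∀ r ∈ uIcc 0 τ, |r| = r := fun r hr => by
    rw [uIcc_of_le hτ] at hr; exact abs_of_nonneg hr.1
  have h1 := integral_mul_intervalIntegral hh (G := fun r => heatMul σ (a + σ / 2) |r| φ)
    (continuous_heatMul hφ hc hσ (by positivity)) hτ (C := C') fun r hr hr' => by
      rw [abs_of_nonneg hr]; exact hC' r hr hr'
  have h2 : ∀ x, ∫ r in (0:ℝ)..τ, heatMul σ (a + σ / 2) |r| φ x =
      heatMul σ a 0 φ x - heatMul σ a τ φ x := fun x => by
    rw [heatMul_sub_eq_integral hφ hc hσ ha0 hτ]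
    exact intervalIntegral.integral_congr fun r hr => by simp only [e r hr]
  simp_rw [h2, mul_sub] at h1
  rw [h1]
  exact intervalIntegral.integral_congr fun r hr => by simp only [e r hr]

end heatPairing

/-! ### Convolutions as averages of translates. -/

section translation
variable {N : ℕ} {σ : ℝ} {K : Space N → ℝ} {C : ℝ}

namespace RhoKernel

lemma integrable_prod_translate (hK : RhoKernel σ K C) (hσ : 0 < σ) {h g : Space N → ℝ} {D : ℝ}
    (hh : MemRho σ h) (hg : Continuous g) (hD0 : 0 ≤ D) (hD : ∀ x, |g x| ≤ D * rho σ x) :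
    Integrable (fun p : Space N × Space N => h p.1 * (K p.2 * g (p.1 - p.2)))
      (volume.prod volume) ∧
    ∫ p, ‖h p.1 * (K p.2 * g (p.1 - p.2))‖ ∂((volume : Measure (Space N)).prod volume) ≤
      D * C * rhoNorm σ h := by
  have hm : AEStronglyMeasurable (fun p : Space N × Space N => h p.1 * (K p.2 * g (p.1 - p.2)))
      (volume.prod volume) :=
    hh.aestronglyMeasurable.comp_fst.mul ((hK.cont.comp continuous_snd).mul
      (hg.comp (continuous_fst.sub continuous_snd))).aestronglyMeasurable
  obtain ⟨D', hD'0, hD'⟩ := hK.dom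
  have hKi : ∀ x, Integrable fun z => |K z| * rho σ (x - z) := fun x => by
    refine ((integrable_rho_mul_rho hσ x).const_mul D').mono' (hK.cont.abs.mul
      (continuous_rho.comp (continuous_const.sub continuous_id))).aestronglyMeasurable
      (.of_forall fun z => ?_)
    rw [Real.norm_of_nonneg (mul_nonneg (abs_nonneg _) (rho_nonneg _)), mul_left_comm, mul_comm]
    exact mul_le_mul_of_nonneg_left (hD' z) (rho_nonneg _) |>.trans_eq (by ring)
  have hKb : ∀ x, ∫ z, |K z| * rho σ (x - z) ≤ C * rho σ x := fun x => by
    refine le_trans (le_of_eq ?_) (hK.bound x)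
    rw [← integral_sub_left_eq_self _ _ x]
    simp only [sub_sub_cancel]
  have hle : ∀ x z, ‖h x * (K z * g (x - z))‖ ≤ |h x| * D * (|K z| * rho σ (x - z)) := by
    intro x z
    rw [norm_mul, norm_mul, Real.norm_eq_abs, Real.norm_eq_abs, Real.norm_eq_abs, mul_assoc]
    refine mul_le_mul_of_nonneg_left ?_ (abs_nonneg _)
    rw [mul_left_comm]
    exact mul_le_mul_of_nonneg_left (hD _) (abs_nonneg _)
  have hin : ∀ x, Integrable fun z => h x * (K z * g (x - z)) := fun x =>
    ((hKi x).const_mul _).mono' (continuous_const.mul (hK.cont.mul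
      (hg.comp (continuous_const.sub continuous_id)))).aestronglyMeasurable (.of_forall (hle x))
  have hb : ∀ x, ∫ z, ‖h x * (K z * g (x - z))‖ ≤ D * C * (|h x| * rho σ x) := fun x => by
    refine (integral_mono (hin x).norm ((hKi x).const_mul _) (hle x)).trans ?_
    rw [integral_const_mul]
    refine (mul_le_mul_of_nonneg_left (hKb x) (mul_nonneg (abs_nonneg _) hD0)).trans_eq ?_
    ring
  have hint : Integrable (fun p : Space N × Space N => h p.1 * (K p.2 * g (p.1 - p.2)))
      (volume.prod volume) := by
    rw [integrable_prod_iff hm]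
    refine ⟨.of_forall hin, (hh.abs_mul.const_mul (D * C)).mono' hm.norm.integral_prod_right'
      (.of_forall fun x => ?_)⟩
    rw [Real.norm_of_nonneg (integral_nonneg fun _ => norm_nonneg _)]
    exact hb x
  refine ⟨hint, ?_⟩
  rw [integral_prod _ hint.norm, rhoNorm, ← integral_const_mul]
  exact integral_mono hint.norm.integral_prod_left (hh.abs_mul.const_mul _) hb

/-- Pairing with `K * g` is an average, with weight `K`, of pairings with translates of `g`. This
extends identities known for compactly supported functions and their translates to the heat
evolution, which has no compact support. -/
lemma integral_mul_conv (hK : RhoKernel σ K C) (hσ : 0 < σ) {h g : Space N → ℝ} {D : ℝ}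
    (hh : MemRho σ h) (hg : Continuous g) (hD0 : 0 ≤ D) (hD : ∀ x, |g x| ≤ D * rho σ x) :
    ∫ x, h x * ∫ y, K (x - y) * g y = ∫ z, K z * ∫ x, h x * g (x - z) := by
  have e : ∀ x, ∫ y, K (x - y) * g y = ∫ z, K z * g (x - z) := fun x => by
    rw [← integral_sub_left_eq_self _ _ x]
    simp only [sub_sub_cancel]
  simp_rw [e, ← integral_const_mul]
  rw [integral_integral_swap (hK.integrable_prod_translate hσ hh hg hD0 hD).1]
  simp only [mul_left_comm]

lemma integrable_mul_translate (hK : RhoKernel σ K C) (hσ : 0 < σ) {h g : Space N → ℝ} {D : ℝ}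
    (hh : MemRho σ h) (hg : Continuous g) (hD0 : 0 ≤ D) (hD : ∀ x, |g x| ≤ D * rho σ x) :
    Integrable (fun z => K z * ∫ x, h x * g (x - z)) ∧
      ∫ z, |K z * ∫ x, h x * g (x - z)| ≤ D * C * rhoNorm σ h := by
  obtain ⟨h1, h2⟩ := hK.integrable_prod_translate hσ hh hg hD0 hD
  have e : ∀ z, ∫ x, h x * (K z * g (x - z)) = K z * ∫ x, h x * g (x - z) := fun z => by
    rw [← integral_const_mul]; simp only [mul_left_comm]
  have h3 := h1.integral_prod_right
  simp only [e] at h3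
  refine ⟨h3, ?_⟩
  rw [integral_prod_symm _ h1.norm] at h2
  refine le_trans (integral_mono h3.abs h1.norm.integral_prod_right fun z => ?_) h2
  simp only [← e]
  exact norm_integral_le_integral_norm (μ := volume) fun x => h x * (K z * g (x - z))

end RhoKernel
end translation

/-! ### Uniqueness -/

section uniqueness
variable {N : ℕ} {σ : ℝ} {φ : Space N → ℝ}

attribute [local irreducible] heatMul heatC

lemma tendsto_rhoNorm_coeFn {X : Type*} [TopologicalSpace X] {w : X → Lp ℝ 1 (rhoMeasure N σ)}
    {s₀ : X} (hw : ContinuousAt w s₀) :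
    Tendsto (fun s => rhoNorm σ fun x => w s x - w s₀ x) (𝓝 s₀) (𝓝 0) := by
  simp_rw [rhoNorm_sub_coeFn]
  exact tendsto_iff_norm_sub_tendsto_zero.1 hw

lemma rhoNorm_coeFn (u : Lp ℝ 1 (rhoMeasure N σ)) : rhoNorm σ u = ‖u‖ := by
  have h := rhoNorm_sub_coeFn u 0
  rw [sub_zero] at h
  rw [← h]
  refine rhoNorm_congr ?_
  filter_upwards [ae_rhoMeasure_iff.1 (Lp.coeFn_zero ℝ 1 (rhoMeasure N σ))] with x hx
  rw [hx, Pi.zero_apply, sub_zero]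

/-- The equation tested with the heat evolution of a test function. -/
lemma integral_mul_heatMul_eq (hN : 1 ≤ N) (hσ : 0 < σ) {w : ℝ → Lp ℝ 1 (rhoMeasure N σ)}
    (hw : Continuous w)
    (h : ∀ φ : Space N → ℝ, ContDiff ℝ ∞ φ → HasCompactSupport φ → ∀ t, 0 ≤ t →
      ∫ x, w t x * φ x = -∫ s in (0:ℝ)..t, ∫ x, w s x * heatMul σ (σ / 2) 0 φ x)
    (hφ : ContDiff ℝ ∞ φ) (hc : HasCompactSupport φ) {t τ : ℝ} (ht : 0 ≤ t) (hτ : 0 < τ) :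
    ∫ x, w t x * heatMul σ 0 τ φ x =
      -∫ s in (0:ℝ)..t, ∫ x, w s x * heatMul σ (σ / 2) τ φ x := by
  have hd : 0 ≤ (N : ℝ) + σ := by positivity
  have g0 : GoodExp σ 0 := Or.inl rfl
  have g1 : GoodExp σ (σ / 2) := Or.inr le_rfl
  obtain ⟨C, hK⟩ := rhoKernel_symP (N := N) hN hσ τ
  replace hK := hK τ hτ le_rfl
  obtain ⟨D₀, hD₀0, hD₀⟩ := exists_abs_heatMul_le hN hσ hφ hc g0
  obtain ⟨D, hD0, hD⟩ := exists_abs_heatMul_le hN hσ hφ hc g1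
  have c0 := continuous_heatMul_of_nonneg hφ hc hσ le_rfl (le_refl (0:ℝ))
  have c1 := continuous_heatMul_of_nonneg hφ hc hσ (g1.nonneg hσ) (le_refl (0:ℝ))
  set K : Space N → ℝ := radKer (symP σ τ) with hKdef
  have r0 : ∫ x, w t x * heatMul σ 0 τ φ x = ∫ z, K z * ∫ x, w t x * heatMul σ 0 0 φ (x - z) := by
    simp_rw [← integral_symP_mul_heatMul hN hσ hφ hc g0 hτ]
    exact hK.integral_mul_conv hσ (memRho_coeFn _) c0 hD₀0 hD₀
  have r1 : ∀ s, ∫ x, w s x * heatMul σ (σ / 2) τ φ x =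
      ∫ z, K z * ∫ x, w s x * heatMul σ (σ / 2) 0 φ (x - z) := fun s => by
    simp_rw [← integral_symP_mul_heatMul hN hσ hφ hc g1 hτ]
    exact hK.integral_mul_conv hσ (memRho_coeFn _) c1 hD0 hD
  set J : ℝ → Space N → ℝ := fun s z => ∫ x, w s x * heatMul σ (σ / 2) 0 φ (x - z) with hJ
  -- The hypothesis is applied to the translate of `φ` by `z`; the fractional Laplacian commutes
  -- with translations.
  have e0 : ∀ z, ∫ x, w t x * heatMul σ 0 0 φ (x - z) = -∫ s in (0:ℝ)..t, J s z := fun z => by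
    have h1 := h (fun x => φ (x - z)) (hφ.comp (contDiff_id.sub contDiff_const))
      (hc.comp_homeomorph (Homeomorph.subRight z)) t ht
    simp_rw [heatMul_translate] at h1
    simp_rw [heatMul_zero_zero hφ hc]
    exact h1
  -- Joint continuity supplies the measurability needed for Fubini. For `z` near `z₀`, Peetre's
  -- inequality dominates the translated function by a multiple of `ρ`.
  have hJc : Continuous fun p : ℝ × Space N => J p.1 p.2 := by
    rw [continuous_iff_continuousAt]
    rintro ⟨s₀, z₀⟩
    refine tendsto_integral_mul (l := 𝓝 (s₀, z₀)) (U := fun p : ℝ × Space N => w p.1)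
      (g := fun p x => heatMul σ (σ / 2) 0 φ (x - p.2))
      (C := D * (1 + (‖z₀‖ + 1)) ^ ((N : ℝ) + σ)) (.of_forall fun p => memRho_coeFn _)
      (memRho_coeFn _) ?_ (.of_forall fun p => ?_) ?_ fun x => ?_
    · exact tendsto_rhoNorm_coeFn (hw.comp continuous_fst).continuousAt
    · exact (c1.comp (continuous_id.sub continuous_const)).aestronglyMeasurable
    · have : ∀ᶠ p : ℝ × Space N in 𝓝 (s₀, z₀), ‖p.2‖ < ‖z₀‖ + 1 :=
        (continuous_snd.norm.tendsto (s₀, z₀)).eventually_lt tendsto_const_nhds (by simp)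
      filter_upwards [this] with p hp x
      refine (hD _).trans ?_
      rw [mul_assoc]
      refine mul_le_mul_of_nonneg_left ((rho_sub_le hσ x p.2).trans ?_) hD0
      refine mul_le_mul_of_nonneg_right ?_ (rho_nonneg _)
      exact Real.rpow_le_rpow (by positivity) (by linarith) hd
    · exact (c1.comp (continuous_const.sub continuous_snd)).tendsto (s₀, z₀)
  rw [r0]
  have r2 : ∀ s, ∫ x, w s x * heatMul σ (σ / 2) τ φ x = ∫ z, K z * J s z := r1
  have r3 : ∀ z, K z * ∫ s in Ioc 0 t, J s z = ∫ s in Ioc 0 t, K z * J s z := fun z =>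
    (integral_const_mul _ _).symm
  simp_rw [e0, r2, mul_neg]
  rw [integral_neg]
  congr 1
  simp_rw [intervalIntegral.integral_of_le ht, r3]
  refine (integral_integral_swap (μ := volume.restrict (Ioc 0 t)) (ν := volume)
    (f := fun s z => K z * J s z) ?_).symm
  have hm : AEStronglyMeasurable (fun p : ℝ × Space N => K p.2 * J p.1 p.2)
      ((volume.restrict (Ioc 0 t)).prod volume) :=
    ((hK.cont.comp continuous_snd).mul hJc).aestronglyMeasurable
  have hb := fun s => hK.integrable_mul_translate hσ (memRho_coeFn (w s)) c1 hD0 hD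
  refine (integrable_prod_iff hm).2 ⟨.of_forall fun s => (hb s).1, ?_⟩
  have hi : Integrable (fun s => D * C * ‖w s‖) (volume.restrict (Ioc 0 t)) :=
    (continuous_const.mul hw.norm).integrableOn_Ioc
  refine hi.mono' hm.norm.integral_prod_right' (.of_forall fun s => ?_)
  rw [Real.norm_of_nonneg (integral_nonneg fun _ => norm_nonneg _), ← rhoNorm_coeFn]
  exact (hb s).2

/-- A continuous curve in `L¹(ρ dx)` starting at zero and solving the fractional heat equation
weakly vanishes. -/
theorem eq_zero_of_integral_mul_eq (hN : 1 ≤ N) (hσ : 0 < σ)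
    {w : ℝ → Lp ℝ 1 (rhoMeasure N σ)} (hw : Continuous w) (h0 : w 0 = 0)
    (h : ∀ φ : Space N → ℝ, ContDiff ℝ ∞ φ → HasCompactSupport φ → ∀ t, 0 ≤ t →
      ∫ x, w t x * φ x = -∫ s in (0:ℝ)..t, ∫ x, w s x * heatMul σ (σ / 2) 0 φ x)
    {t : ℝ} (ht : 0 < t) : w t = 0 := by
  have g0 : GoodExp σ 0 := Or.inl rfl
  have g1 : GoodExp σ (σ / 2) := Or.inr le_rfl
  suffices hs : ∀ φ : Space N → ℝ, ContDiff ℝ ∞ φ → HasCompactSupport φ → ∫ x, w t x * φ x = 0 by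
    have hli : LocallyIntegrable (w t : Space N → ℝ) := by
      have e : (w t : Space N → ℝ) = fun x => w t x * rho σ x * (rho σ x)⁻¹ := by
        funext x; rw [mul_inv_cancel_right₀ (rho_pos x).ne']
      rw [e, ← locallyIntegrableOn_univ]
      exact ((Integrable.locallyIntegrable (memRho_coeFn (w t))).locallyIntegrableOn _).mul_continuousOn
        (continuous_rho.inv₀ fun x => (rho_pos x).ne').continuousOn isOpen_univ.isLocallyClosed
    have hz := ae_eq_zero_of_integral_contDiff_smul_eq_zero hli fun φ hφ hc => by
      simpa only [smul_eq_mul, mul_comm] using hs φ hφ hc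
    refine Lp.ext (ae_rhoMeasure_iff.2 ?_)
    filter_upwards [hz, ae_rhoMeasure_iff.1 (Lp.coeFn_zero ℝ 1 (rhoMeasure N σ))] with x h1 h2
    rw [h1, h2, Pi.zero_apply]
  intro φ hφ hc
  have hlim : ∀ {a : ℝ}, GoodExp σ a → Continuous fun v : ℝ × ℝ =>
      ∫ x, w v.1 x * heatMul σ a |v.2| φ x := fun ha => by
    rw [continuous_iff_continuousAt]
    intro v₀
    exact tendsto_integral_mul_heatMul hN hσ hφ hc ha (U := fun v : ℝ × ℝ => w v.1)
      (.of_forall fun _ => memRho_coeFn _) (memRho_coeFn _)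
      (tendsto_rhoNorm_coeFn (hw.comp continuous_fst).continuousAt) (continuous_snd.tendsto v₀)
  -- The curve `w(s)` is paired with `φ` evolved for a time `τ`. The equation gives `∂_s B = -H` and
  -- the semigroup gives `∂_τ B = -H`. The two cancel along `τ = t - s`, so `B(t, 0) = B(0, t) = 0`.
  -- Derivatives are needed only for `s, τ > 0`; continuity covers the end points.
  set B : ℝ → ℝ → ℝ := fun s τ => ∫ x, w s x * heatMul σ 0 |τ| φ x with hB
  set H : ℝ → ℝ → ℝ := fun s τ => ∫ x, w s x * heatMul σ (σ / 2) |τ| φ x with hH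
  have hBc : Continuous fun v : ℝ × ℝ => B v.1 v.2 := hlim g0
  have hHc : Continuous fun v : ℝ × ℝ => H v.1 v.2 := hlim g1
  have hd1 : ∀ v : ℝ × ℝ, 0 < v.1 → 0 < v.2 → HasDerivAt (fun r => B r v.2) (-H v.1 v.2) v.1 := by
    rintro ⟨s, τ⟩ hs hτ
    simp only at hs hτ ⊢
    have hc1 : Continuous fun r => H r τ := hHc.comp (continuous_id.prodMk continuous_const)
    have h1 := (intervalIntegral.integral_hasDerivAt_right (hc1.intervalIntegrable 0 s)
      (hc1.stronglyMeasurableAtFilter _ _) hc1.continuousAt).neg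
    refine h1.congr_of_eventuallyEq ?_
    filter_upwards [lt_mem_nhds hs] with r hr
    simp only [hB, hH, abs_of_pos hτ, Pi.neg_apply]
    exact integral_mul_heatMul_eq hN hσ hw h hφ hc hr.le hτ
  have hd2 : ∀ v : ℝ × ℝ, 0 < v.1 → 0 < v.2 → HasDerivAt (fun r => B v.1 r) (-H v.1 v.2) v.2 := by
    rintro ⟨s, τ⟩ hs hτ
    simp only at hs hτ ⊢
    have hc1 : Continuous fun r => H s r := hHc.comp (continuous_const.prodMk continuous_id)
    have h1 := (intervalIntegral.integral_hasDerivAt_right (hc1.intervalIntegrable 0 τ)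
      (hc1.stronglyMeasurableAtFilter _ _) hc1.continuousAt).const_sub (B s 0)
    refine h1.congr_of_eventuallyEq ?_
    filter_upwards [lt_mem_nhds hτ] with r hr
    have h2 := integral_mul_heatMul_sub hN hσ hφ hc g0 (memRho_coeFn (w s)) hr.le
    rw [zero_add] at h2
    simp only [hB, hH, abs_of_pos hr, abs_zero]
    have h3 : ∫ q in (0:ℝ)..r, ∫ x, w s x * heatMul σ (σ / 2) |q| φ x =
        ∫ q in (0:ℝ)..r, ∫ x, w s x * heatMul σ (σ / 2) q φ x := by
      refine intervalIntegral.integral_congr fun q hq => ?_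
      rw [uIcc_of_le hr.le] at hq
      simp only [abs_of_nonneg hq.1]
    rw [h3, ← h2, sub_sub_cancel]
  have hev : ∀ s ∈ Ioo 0 t, ∀ᶠ v : ℝ × ℝ in 𝓝 (s, t - s), 0 < v.1 ∧ 0 < v.2 := fun s hs =>
    ((continuous_fst.tendsto (s, t - s)).eventually_const_lt hs.1).and
      ((continuous_snd.tendsto (s, t - s)).eventually_const_lt (sub_pos.2 hs.2))
  have hG : ∀ s ∈ Ioo 0 t, HasDerivAt (fun r => B r (t - r)) 0 s := fun s hs => by
    have h1 := hasDerivAt_diag (B := B) (H₁ := fun a b => -H a b) (H₂ := fun a b => -H a b)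
      (c := fun r => t - r) (c' := -1) (s := s)
      ((hev s hs).mono fun v hv => hd1 v hv.1 hv.2) ((hev s hs).mono fun v hv => hd2 v hv.1 hv.2)
      hHc.neg.continuousAt hHc.neg.continuousAt ((hasDerivAt_id s).const_sub t)
    exact h1.congr_deriv (by ring)
  have hGc : Continuous fun r => B r (t - r) :=
    hBc.comp (continuous_id.prodMk (continuous_const.sub continuous_id))
  obtain ⟨c, hcI, hcE⟩ := exists_hasDerivAt_eq_slope (fun r => B r (t - r)) (fun _ => 0) ht
    hGc.continuousOn hG
  have hBt : B t (t - t) = B 0 (t - 0) := by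
    rw [eq_comm, div_eq_zero_iff] at hcE
    rcases hcE with h1 | h1
    · linarith
    · linarith
  have hB0 : B 0 (t - 0) = 0 := by
    simp only [hB, h0]
    refine integral_eq_zero_of_ae ?_
    filter_upwards [ae_rhoMeasure_iff.1 (Lp.coeFn_zero ℝ 1 (rhoMeasure N σ))] with x hx
    rw [hx, Pi.zero_apply, zero_mul]
  rw [hB0, sub_self] at hBt
  simp only [hB, abs_zero, heatMul_zero_zero hφ hc] at hBt
  exact hBt

end uniqueness

/-! ### The source term -/

section singular
variable {N : ℕ} {σ α c : ℝ}

/-- Pointwise bound for the singular convolution with `A_σ(·,τ)`. -/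
lemma exists_abs_conv_symA_le (hN : 1 ≤ N) (hσ : 0 < σ) (hα : 0 < α) (hασ : α ≤ σ) (hc : 0 ≤ c) :
    ∃ C : ℝ, 0 ≤ C ∧ ∀ h : Space N → ℝ, MemRho σ h → (∀ x y, |h x - h y| ≤ c * ‖x - y‖ ^ α) →
      ∀ τ, 0 < τ → ∀ x, |∫ y, radKer (symA σ τ) (x - y) * h y| ≤
        C * (τ ^ (α / 2 / σ - 1) + (∫ y, rho σ (x - y) * |h y|) + |h x|) := by
  -- Half of the Hölder exponent is used because the moment estimate requires an order below `σ`,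
  -- while `α = σ` is allowed. The power `τ^{α/(2σ)-1}` is still integrable at `0`.
  obtain ⟨C₁, hC₁0, hC₁⟩ := exists_moment_symA (N := N) hN hσ (a := α / 2) (by positivity)
    (by linarith)
  obtain ⟨C₂, hC₂0, hC₂⟩ := exists_abs_radKer_symA_le_far (N := N) hN hσ
  have hI : 0 ≤ ∫ x : Space N, rho σ x := integral_nonneg fun _ => rho_nonneg _
  refine ⟨c * C₁ + C₂ + C₂ * ∫ x : Space N, rho σ x, by positivity, fun h hh hH τ hτ x => ?_⟩
  set K : Space N → ℝ := radKer (symA σ τ) with hK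
  obtain ⟨C', hRK⟩ := rhoKernel_symA (N := N) hN hσ hτ
  obtain ⟨_, hρK⟩ : ∃ D, RhoKernel σ (rho σ : Space N → ℝ) D :=
    ⟨_, .of_le hσ (D := 1) continuous_rho rho_neg zero_le_one fun x => by
      rw [one_mul, abs_of_nonneg (rho_nonneg x)]⟩
  have habs : MemRho σ fun y => |h y| := hh.abs_mul
  have hρi : Integrable fun y => rho σ (x - y) * |h y| := hρK.integrable_mul hσ habs x
  have hKi : Integrable fun y => K (x - y) := (integrable_radKer_symA hN hσ hτ).comp_sub_left x
  have hK0 : ∫ y, K (x - y) = 0 := by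
    rw [integral_sub_left_eq_self K volume x]; exact integral_radKer_symA hN hσ hτ
  obtain ⟨hmi, hmb⟩ := hC₁ τ hτ
  have hmi' : Integrable fun y => |K (x - y)| * ‖x - y‖ ^ (α / 2) := hmi.comp_sub_left x
  have hmb' : ∫ y, |K (x - y)| * ‖x - y‖ ^ (α / 2) ≤ C₁ * τ ^ (α / 2 / σ - 1) := by
    rw [integral_sub_left_eq_self (fun z => |K z| * ‖z‖ ^ (α / 2)) volume x]
    exact hmb
  -- The kernel has mean zero. Near `x` the Hölder condition beats its singularity; at distance at
  -- least `1` it is bounded by a multiple of `ρ`, uniformly in `τ`.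
  have e : ∫ y, K (x - y) * h y = ∫ y, K (x - y) * (h y - h x) := by
    have h1 := hRK.integrable_mul hσ hh x
    simp only [mul_sub]
    rw [integral_sub h1 (hKi.mul_const _), integral_mul_const, hK0, zero_mul, sub_zero]
  have hr1 : Integrable fun y => rho σ (x - y) := (integrable_rho hσ).comp_sub_left x
  have hr2 : ∫ y, rho σ (x - y) = ∫ y : Space N, rho σ y := integral_sub_left_eq_self _ volume x
  have hpt : ∀ y, ‖K (x - y) * (h y - h x)‖ ≤ c * (|K (x - y)| * ‖x - y‖ ^ (α / 2)) +
      (C₂ * (rho σ (x - y) * |h y|) + C₂ * |h x| * rho σ (x - y)) := by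
    intro y
    rw [norm_mul, Real.norm_eq_abs, Real.norm_eq_abs]
    have hr := rho_nonneg (σ := σ) (x - y)
    rcases le_total ‖x - y‖ 1 with hy | hy
    · have h1 : |h y - h x| ≤ c * ‖x - y‖ ^ (α / 2) := by
        rw [abs_sub_comm]
        refine (hH x y).trans (mul_le_mul_of_nonneg_left ?_ hc)
        exact Real.rpow_le_rpow_of_exponent_ge' (norm_nonneg _) hy (by positivity) (by linarith)
      have h2 : 0 ≤ C₂ * (rho σ (x - y) * |h y|) + C₂ * |h x| * rho σ (x - y) := by positivity
      calc _ ≤ |K (x - y)| * (c * ‖x - y‖ ^ (α / 2)) :=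
            mul_le_mul_of_nonneg_left h1 (abs_nonneg _)
        _ ≤ _ := by linarith
    · have h1 := hC₂ τ hτ (x - y) hy
      have h2 : |h y - h x| ≤ |h y| + |h x| := abs_sub _ _
      have h3 : 0 ≤ c * (|K (x - y)| * ‖x - y‖ ^ (α / 2)) := by positivity
      calc _ ≤ (C₂ * rho σ (x - y)) * (|h y| + |h x|) :=
            mul_le_mul h1 h2 (abs_nonneg _) (by positivity)
        _ ≤ _ := by linarith
  rw [e, ← Real.norm_eq_abs]
  have i2 : Integrable fun y => C₂ * (rho σ (x - y) * |h y|) + C₂ * |h x| * rho σ (x - y) :=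
    (hρi.const_mul C₂).add (hr1.const_mul (C₂ * |h x|))
  refine (norm_integral_le_of_norm_le ((hmi'.const_mul c).add i2) (.of_forall hpt)).trans ?_
  simp only [Pi.add_apply]
  rw [integral_add (hmi'.const_mul c) i2, integral_add (hρi.const_mul C₂) (hr1.const_mul (C₂ * |h x|)), integral_const_mul,
    integral_const_mul, integral_const_mul, hr2]
  have hA : 0 ≤ τ ^ (α / 2 / σ - 1) := by positivity
  have hB : 0 ≤ ∫ y, rho σ (x - y) * |h y| :=
    integral_nonneg fun _ => mul_nonneg (rho_nonneg _) (abs_nonneg _)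
  have hX := abs_nonneg (h x)
  set A := τ ^ (α / 2 / σ - 1)
  set B := ∫ y, rho σ (x - y) * |h y|
  set I := ∫ x : Space N, rho σ x
  have h1 : c * ∫ y, |K (x - y)| * ‖x - y‖ ^ (α / 2) ≤ c * (C₁ * A) :=
    mul_le_mul_of_nonneg_left hmb' hc
  have h2 : (c * C₁ + C₂ + C₂ * I) * (A + B + |h x|) =
      c * (C₁ * A) + (C₂ * B + C₂ * |h x| * I) +
        (c * C₁ * (B + |h x|) + C₂ * (A + |h x|) + C₂ * I * (A + B)) := by ring
  have h3 : 0 ≤ c * C₁ * (B + |h x|) + C₂ * (A + |h x|) + C₂ * I * (A + B) := by positivity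
  linarith

/-- Bound for the singular convolution with `A_σ(·,τ)` in `L¹(ρ dx)`. -/
lemma exists_rhoNorm_conv_symA_le (hN : 1 ≤ N) (hσ : 0 < σ) (hα : 0 < α) (hασ : α ≤ σ)
    (hc : 0 ≤ c) :
    ∃ C : ℝ, 0 ≤ C ∧ ∀ h : Space N → ℝ, MemRho σ h → (∀ x y, |h x - h y| ≤ c * ‖x - y‖ ^ α) →
      ∀ τ, 0 < τ → rhoNorm σ (fun x => ∫ y, radKer (symA σ τ) (x - y) * h y) ≤
        C * (τ ^ (α / 2 / σ - 1) + rhoNorm σ h) := by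
  obtain ⟨C, hC0, hC⟩ := exists_abs_conv_symA_le (N := N) hN hσ hα hασ hc
  have hI : 0 ≤ ∫ x : Space N, rho σ x := integral_nonneg fun _ => rho_nonneg _
  have hρK : RhoKernel σ (rho σ : Space N → ℝ) (1 * rhoConst N σ) :=
    .of_le hσ (D := 1) continuous_rho rho_neg zero_le_one fun x => by
      rw [one_mul, abs_of_nonneg (rho_nonneg x)]
  have hR := rhoConst_nonneg (N := N) (σ := σ)
  refine ⟨C * ((∫ x : Space N, rho σ x) + rhoConst N σ + 1), by positivity,
    fun h hh hH τ hτ => ?_⟩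
  obtain ⟨C', hRK⟩ := rhoKernel_symA (N := N) hN hσ hτ
  have habs : MemRho σ fun y => |h y| := hh.abs_mul
  have i1 : Integrable fun x : Space N => τ ^ (α / 2 / σ - 1) * rho σ x :=
    (integrable_rho hσ).const_mul _
  have i2 : Integrable fun x => (∫ y, rho σ (x - y) * |h y|) * rho σ x := hρK.memRho_conv hσ habs
  have i3 := hh.abs_mul
  have i4 : Integrable fun x => τ ^ (α / 2 / σ - 1) * rho σ x +
      (∫ y, rho σ (x - y) * |h y|) * rho σ x := i1.add i2
  have h1 : ∫ x, (∫ y, rho σ (x - y) * |h y|) * rho σ x ≤ rhoConst N σ * rhoNorm σ h := by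
    have h2 := hρK.rhoNorm_conv_le hσ habs
    simp only [rhoNorm, abs_abs, one_mul] at h2 ⊢
    refine le_trans (le_of_eq ?_) h2
    refine integral_congr_ae (.of_forall fun x => ?_)
    simp only
    rw [abs_of_nonneg (integral_nonneg fun y => mul_nonneg (rho_nonneg _) (abs_nonneg _))]
  calc rhoNorm σ (fun x => ∫ y, radKer (symA σ τ) (x - y) * h y)
      ≤ ∫ x, C * ((τ ^ (α / 2 / σ - 1) * rho σ x + (∫ y, rho σ (x - y) * |h y|) * rho σ x) +
          |h x| * rho σ x) := by
        refine integral_mono (hRK.memRho_conv hσ hh).abs_mul ((i4.add i3).const_mul C)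
          fun x => ?_
        refine (mul_le_mul_of_nonneg_right (hC h hh hH τ hτ x) (rho_nonneg x)).trans_eq ?_
        ring
    _ = C * ((τ ^ (α / 2 / σ - 1) * (∫ x : Space N, rho σ x) +
          ∫ x, (∫ y, rho σ (x - y) * |h y|) * rho σ x) + rhoNorm σ h) := by
        rw [integral_const_mul, integral_add i4 i3, integral_add i1 i2,
          integral_const_mul, rhoNorm]
    _ ≤ C * ((τ ^ (α / 2 / σ - 1) * (∫ x : Space N, rho σ x) + rhoConst N σ * rhoNorm σ h) +
          rhoNorm σ h) := by gcongr
    _ ≤ C * ((∫ x : Space N, rho σ x) + rhoConst N σ + 1) *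
          (τ ^ (α / 2 / σ - 1) + rhoNorm σ h) := by
        have hA : 0 ≤ τ ^ (α / 2 / σ - 1) := by positivity
        have hB := rhoNorm_nonneg (σ := σ) h
        rw [mul_assoc]
        refine mul_le_mul_of_nonneg_left ?_ hC0
        set A := τ ^ (α / 2 / σ - 1)
        set B := rhoNorm σ h
        set I := ∫ x : Space N, rho σ x
        set R := rhoConst N σ
        have h2 : (I + R + 1) * (A + B) = (A * I + R * B) + B + (R * A + A + I * B) := by ring
        have h3 : 0 ≤ R * A + A + I * B := by positivity
        linarith

end singular

/-- Source terms: Hölder continuous functions on `Q` with values in `L¹(ρ dx)`, extended by zero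
to nonpositive times. -/
structure IsSource {N : ℕ} (σ α c : ℝ) (f : Space N × ℝ → ℝ) : Prop where
  measurable : Measurable f
  zero : ∀ x t, t ≤ 0 → f (x, t) = 0
  memRho : ∀ t, MemRho σ fun x => f (x, t)
  holder_space : ∀ t x y, |f (x, t) - f (y, t)| ≤ c * ‖x - y‖ ^ α
  holder_time : ∀ x s t, 0 < s → 0 < t → |f (x, t) - f (x, s)| ≤ c * |t - s| ^ (α / σ)

section source
variable {N : ℕ} {σ α c : ℝ} {f : Space N × ℝ → ℝ}

lemma sigmaSize_space (hσ : 0 < σ) (x : Space N) : sigmaSize σ (x, (0 : ℝ)) = ‖x‖ := by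
  rw [sigmaSize, abs_zero, Real.zero_rpow (by positivity), add_zero, Real.sqrt_sq (norm_nonneg _)]

lemma sigmaSize_time_rpow (t : ℝ) : sigmaSize σ ((0 : Space N), t) ^ α = |t| ^ (α / σ) := by
  rw [sigmaSize, norm_zero, zero_pow two_ne_zero, zero_add, Real.sqrt_eq_rpow,
    ← Real.rpow_mul (abs_nonneg _), ← Real.rpow_mul (abs_nonneg _)]
  congr 1
  ring

lemma continuous_sigmaSize (hσ : 0 < σ) : Continuous (sigmaSize σ : Space N × ℝ → ℝ) := by
  unfold sigmaSize
  refine Real.continuous_sqrt.comp ((continuous_fst.norm.pow 2).add ?_)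
  exact continuous_snd.abs.rpow_const fun _ => Or.inr (by positivity)

lemma IsSigmaHolder.continuousOn (hσ : 0 < σ) (hα : 0 < α) (hf : IsSigmaHolder σ α f) :
    ContinuousOn f (domainQ N) := by
  obtain ⟨c, hc, h⟩ := hf
  intro Y hY
  refine tendsto_iff_norm_sub_tendsto_zero.2 ?_
  have h1 : Tendsto (fun Z => c * sigmaSize σ (Z - Y) ^ α) (𝓝[domainQ N] Y) (𝓝 0) := by
    have h2 : Continuous fun Z : Space N × ℝ => c * sigmaSize σ (Z - Y) ^ α :=
      continuous_const.mul (((continuous_sigmaSize hσ).comp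
        (continuous_id.sub continuous_const)).rpow_const fun _ => Or.inr hα.le)
    have h3 := h2.tendsto Y
    simp only [sub_self] at h3
    have h4 : sigmaSize σ (0 : Space N × ℝ) = 0 := by
      have := sigmaSize_space hσ (0 : Space N)
      rwa [norm_zero] at this
    rw [h4, Real.zero_rpow hα.ne', mul_zero] at h3
    exact h3.mono_left nhdsWithin_le_nhds
  refine squeeze_zero' (.of_forall fun _ => norm_nonneg _) ?_ h1
  filter_upwards [self_mem_nhdsWithin] with Z hZ using h Z hZ Y hY

lemma measurableSet_domainQ : MeasurableSet (domainQ N) :=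
  measurableSet_lt measurable_const measurable_snd

/-- The functions of the theorem are source terms. -/
lemma exists_isSource_indicator (hσ : 0 < σ) (hα : 0 < α) (hfL : MemLinftyLocL1Rho σ f)
    (hfC : IsSigmaHolder σ α f) : ∃ c, 0 ≤ c ∧ IsSource σ α c ((domainQ N).indicator f) := by
  classical
  have hcont := hfC.continuousOn hσ hα
  obtain ⟨c, hc, h⟩ := hfC
  have hmeas : Measurable ((domainQ N).indicator f) := by
    rw [← Set.piecewise_eq_indicator]
    exact hcont.measurable_piecewise continuousOn_const measurableSet_domainQ
  have hpos : ∀ x t, 0 < t → (domainQ N).indicator f (x, t) = f (x, t) := fun x t ht =>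
    indicator_of_mem (show (x, t) ∈ domainQ N from ht) f
  have hneg : ∀ x t, t ≤ 0 → (domainQ N).indicator f (x, t) = 0 := fun x t ht =>
    indicator_of_notMem (show (x, t) ∉ domainQ N from not_lt.2 ht) f
  have htime : ∀ x s t, 0 < s → 0 < t →
      |(domainQ N).indicator f (x, t) - (domainQ N).indicator f (x, s)| ≤
        c * |t - s| ^ (α / σ) := fun x s t hs ht => by
    rw [hpos x t ht, hpos x s hs, ← sigmaSize_time_rpow (N := N)]
    have := h (x, t) ht (x, s) hs
    rwa [Prod.mk_sub_mk, sub_self] at this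
  have hslice : ∀ t, Measurable fun x => (domainQ N).indicator f (x, t) := fun t =>
    hmeas.comp (measurable_id.prodMk measurable_const)
  -- The essential bound in time is needed only to find one slice in `L¹(ρ dx)`. Hölder continuity
  -- in time makes any two slices at positive times differ by a bounded function, so every slice
  -- belongs to this space.
  obtain ⟨t₀, ht₀, hm₀⟩ : ∃ t₀, 0 < t₀ ∧ MemRho σ fun x => (domainQ N).indicator f (x, t₀) := by
    obtain ⟨C, hC⟩ := hfL.2 1 one_pos
    have hne : (volume.restrict (Ioo (0:ℝ) 1)) ≠ 0 := by
      rw [Ne, Measure.restrict_eq_zero]; simp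
    have : (ae (volume.restrict (Ioo (0:ℝ) 1))).NeBot := ae_neBot.2 hne
    obtain ⟨t₀, h1, h2⟩ := (hC.and (ae_restrict_mem measurableSet_Ioo)).exists
    refine ⟨t₀, h2.1, integrable_rhoMeasure_iff.1 ⟨(hslice t₀).aestronglyMeasurable, ?_⟩⟩
    rw [hasFiniteIntegral_iff_enorm]
    simp_rw [fun x => hpos x t₀ h2.1]
    exact h1.trans_lt ENNReal.coe_lt_top
  refine ⟨c, hc.le, hmeas, hneg, fun t => ?_, fun t x y => ?_, htime⟩
  · rcases le_or_gt t 0 with ht | ht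
    · simp_rw [fun x => hneg x t ht]
      simp [MemRho]
    · have hd : MemRho σ fun x =>
          (domainQ N).indicator f (x, t) - (domainQ N).indicator f (x, t₀) := by
        refine ((integrable_rho hσ).const_mul (c * |t - t₀| ^ (α / σ))).mono'
          (((hslice t).sub (hslice t₀)).mul continuous_rho.measurable).aestronglyMeasurable
          (.of_forall fun x => ?_)
        rw [norm_mul, Real.norm_eq_abs, Real.norm_of_nonneg (rho_nonneg x)]
        exact mul_le_mul_of_nonneg_right (htime x t₀ t ht₀ ht) (rho_nonneg x)
      simpa using hm₀.add hd
  · rcases le_or_gt t 0 with ht | ht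
    · rw [hneg x t ht, hneg y t ht, sub_self, abs_zero]
      positivity
    · rw [hpos x t ht, hpos y t ht, ← sigmaSize_space hσ]
      have := h (x, t) ht (y, t) ht
      rwa [Prod.mk_sub_mk, sub_self] at this

namespace IsSource

lemma rhoNorm_sub_le (hf : IsSource σ α c f) (hσ : 0 < σ) {s t : ℝ} (hs : 0 < s) (ht : 0 < t) :
    rhoNorm σ (fun x => f (x, t) - f (x, s)) ≤
      c * |t - s| ^ (α / σ) * ∫ x : Space N, rho σ x := by
  rw [rhoNorm, ← integral_const_mul]
  exact integral_mono ((hf.memRho t).sub (hf.memRho s)).abs_mul ((integrable_rho hσ).const_mul _)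
    fun x => mul_le_mul_of_nonneg_right (hf.holder_time x s t hs ht) (rho_nonneg x)

/-- Comparison with the slice at time `1`. The bound holds for every time up to `T`, not just almost
every one. -/
lemma exists_rhoNorm_le (hf : IsSource σ α c f) (hσ : 0 < σ) (hα : 0 < α) (hc : 0 ≤ c) (T : ℝ) :
    ∃ M, 0 ≤ M ∧ ∀ t ≤ T, rhoNorm σ (fun x => f (x, t)) ≤ M := by
  have hI : 0 ≤ ∫ x : Space N, rho σ x := integral_nonneg fun _ => rho_nonneg _
  have h1 := rhoNorm_nonneg (σ := σ) fun x => f (x, 1)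
  refine ⟨rhoNorm σ (fun x => f (x, 1)) + c * (|T| + 1) ^ (α / σ) * ∫ x : Space N, rho σ x,
    by positivity, fun t ht => ?_⟩
  rcases le_or_gt t 0 with h0 | h0
  · simp_rw [fun x => hf.zero x t h0]
    simp only [rhoNorm, abs_zero, zero_mul, integral_zero]
    positivity
  · refine (rhoNorm_le_add_sub (hf.memRho t) (hf.memRho 1)).trans ?_
    gcongr
    refine (hf.rhoNorm_sub_le hσ one_pos h0).trans ?_
    gcongr
    have := le_abs_self T
    rw [abs_le]
    constructor <;> linarith [abs_nonneg T]

/-- Time `0` is excluded because the extension by zero may jump there. -/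
lemma tendsto_rhoNorm_sub (hf : IsSource σ α c f) (hσ : 0 < σ) (hα : 0 < α) {t₀ : ℝ}
    (ht₀ : t₀ ≠ 0) :
    Tendsto (fun t => rhoNorm σ fun x => f (x, t) - f (x, t₀)) (𝓝 t₀) (𝓝 0) := by
  rcases lt_or_gt_of_ne ht₀ with h0 | h0
  · refine tendsto_const_nhds.congr' ?_
    filter_upwards [gt_mem_nhds h0] with t ht
    simp_rw [fun x => hf.zero x t (le_of_lt ht), fun x => hf.zero x t₀ h0.le]
    simp [rhoNorm]
  · have hcont : Continuous fun t => c * |t - t₀| ^ (α / σ) * ∫ x : Space N, rho σ x :=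
      (continuous_const.mul ((continuous_id.sub continuous_const).abs.rpow_const fun _ =>
        Or.inr (by positivity))).mul continuous_const
    have h1 := hcont.tendsto t₀
    rw [sub_self, abs_zero, Real.zero_rpow (by positivity), mul_zero, zero_mul] at h1
    refine squeeze_zero' (.of_forall fun _ => rhoNorm_nonneg _) ?_ h1
    filter_upwards [lt_mem_nhds h0] with t ht using hf.rhoNorm_sub_le hσ h0 ht

end IsSource
end source

/-! ### The evolution of the source term -/

section sourceEvolution
variable {N : ℕ} {σ α c : ℝ} {f : Space N × ℝ → ℝ}

/-- The convolution of `f(·,s)` with `A_σ(·,τ)`. -/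
noncomputable def srcConv (σ : ℝ) (f : Space N × ℝ → ℝ) (s τ : ℝ) (x : Space N) : ℝ :=
  ∫ y, radKer (symA σ τ) (x - y) * f (y, s)

/-- The second term of Duhamel's formula. -/
noncomputable def srcEvol (σ : ℝ) (f : Space N × ℝ → ℝ) (t : ℝ) (x : Space N) : ℝ :=
  ∫ τ in Ioi (0 : ℝ), srcConv σ f (t - τ) τ x

namespace IsSource

/-- This vanishing is why `srcEvol` can integrate over all `τ > 0`. After the substitution `τ = t -
s`, neither the kernel nor the domain of integration depends on `t`, and continuity in `t` becomes a
matter of dominated convergence. -/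
lemma srcConv_zero (hf : IsSource σ α c f) {s : ℝ} (hs : s ≤ 0) (τ : ℝ) (x : Space N) :
    srcConv σ f s τ x = 0 := by
  simp [srcConv, hf.zero _ s hs]

lemma measurable_srcConv (hf : IsSource σ α c f) (hσ : 0 < σ) :
    Measurable fun p : Space N × ℝ × ℝ => srcConv σ f p.2.1 p.2.2 p.1 := by
  unfold srcConv
  refine (StronglyMeasurable.integral_prod_right (f := fun (p : Space N × ℝ × ℝ) (y : Space N) =>
    radKer (symA σ p.2.2) (p.1 - y) * f (y, p.2.1)) (Measurable.stronglyMeasurable ?_)).measurable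
  have h1 : Measurable fun q : (Space N × ℝ × ℝ) × Space N => (q.1.1 - q.2, q.1.2.2) := by fun_prop
  have h2 : Measurable fun q : (Space N × ℝ × ℝ) × Space N => (q.2, q.1.2.1) := by fun_prop
  exact ((measurable_radKer_symA hσ).comp h1).mul (hf.measurable.comp h2)

lemma measurable_srcConv_diag (hf : IsSource σ α c f) (hσ : 0 < σ) (t : ℝ) :
    Measurable fun p : Space N × ℝ => srcConv σ f (t - p.2) p.2 p.1 := by
  have h := hf.measurable_srcConv hσ
  generalize srcConv σ f = S at h ⊢
  have h1 : Measurable fun p : Space N × ℝ => (p.1, t - p.2, p.2) :=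
    measurable_fst.prodMk ((measurable_const.sub measurable_snd).prodMk measurable_snd)
  exact h.comp h1

lemma memRho_srcConv (hf : IsSource σ α c f) (hN : 1 ≤ N) (hσ : 0 < σ) (s : ℝ) {τ : ℝ}
    (hτ : 0 < τ) : MemRho σ (srcConv σ f s τ) := by
  obtain ⟨C, hK⟩ := rhoKernel_symA (N := N) hN hσ hτ
  exact hK.memRho_conv hσ (hf.memRho s)

lemma integrable_indicator_rpow (hσ : 0 < σ) (hα : 0 < α) (T A B : ℝ) :
    Integrable ((Ioc 0 T).indicator fun τ : ℝ => A * (τ ^ (α / 2 / σ - 1) + B))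
      (volume.restrict (Ioi 0)) := by
  rw [integrable_indicator_iff measurableSet_Ioc, IntegrableOn, Measure.restrict_restrict
    measurableSet_Ioc, inter_eq_left.2 fun x hx => hx.1]
  have h1 : IntegrableOn (fun τ : ℝ => τ ^ (α / 2 / σ - 1)) (Ioc 0 T) := by
    rcases le_total 0 T with hT | hT
    · rw [← intervalIntegrable_iff_integrableOn_Ioc_of_le hT]
      refine intervalIntegral.intervalIntegrable_rpow' ?_
      have : 0 < α / 2 / σ := by positivity
      linarith
    · simp [Ioc_eq_empty_of_le hT]
  have h2 : IntegrableOn (fun _ : ℝ => B) (Ioc 0 T) := integrableOn_const (by simp)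
  exact (h1.add h2).const_mul A

/-- Integrable bound in time for the norm of the source convolutions. -/
lemma exists_rhoNorm_srcConv_le (hf : IsSource σ α c f) (hN : 1 ≤ N) (hσ : 0 < σ) (hα : 0 < α)
    (hασ : α ≤ σ) (hc : 0 ≤ c) (T : ℝ) :
    ∃ G : ℝ → ℝ, Integrable G (volume.restrict (Ioi 0)) ∧ ∀ τ, 0 < τ → ∀ t ≤ T,
      rhoNorm σ (srcConv σ f (t - τ) τ) ≤ G τ := by
  obtain ⟨C, hC0, hC⟩ := exists_rhoNorm_conv_symA_le (N := N) hN hσ hα hασ hc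
  obtain ⟨M, hM0, hM⟩ := hf.exists_rhoNorm_le hσ hα hc T
  refine ⟨_, integrable_indicator_rpow hσ hα T C M, fun τ hτ t ht => ?_⟩
  rcases le_or_gt τ T with h | h
  · rw [indicator_of_mem (show τ ∈ Ioc 0 T from ⟨hτ, h⟩)]
    refine (hC _ (hf.memRho (t - τ)) (hf.holder_space (t - τ)) τ hτ).trans ?_
    gcongr
    exact hM _ (by linarith)
  · rw [indicator_of_notMem (show τ ∉ Ioc 0 T from fun h' => absurd h'.2 (not_le.2 h))]
    have e : srcConv σ f (t - τ) τ = fun _ => 0 := by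
      funext x; exact hf.srcConv_zero (by linarith) τ x
    simp [e, rhoNorm]

/-- The time integral in Duhamel's formula converges at every point. -/
lemma integrableOn_srcConv (hf : IsSource σ α c f) (hN : 1 ≤ N) (hσ : 0 < σ) (hα : 0 < α)
    (hασ : α ≤ σ) (hc : 0 ≤ c) (t : ℝ) (x : Space N) :
    Integrable (fun τ => srcConv σ f (t - τ) τ x) (volume.restrict (Ioi 0)) := by
  obtain ⟨C, hC0, hC⟩ := exists_abs_conv_symA_le (N := N) hN hσ hα hασ hc
  obtain ⟨M, hM0, hM⟩ := hf.exists_rhoNorm_le hσ hα hc t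
  have hd : 0 ≤ (N : ℝ) + σ := by positivity
  set B := (1 + ‖x‖) ^ ((N : ℝ) + σ) * M + (|f (x, 1)| + c * (|t| + 1) ^ (α / σ)) with hB
  refine (integrable_indicator_rpow hσ hα t C B).mono' ?_ ?_
  · exact ((hf.measurable_srcConv_diag hσ t).comp
      (measurable_const.prodMk measurable_id)).aestronglyMeasurable
  · filter_upwards [ae_restrict_mem measurableSet_Ioi] with τ hτ
    have hτ0 : 0 < τ := hτ
    rcases lt_or_ge τ t with h | h
    · rw [indicator_of_mem (show τ ∈ Ioc 0 t from ⟨hτ, h.le⟩), Real.norm_eq_abs]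
      refine (hC _ (hf.memRho (t - τ)) (hf.holder_space (t - τ)) τ hτ x).trans ?_
      rw [add_assoc, hB]
      gcongr
      · calc ∫ y, rho σ (x - y) * |f (y, t - τ)|
            ≤ ∫ y, (1 + ‖x‖) ^ ((N : ℝ) + σ) * (|f (y, t - τ)| * rho σ y) := by
              refine integral_mono_of_nonneg (.of_forall fun y => mul_nonneg (rho_nonneg _)
                (abs_nonneg _)) ((hf.memRho _).abs_mul.const_mul _) (.of_forall fun y => ?_)
              simp only
              rw [mul_comm |f (y, t - τ)|, ← mul_assoc]
              exact mul_le_mul_of_nonneg_right (rho_sub_le' hσ x y) (abs_nonneg _)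
          _ = (1 + ‖x‖) ^ ((N : ℝ) + σ) * rhoNorm σ fun y => f (y, t - τ) :=
              integral_const_mul _ _
          _ ≤ _ := by
              gcongr
              exact hM _ (by linarith)
      · have h1 := hf.holder_time x 1 (t - τ) one_pos (by linarith)
        have h2 : |t - τ - 1| ^ (α / σ) ≤ (|t| + 1) ^ (α / σ) := by
          gcongr
          have := le_abs_self t
          rw [abs_le]
          constructor <;> linarith
        have h3 : |f (x, t - τ)| ≤ |f (x, 1)| + |f (x, t - τ) - f (x, 1)| := by
          have := abs_add_le (f (x, 1)) (f (x, t - τ) - f (x, 1))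
          rwa [add_sub_cancel] at this
        have h4 : c * |t - τ - 1| ^ (α / σ) ≤ c * (|t| + 1) ^ (α / σ) := by gcongr
        linarith
    · rw [hf.srcConv_zero (by linarith), norm_zero]
      refine indicator_nonneg (fun s hs => ?_) τ
      have : 0 ≤ s ^ (α / 2 / σ - 1) := Real.rpow_nonneg hs.1.le _
      positivity

lemma integrable_prod_srcConv (hf : IsSource σ α c f) (hN : 1 ≤ N) (hσ : 0 < σ) (hα : 0 < α)
    (hασ : α ≤ σ) (hc : 0 ≤ c) (t : ℝ) :
    Integrable (fun p : Space N × ℝ => srcConv σ f (t - p.2) p.2 p.1 * rho σ p.1)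
      (volume.prod (volume.restrict (Ioi 0))) := by
  obtain ⟨G, hG, hGb⟩ := hf.exists_rhoNorm_srcConv_le hN hσ hα hασ hc t
  have hm : AEStronglyMeasurable
      (fun p : Space N × ℝ => srcConv σ f (t - p.2) p.2 p.1 * rho σ p.1)
      (volume.prod (volume.restrict (Ioi 0))) :=
    ((hf.measurable_srcConv_diag hσ t).mul
      (continuous_rho.measurable.comp measurable_fst)).aestronglyMeasurable
  rw [integrable_prod_iff' hm]
  constructor
  · filter_upwards [ae_restrict_mem measurableSet_Ioi] with τ hτ using
      hf.memRho_srcConv hN hσ (t - τ) hτ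
  · refine hG.mono' hm.norm.prod_swap.integral_prod_right' ?_
    filter_upwards [ae_restrict_mem measurableSet_Ioi] with τ hτ
    rw [Real.norm_of_nonneg (integral_nonneg fun _ => norm_nonneg _)]
    refine le_trans (le_of_eq ?_) (hGb τ hτ t le_rfl)
    simp only [rhoNorm, norm_mul, Real.norm_eq_abs, abs_of_nonneg (rho_nonneg _)]

lemma memRho_srcEvol (hf : IsSource σ α c f) (hN : 1 ≤ N) (hσ : 0 < σ) (hα : 0 < α)
    (hασ : α ≤ σ) (hc : 0 ≤ c) (t : ℝ) : MemRho σ (srcEvol σ f t) := by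
  refine (hf.integrable_prod_srcConv hN hσ hα hασ hc t).integral_prod_left.congr
    (.of_forall fun x => ?_)
  simp only [integral_mul_const]
  rfl

lemma srcEvol_of_nonpos (hf : IsSource σ α c f) {t : ℝ} (ht : t ≤ 0) (x : Space N) :
    srcEvol σ f t x = 0 := by
  refine setIntegral_eq_zero_of_forall_eq_zero fun τ hτ => hf.srcConv_zero ?_ τ x
  have : 0 < τ := hτ
  linarith

lemma rhoNorm_srcEvol_sub_le (hf : IsSource σ α c f) (hN : 1 ≤ N) (hσ : 0 < σ) (hα : 0 < α)
    (hασ : α ≤ σ) (hc : 0 ≤ c) (s t : ℝ) :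
    rhoNorm σ (fun x => srcEvol σ f s x - srcEvol σ f t x) ≤
      ∫ τ in Ioi (0:ℝ), rhoNorm σ fun x => srcConv σ f (s - τ) τ x - srcConv σ f (t - τ) τ x := by
  have hi : Integrable (fun p : Space N × ℝ =>
      ‖srcConv σ f (s - p.2) p.2 p.1 * rho σ p.1 - srcConv σ f (t - p.2) p.2 p.1 * rho σ p.1‖)
      (volume.prod (volume.restrict (Ioi 0))) :=
    ((hf.integrable_prod_srcConv hN hσ hα hασ hc s).sub
      (hf.integrable_prod_srcConv hN hσ hα hασ hc t)).norm
  have e : ∀ (x : Space N) (τ : ℝ),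
      ‖srcConv σ f (s - τ) τ x * rho σ x - srcConv σ f (t - τ) τ x * rho σ x‖ =
      |srcConv σ f (s - τ) τ x - srcConv σ f (t - τ) τ x| * rho σ x := fun x τ => by
    rw [← sub_mul, norm_mul, Real.norm_eq_abs, Real.norm_of_nonneg (rho_nonneg x)]
  simp only [e] at hi
  unfold rhoNorm
  rw [← integral_integral_swap hi]
  refine integral_mono ((hf.memRho_srcEvol hN hσ hα hασ hc s).sub
    (hf.memRho_srcEvol hN hσ hα hασ hc t)).abs_mul hi.integral_prod_left fun x => ?_
  simp only [integral_mul_const]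
  refine mul_le_mul_of_nonneg_right ?_ (rho_nonneg x)
  rw [srcEvol, srcEvol, ← integral_sub (hf.integrableOn_srcConv hN hσ hα hασ hc s x)
    (hf.integrableOn_srcConv hN hσ hα hασ hc t x)]
  exact norm_integral_le_integral_norm (μ := volume.restrict (Ioi 0))
    fun τ => srcConv σ f (s - τ) τ x - srcConv σ f (t - τ) τ x

/-- The evolution of the source term is continuous in `L¹(ρ dx)`. -/
lemma tendsto_srcEvol (hf : IsSource σ α c f) (hN : 1 ≤ N) (hσ : 0 < σ) (hα : 0 < α)
    (hασ : α ≤ σ) (hc : 0 ≤ c) (t₀ : ℝ) :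
    Tendsto (fun t => rhoNorm σ fun x => srcEvol σ f t x - srcEvol σ f t₀ x) (𝓝 t₀) (𝓝 0) := by
  obtain ⟨G, hG, hGb⟩ := hf.exists_rhoNorm_srcConv_le hN hσ hα hασ hc (t₀ + 1)
  have hm : ∀ t, AEStronglyMeasurable (fun τ => rhoNorm σ fun x =>
      srcConv σ f (t - τ) τ x - srcConv σ f (t₀ - τ) τ x) (volume.restrict (Ioi 0)) := fun t => by
    have h1 : Measurable fun p : Space N × ℝ =>
        |srcConv σ f (t - p.2) p.2 p.1 - srcConv σ f (t₀ - p.2) p.2 p.1| * rho σ p.1 :=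
      (((hf.measurable_srcConv_diag hσ t).sub (hf.measurable_srcConv_diag hσ t₀)).norm).mul
        (continuous_rho.measurable.comp measurable_fst)
    exact (h1.stronglyMeasurable.integral_prod_left' (μ := volume)).aestronglyMeasurable
  have hlim : Tendsto (fun t => ∫ τ in Ioi (0:ℝ), rhoNorm σ fun x =>
      srcConv σ f (t - τ) τ x - srcConv σ f (t₀ - τ) τ x) (𝓝 t₀)
      (𝓝 (∫ _ in Ioi (0:ℝ), (0:ℝ))) := by
    refine tendsto_integral_filter_of_dominated_convergence (fun τ => G τ + G τ)
      (.of_forall hm) ?_ (hG.add hG) ?_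
    · filter_upwards [gt_mem_nhds (show t₀ < t₀ + 1 by linarith)] with t ht
      filter_upwards [ae_restrict_mem measurableSet_Ioi] with τ hτ
      have m1 := hf.memRho_srcConv hN hσ (t - τ) hτ
      have m2 := hf.memRho_srcConv hN hσ (t₀ - τ) hτ
      rw [Real.norm_of_nonneg (rhoNorm_nonneg _)]
      have h1 := rhoNorm_le_add_sub (m1.sub m2) m1
      have h2 : rhoNorm σ (fun x => srcConv σ f (t - τ) τ x - srcConv σ f (t₀ - τ) τ x -
          srcConv σ f (t - τ) τ x) = rhoNorm σ (srcConv σ f (t₀ - τ) τ) := by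
        simp only [rhoNorm]
        congr 1
        funext x
        rw [sub_right_comm, sub_self, zero_sub, abs_neg]
      rw [h2] at h1
      exact h1.trans (add_le_add (hGb τ hτ t (le_of_lt ht)) (hGb τ hτ t₀ (by linarith)))
    -- The value `τ = t₀`, where `f` is taken at its possible jump, is a null set. For any other
    -- fixed `τ`, convolution with `A_σ(·,τ)` is bounded on `L¹(ρ dx)`, and `f` is continuous at `t₀
    -- - τ`.
    · have hne : ∀ᵐ τ ∂(volume.restrict (Ioi (0:ℝ))), τ ≠ t₀ :=
        ae_restrict_of_ae (Measure.ae_ne volume t₀)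
      filter_upwards [ae_restrict_mem measurableSet_Ioi, hne] with τ hτ hτt
      obtain ⟨C, hK⟩ := rhoKernel_symA (N := N) hN hσ (show 0 < τ from hτ)
      have h1 : Tendsto (fun t => t - τ) (𝓝 t₀) (𝓝 (t₀ - τ)) :=
        (continuous_id.sub continuous_const).tendsto t₀
      have h2 := ((hf.tendsto_rhoNorm_sub hσ hα (sub_ne_zero.2 hτt.symm)).comp h1).const_mul C
      rw [mul_zero] at h2
      refine squeeze_zero (fun _ => rhoNorm_nonneg _) (fun t => ?_) h2
      have h3 := hK.rhoNorm_conv_le hσ ((hf.memRho (t - τ)).sub (hf.memRho (t₀ - τ)))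
      simp only [hK.conv_sub hσ (hf.memRho (t - τ)) (hf.memRho (t₀ - τ))] at h3
      exact h3
  rw [integral_zero] at hlim
  exact squeeze_zero (fun _ => rhoNorm_nonneg _)
    (fun t => hf.rhoNorm_srcEvol_sub_le hN hσ hα hασ hc t t₀) hlim

end IsSource
end sourceEvolution

/-! ### The evolution of the initial datum -/

section dataEvolution
variable {N : ℕ} {σ : ℝ}

attribute [local irreducible] heatMul heatC

/-- The first term of Duhamel's formula, extended by the datum to `t = 0`. -/
noncomputable def dataEvol (σ : ℝ) (h : Space N → ℝ) (t : ℝ) (x : Space N) : ℝ :=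
  if 0 < t then ∫ y, radKer (symP σ t) (x - y) * h y else h x

lemma dataEvol_of_pos {t : ℝ} (ht : 0 < t) (h : Space N → ℝ) :
    dataEvol σ h t = fun x => ∫ y, radKer (symP σ t) (x - y) * h y := by
  funext x; exact if_pos ht

lemma dataEvol_of_nonpos {t : ℝ} (ht : t ≤ 0) (h : Space N → ℝ) : dataEvol σ h t = h := by
  funext x; exact if_neg (not_lt.2 ht)

lemma exists_dataEvol_bound (hN : 1 ≤ N) (hσ : 0 < σ) (T : ℝ) : ∃ C, 0 ≤ C ∧
    ∀ h : Space N → ℝ, MemRho σ h → ∀ t ≤ T, MemRho σ (dataEvol σ h t) ∧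
      rhoNorm σ (dataEvol σ h t) ≤ C * rhoNorm σ h := by
  obtain ⟨C, hC⟩ := rhoKernel_symP (N := N) hN hσ T
  refine ⟨max 1 C, by positivity, fun h hh t ht => ?_⟩
  have h0 := rhoNorm_nonneg (σ := σ) h
  rcases le_or_gt t 0 with ht0 | ht0
  · rw [dataEvol_of_nonpos ht0]
    exact ⟨hh, le_mul_of_one_le_left h0 (le_max_left _ _)⟩
  · rw [dataEvol_of_pos ht0]
    have hK := hC t ht0 ht
    exact ⟨hK.memRho_conv hσ hh, (hK.rhoNorm_conv_le hσ hh).trans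
      (mul_le_mul_of_nonneg_right (le_max_right _ _) h0)⟩

lemma dataEvol_sub (hN : 1 ≤ N) (hσ : 0 < σ) {h k : Space N → ℝ} (hh : MemRho σ h)
    (hk : MemRho σ k) (t : ℝ) (x : Space N) :
    dataEvol σ (fun y => h y - k y) t x = dataEvol σ h t x - dataEvol σ k t x := by
  rcases le_or_gt t 0 with ht | ht
  · simp only [dataEvol_of_nonpos ht]
  · simp only [dataEvol_of_pos ht]
    obtain ⟨C, hC⟩ := rhoKernel_symP (N := N) hN hσ t
    exact (hC t ht le_rfl).conv_sub hσ hh hk x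

lemma dataEvol_test (hN : 1 ≤ N) (hσ : 0 < σ) {φ : Space N → ℝ} (hφ : ContDiff ℝ ∞ φ)
    (hc : HasCompactSupport φ) (t : ℝ) (x : Space N) :
    dataEvol σ φ t x = heatMul σ 0 (max t 0) φ x := by
  rcases le_or_gt t 0 with ht | ht
  · rw [dataEvol_of_nonpos ht, max_eq_right ht, heatMul_zero_zero hφ hc]
  · rw [dataEvol_of_pos ht, max_eq_left ht.le,
      ← integral_symP_mul_heatMul hN hσ hφ hc (Or.inl rfl) ht]
    simp only [heatMul_zero_zero hφ hc]

lemma tendsto_dataEvol_test (hN : 1 ≤ N) (hσ : 0 < σ) {φ : Space N → ℝ} (hφ : ContDiff ℝ ∞ φ)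
    (hc : HasCompactSupport φ) (t₀ : ℝ) :
    Tendsto (fun t => rhoNorm σ fun x => dataEvol σ φ t x - dataEvol σ φ t₀ x) (𝓝 t₀) (𝓝 0) := by
  have g0 : GoodExp σ 0 := Or.inl rfl
  obtain ⟨C, hC0, hC⟩ := exists_abs_heatMul_le_uniform hN hσ hφ hc g0 (max (t₀ + 1) 0)
  have hcont := fun t : ℝ => continuous_heatMul_of_nonneg hφ hc hσ (le_refl (0:ℝ))
    (le_max_right t 0)
  simp only [dataEvol_test hN hσ hφ hc]
  have hb : ∀ t ≤ t₀ + 1, ∀ x, |heatMul σ 0 (max t 0) φ x| ≤ C := fun t ht x =>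
    (hC _ (le_max_right _ _) (max_le_max_right _ ht) x).trans
      (mul_le_of_le_one_right hC0 (rho_le_one hσ x))
  have hlim : Tendsto (fun t => rhoNorm σ fun x =>
      heatMul σ 0 (max t 0) φ x - heatMul σ 0 (max t₀ 0) φ x) (𝓝 t₀)
      (𝓝 (∫ _ : Space N, (0:ℝ))) := by
    refine tendsto_integral_filter_of_dominated_convergence (fun x => (C + C) * rho σ x)
      (.of_forall fun t => ?_) ?_ ((integrable_rho hσ).const_mul _) (.of_forall fun x => ?_)
    · exact (((hcont t).sub (hcont t₀)).abs.mul continuous_rho).aestronglyMeasurable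
    · filter_upwards [gt_mem_nhds (show t₀ < t₀ + 1 by linarith)] with t ht
      refine .of_forall fun x => ?_
      rw [norm_mul, Real.norm_eq_abs, abs_abs, Real.norm_of_nonneg (rho_nonneg x)]
      refine mul_le_mul_of_nonneg_right ((abs_sub _ _).trans ?_) (rho_nonneg x)
      exact add_le_add (hb t (le_of_lt ht) x) (hb t₀ (by linarith) x)
    · have h1 : Continuous fun t : ℝ => heatMul σ 0 (max t 0) φ x := by
        have h2 := (continuous_heatMul_time hφ hc hσ (le_refl (0:ℝ)) x).comp
          (continuous_id.max (continuous_const (y := (0:ℝ))))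
        simpa only [Function.comp_def, id, abs_of_nonneg (le_max_right _ (0:ℝ))] using h2
      have h3 := (((h1.sub (continuous_const (y := heatMul σ 0 (max t₀ 0) φ x))).abs).mul
        (continuous_const (y := rho σ x))).tendsto t₀
      simp only [Pi.mul_apply, Pi.sub_apply, sub_self, abs_zero, zero_mul] at h3
      exact h3
  rwa [integral_zero] at hlim

/-- Test functions are dense in `L¹(ρ dx)`. -/
lemma exists_test_rhoNorm_sub_le (hσ : 0 < σ) {h : Space N → ℝ} (hh : MemRho σ h) {ε : ℝ} (hε : 0 < ε) :
    ∃ φ : Space N → ℝ, ContDiff ℝ ∞ φ ∧ HasCompactSupport φ ∧ MemRho σ φ ∧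
      rhoNorm σ (fun x => h x - φ x) ≤ ε := by
  have hm : MemLp h 1 (rhoMeasure N σ) := memLp_one_iff_integrable.2 (integrable_rhoMeasure_iff.2 hh)
  have : IsFiniteMeasure (rhoMeasure N σ) :=
    isFiniteMeasure_withDensity_ofReal (integrable_rho hσ).hasFiniteIntegral
  obtain ⟨φ, hc, hφ, hle⟩ := hm.exist_eLpNorm_sub_le (by simp) le_rfl hε
  have hφm : MemRho σ φ :=
    (hφ.continuous.mul continuous_rho).integrable_of_hasCompactSupport hc.mul_right
  refine ⟨φ, hφ, hc, hφm, ?_⟩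
  have e : rhoNorm σ (fun x => h x - φ x) = (eLpNorm (h - φ) 1 (rhoMeasure N σ)).toReal := by
    rw [eLpNorm_one_eq_lintegral_enorm]
    simp only [Pi.sub_apply]
    rw [← integral_norm_eq_lintegral_enorm
      (integrable_rhoMeasure_iff.2 (hh.sub hφm)).aestronglyMeasurable, integral_rhoMeasure]
    rfl
  rw [e]
  exact ENNReal.toReal_le_of_le_ofReal hε.le hle

/-- The evolution of the datum is continuous in `L¹(ρ dx)`. -/
lemma tendsto_dataEvol (hN : 1 ≤ N) (hσ : 0 < σ) {h : Space N → ℝ} (hh : MemRho σ h) (t₀ : ℝ) :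
    Tendsto (fun t => rhoNorm σ fun x => dataEvol σ h t x - dataEvol σ h t₀ x) (𝓝 t₀) (𝓝 0) := by
  obtain ⟨C, hC0, hC⟩ := exists_dataEvol_bound (N := N) hN hσ (t₀ + 1)
  rw [Metric.tendsto_nhds]
  intro ε hε
  -- The evolution is bounded by `C` on `L¹(ρ dx)` for all times up to `t₀ + 1`. Replacing `h` by a
  -- test function at distance at most `δ` therefore costs at most `ε / 4` at each of the times `t`
  -- and `t₀`.
  set δ := ε / (4 * (C + 1)) with hδ
  have hδ0 : 0 < δ := by positivity
  obtain ⟨φ, hφ, hc, hφm, hle⟩ := exists_test_rhoNorm_sub_le hσ hh hδ0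
  have h1 := (tendsto_dataEvol_test (σ := σ) hN hσ hφ hc t₀).eventually_lt_const
    (show (0:ℝ) < ε / 4 by positivity)
  have hb : ∀ t ≤ t₀ + 1, MemRho σ (fun x => dataEvol σ h t x - dataEvol σ φ t x) ∧
      rhoNorm σ (fun x => dataEvol σ h t x - dataEvol σ φ t x) ≤ ε / 4 := fun t ht => by
    have h2 := hC _ (hh.sub hφm) t ht
    have e : dataEvol σ (fun y => h y - φ y) t = fun x => dataEvol σ h t x - dataEvol σ φ t x := by
      funext x; exact dataEvol_sub hN hσ hh hφm t x
    rw [e] at h2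
    refine ⟨h2.1, h2.2.trans ?_⟩
    calc C * _ ≤ (C + 1) * δ := mul_le_mul (by linarith) hle (rhoNorm_nonneg _) (by linarith)
      _ = ε / 4 := by rw [hδ]; field_simp
  filter_upwards [h1, gt_mem_nhds (show t₀ < t₀ + 1 by linarith)] with t ht ht'
  rw [Real.dist_eq, sub_zero, abs_of_nonneg (rhoNorm_nonneg _)]
  have b1 := hb t (le_of_lt ht')
  have b2 := hb t₀ (by linarith)
  have m1 := (hC _ hφm t (le_of_lt ht')).1
  have m2 := (hC _ hφm t₀ (by linarith)).1
  have e : (fun x => dataEvol σ h t x - dataEvol σ h t₀ x) = fun x =>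
      ((dataEvol σ h t x - dataEvol σ φ t x) + (dataEvol σ φ t x - dataEvol σ φ t₀ x)) +
        (dataEvol σ φ t₀ x - dataEvol σ h t₀ x) := by
    funext x; ring
  rw [e]
  have b3 : MemRho σ (fun x => dataEvol σ φ t₀ x - dataEvol σ h t₀ x) :=
    m2.sub (hC _ hh t₀ (by linarith)).1
  have l1 := rhoNorm_add_le (b1.1.add (m1.sub m2)) b3
  have l2 := rhoNorm_add_le b1.1 (m1.sub m2)
  have l3 := rhoNorm_sub_comm (σ := σ) (dataEvol σ φ t₀) (dataEvol σ h t₀)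
  linarith [b1.2, b2.2]

end dataEvolution

/-! ### The weak equation for Duhamel's formula -/

section weakEquation
variable {N : ℕ} {σ α c : ℝ} {f : Space N × ℝ → ℝ} {φ : Space N → ℝ}

attribute [local irreducible] heatMul heatC

/-- Duality: `P_σ` is even, so convolution with it moves onto the test function. -/
lemma integral_dataEvol_mul (hN : 1 ≤ N) (hσ : 0 < σ) (hφ : ContDiff ℝ ∞ φ)
    (hc : HasCompactSupport φ) {a : ℝ} (ha : GoodExp σ a) {h : Space N → ℝ} (hh : MemRho σ h)
    {t : ℝ} (ht : 0 ≤ t) :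
    ∫ x, dataEvol σ h t x * heatMul σ a 0 φ x = ∫ x, h x * heatMul σ a t φ x := by
  rcases ht.eq_or_lt with rfl | ht
  · rw [dataEvol_of_nonpos le_rfl]
  · obtain ⟨C, hK⟩ := rhoKernel_symP (N := N) hN hσ t
    obtain ⟨D, -, hD⟩ := exists_abs_heatMul_le hN hσ hφ hc ha
    rw [dataEvol_of_pos ht, (hK t ht le_rfl).integral_conv_mul hσ hh
      (continuous_heatMul_of_nonneg hφ hc hσ (ha.nonneg hσ) le_rfl).aestronglyMeasurable hD]
    simp only [integral_symP_mul_heatMul hN hσ hφ hc ha ht]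

lemma integral_dataEvol_mul_test (hN : 1 ≤ N) (hσ : 0 < σ) (hφ : ContDiff ℝ ∞ φ)
    (hc : HasCompactSupport φ) {h : Space N → ℝ} (hh : MemRho σ h) {t : ℝ} (ht : 0 ≤ t) :
    ∫ x, dataEvol σ h t x * φ x = (∫ x, h x * φ x) -
      ∫ r in (0:ℝ)..t, ∫ x, dataEvol σ h r x * heatMul σ (σ / 2) 0 φ x := by
  have h1 := integral_mul_heatMul_sub hN hσ hφ hc (Or.inl rfl) hh ht
  have h2 := integral_dataEvol_mul hN hσ hφ hc (Or.inl rfl) hh ht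
  simp only [heatMul_zero_zero hφ hc, zero_add] at h1 h2
  rw [h2, eq_sub_iff_add_eq, ← eq_sub_iff_add_eq', h1]
  refine intervalIntegral.integral_congr fun r hr => ?_
  rw [uIcc_of_le ht] at hr
  exact integral_dataEvol_mul hN hσ hφ hc (Or.inr le_rfl) hh hr.1

namespace IsSource

/-- Fubini and symmetry move `A_σ(·,τ)` onto the test function, which raises the exponent by `σ/2`;
the substitution `s = t - τ` is then undone. -/
lemma integral_srcEvol_mul (hf : IsSource σ α c f) (hN : 1 ≤ N) (hσ : 0 < σ) (hα : 0 < α)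
    (hασ : α ≤ σ) (hc0 : 0 ≤ c) (hφ : ContDiff ℝ ∞ φ) (hc : HasCompactSupport φ) {a : ℝ}
    (ha : GoodExp σ a) {t : ℝ} (ht : 0 ≤ t) :
    ∫ x, srcEvol σ f t x * heatMul σ a 0 φ x =
      ∫ s in (0:ℝ)..t, ∫ x, f (x, s) * heatMul σ (a + σ / 2) (t - s) φ x := by
  obtain ⟨D, hD0, hD⟩ := exists_abs_heatMul_le hN hσ hφ hc ha
  have hgc := continuous_heatMul_of_nonneg hφ hc hσ (ha.nonneg hσ) (le_refl (0:ℝ))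
  have hi : Integrable (fun p : Space N × ℝ =>
      srcConv σ f (t - p.2) p.2 p.1 * heatMul σ a 0 φ p.1)
      (volume.prod (volume.restrict (Ioi 0))) := by
    refine ((hf.integrable_prod_srcConv hN hσ hα hασ hc0 t).norm.const_mul D).mono'
      ((hf.measurable_srcConv_diag hσ t).mul
        (hgc.measurable.comp measurable_fst)).aestronglyMeasurable (.of_forall fun p => ?_)
    rw [norm_mul, norm_mul _ (rho σ p.1), mul_left_comm, Real.norm_of_nonneg (rho_nonneg p.1)]
    exact mul_le_mul_of_nonneg_left (hD _) (norm_nonneg _)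
  have e1 : ∫ x, srcEvol σ f t x * heatMul σ a 0 φ x =
      ∫ τ in Ioi (0:ℝ), ∫ x, srcConv σ f (t - τ) τ x * heatMul σ a 0 φ x := by
    simp only [srcEvol, ← integral_mul_const]
    exact integral_integral_swap hi
  have e2 : ∀ τ, 0 < τ → ∫ x, srcConv σ f (t - τ) τ x * heatMul σ a 0 φ x =
      ∫ x, f (x, t - τ) * heatMul σ (a + σ / 2) τ φ x := fun τ hτ => by
    obtain ⟨C, hK⟩ := rhoKernel_symA (N := N) hN hσ hτ
    have h1 := hK.integral_conv_mul hσ (hf.memRho (t - τ)) hgc.aestronglyMeasurable hD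
    simp only [integral_symA_mul_heatMul hN hσ hφ hc ha hτ] at h1
    exact h1
  rw [e1, setIntegral_congr_fun measurableSet_Ioi fun τ hτ => e2 τ hτ]
  have e3 : ∫ τ in Ioi (0:ℝ), ∫ x, f (x, t - τ) * heatMul σ (a + σ / 2) τ φ x =
      ∫ τ in Ioc 0 t, ∫ x, f (x, t - τ) * heatMul σ (a + σ / 2) τ φ x := by
    refine setIntegral_eq_of_subset_of_forall_sdiff_eq_zero measurableSet_Ioi
      Ioc_subset_Ioi_self fun τ hτ => ?_
    have h1 : t < τ := by
      by_contra h
      exact hτ.2 ⟨hτ.1, not_lt.1 h⟩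
    simp [fun x => hf.zero x (t - τ) (by linarith)]
  rw [e3, ← intervalIntegral.integral_of_le ht]
  have h2 := intervalIntegral.integral_comp_sub_left (a := 0) (b := t)
    (fun s => ∫ x, f (x, s) * heatMul σ (a + σ / 2) (t - s) φ x) t
  simpa only [sub_sub_cancel, sub_zero, sub_self] using h2

lemma measurable_pairing (hf : IsSource σ α c f) (hσ : 0 < σ) (hφ : ContDiff ℝ ∞ φ)
    (hc : HasCompactSupport φ) {a : ℝ} (ha : 0 ≤ a) :
    Measurable fun p : ℝ × ℝ => ∫ x, f (x, p.1) * heatMul σ a |p.2| φ x := by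
  have h1 : Measurable fun q : (ℝ × ℝ) × Space N => (q.2, q.1.1) := by fun_prop
  have h2 : Continuous fun q : (ℝ × ℝ) × Space N => (q.2, q.1.2) := by fun_prop
  have h3 := ((hf.measurable.comp h1).mul
    ((continuous_heatMul hφ hc hσ ha).comp h2).measurable).stronglyMeasurable
  exact (h3.integral_prod_right' (ν := volume)).measurable

lemma intervalIntegrable_pairing (hf : IsSource σ α c f) (hN : 1 ≤ N) (hσ : 0 < σ) (hα : 0 < α)
    (hc0 : 0 ≤ c) (hφ : ContDiff ℝ ∞ φ) (hc : HasCompactSupport φ) {t : ℝ} (ht : 0 ≤ t) :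
    IntervalIntegrable (fun s => ∫ x, f (x, s) * heatMul σ (σ / 2) 0 φ x) volume 0 t := by
  have g1 : GoodExp σ (σ / 2) := Or.inr le_rfl
  obtain ⟨M, hM0, hM⟩ := hf.exists_rhoNorm_le hσ hα hc0 t
  obtain ⟨C, hC0, hC⟩ := exists_abs_heatMul_le hN hσ hφ hc g1
  rw [intervalIntegrable_iff_integrableOn_Ioc_of_le ht]
  refine (integrable_const (C * M)).mono' ?_ ?_
  · have h2 := (hf.measurable_pairing hσ hφ hc (g1.nonneg hσ)).comp
      (measurable_id.prodMk (measurable_const (a := (0:ℝ))))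
    simp only [Function.comp_def, id, abs_zero] at h2
    exact h2.aestronglyMeasurable
  · filter_upwards [ae_restrict_mem measurableSet_Ioc] with s hs
    exact ((hf.memRho s).abs_integral_mul_le hC).trans
      (mul_le_mul_of_nonneg_left (hM s hs.2) hC0)

/-- The pairing of `srcEvol` at time `r` with `(-Δ)^{σ/2} φ` is an integral over `s < r` involving
the exponent `σ`. Exchanging the order, the integral in `r ∈ (s, t)` is computed by
`integral_mul_heatMul_sub`: it is the difference of the pairings with `(-Δ)^{σ/2} φ` and with its
evolution for time `t - s`. The latter reproduces the left side. -/
lemma integral_srcEvol_mul_test (hf : IsSource σ α c f) (hN : 1 ≤ N) (hσ : 0 < σ) (hα : 0 < α)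
    (hασ : α ≤ σ) (hc0 : 0 ≤ c) (hφ : ContDiff ℝ ∞ φ) (hc : HasCompactSupport φ) {t : ℝ}
    (ht : 0 ≤ t) :
    ∫ x, srcEvol σ f t x * φ x =
      (∫ s in (0:ℝ)..t, ∫ x, f (x, s) * heatMul σ (σ / 2) 0 φ x) -
        ∫ r in (0:ℝ)..t, ∫ x, srcEvol σ f r x * heatMul σ (σ / 2) 0 φ x := by
  have g0 : GoodExp σ 0 := Or.inl rfl
  have g1 : GoodExp σ (σ / 2) := Or.inr le_rfl
  have g2 : GoodExp σ (σ / 2 + σ / 2) := g1.add hσ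
  obtain ⟨M, hM0, hM⟩ := hf.exists_rhoNorm_le hσ hα hc0 t
  obtain ⟨C₁, hC₁0, hC₁⟩ := exists_abs_heatMul_le_uniform hN hσ hφ hc g1 t
  obtain ⟨C₂, hC₂0, hC₂⟩ := exists_abs_heatMul_le_uniform hN hσ hφ hc g2 t
  have h1 := hf.integral_srcEvol_mul hN hσ hα hασ hc0 hφ hc g0 ht
  simp only [heatMul_zero_zero hφ hc, zero_add] at h1
  set H : ℝ → ℝ → ℝ := fun s q => ∫ x, f (x, s) * heatMul σ (σ / 2 + σ / 2) |q| φ x with hH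
  have hHm : Measurable fun p : ℝ × ℝ => H p.1 p.2 := hf.measurable_pairing hσ hφ hc (g2.nonneg hσ)
  have hHb : ∀ s ≤ t, ∀ q, |q| ≤ t → |H s q| ≤ C₂ * M := fun s hs q hq =>
    ((hf.memRho s).abs_integral_mul_le (hC₂ _ (abs_nonneg q) hq)).trans
      (mul_le_mul_of_nonneg_left (hM s hs) hC₂0)
  -- The integrand on the triangle `s < r`, extended by zero to the square so that Fubini applies to
  -- fixed domains.
  set G : ℝ × ℝ → ℝ := {p : ℝ × ℝ | p.2 < p.1}.indicator fun p => H p.2 (p.1 - p.2) with hG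
  have hGm : Measurable G := by
    have h2 : Measurable fun p : ℝ × ℝ => (p.2, p.1 - p.2) := by fun_prop
    exact (hHm.comp h2).indicator (measurableSet_lt measurable_snd measurable_fst)
  have hGi : Integrable G ((volume.restrict (Ioc 0 t)).prod (volume.restrict (Ioc 0 t))) := by
    refine (integrable_const (C₂ * M)).mono' hGm.aestronglyMeasurable ?_
    have a1 : ∀ᵐ p ∂((volume.restrict (Ioc 0 t)).prod (volume.restrict (Ioc 0 t))),
        p.1 ∈ Ioc 0 t :=
      Measure.quasiMeasurePreserving_fst.ae (ae_restrict_mem measurableSet_Ioc)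
    have a2 : ∀ᵐ p ∂((volume.restrict (Ioc 0 t)).prod (volume.restrict (Ioc 0 t))),
        p.2 ∈ Ioc 0 t :=
      Measure.quasiMeasurePreserving_snd.ae (ae_restrict_mem measurableSet_Ioc)
    filter_upwards [a1, a2] with p h1 h2
    refine (norm_indicator_le_norm_self _ _).trans (hHb _ h2.2 _ ?_)
    rw [abs_le]
    constructor <;> linarith [h1.1, h1.2, h2.1, h2.2]
  have hY : ∀ r ∈ Ioc 0 t, ∫ x, srcEvol σ f r x * heatMul σ (σ / 2) 0 φ x =
      ∫ s in Ioc 0 t, G (r, s) := fun r hr => by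
    rw [hf.integral_srcEvol_mul hN hσ hα hασ hc0 hφ hc g1 hr.1.le,
      intervalIntegral.integral_of_le hr.1.le, integral_Ioc_eq_integral_Ioo]
    have e : (fun s => G (r, s)) = (Iio r).indicator fun s => H s (r - s) := by
      funext s
      simp only [hG, indicator, mem_ofPred_eq, mem_Iio]
    rw [e, setIntegral_indicator measurableSet_Iio]
    have e2 : Ioc 0 t ∩ Iio r = Ioo 0 r := by
      ext s
      simp only [mem_inter_iff, mem_Ioc, mem_Iio, mem_Ioo]
      constructor
      · rintro ⟨⟨h1, -⟩, h2⟩; exact ⟨h1, h2⟩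
      · rintro ⟨h1, h2⟩; exact ⟨⟨h1, h2.le.trans hr.2⟩, h2⟩
    rw [e2]
    refine setIntegral_congr_fun measurableSet_Ioo fun s hs => ?_
    simp only [hH, abs_of_pos (sub_pos.2 hs.2)]
  have hX : ∀ s ∈ Ioc 0 t, ∫ r in Ioc 0 t, G (r, s) =
      (∫ x, f (x, s) * heatMul σ (σ / 2) 0 φ x) -
        ∫ x, f (x, s) * heatMul σ (σ / 2) (t - s) φ x := fun s hs => by
    have e : (fun r => G (r, s)) = (Ioi s).indicator fun r => H s (r - s) := by
      funext r
      simp only [hG, indicator, mem_ofPred_eq, mem_Ioi]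
    rw [e, setIntegral_indicator measurableSet_Ioi]
    have e2 : Ioc 0 t ∩ Ioi s = Ioc s t := by
      ext r
      simp only [mem_inter_iff, mem_Ioc, mem_Ioi]
      constructor
      · rintro ⟨⟨-, h1⟩, h2⟩; exact ⟨h2, h1⟩
      · rintro ⟨h1, h2⟩; exact ⟨⟨hs.1.trans h1, h2⟩, h1⟩
    rw [e2, ← intervalIntegral.integral_of_le hs.2,
      intervalIntegral.integral_comp_sub_right (fun q => H s q) s, sub_self,
      integral_mul_heatMul_sub hN hσ hφ hc g1 (hf.memRho s) (sub_nonneg.2 hs.2)]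
    refine intervalIntegral.integral_congr fun q hq => ?_
    rw [uIcc_of_le (sub_nonneg.2 hs.2)] at hq
    simp only [hH, abs_of_nonneg hq.1]
  have hi1 : IntegrableOn (fun s => ∫ x, f (x, s) * heatMul σ (σ / 2) 0 φ x) (Ioc 0 t) :=
    (intervalIntegrable_iff_integrableOn_Ioc_of_le ht).1
      (hf.intervalIntegrable_pairing hN hσ hα hc0 hφ hc ht)
  have hi2 : IntegrableOn (fun s => ∫ x, f (x, s) * heatMul σ (σ / 2) (t - s) φ x) (Ioc 0 t) := by
    refine (integrable_const (C₁ * M)).mono' ?_ ?_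
    · have h2 := (hf.measurable_pairing hσ hφ hc (g1.nonneg hσ)).comp
        (measurable_id.prodMk ((measurable_const (a := t)).sub measurable_id))
      refine (h2.aestronglyMeasurable (μ := volume.restrict (Ioc 0 t))).congr ?_
      filter_upwards [ae_restrict_mem measurableSet_Ioc] with s hs
      simp only [Function.comp_def, Pi.sub_apply, id, abs_of_nonneg (sub_nonneg.2 hs.2)]
    · filter_upwards [ae_restrict_mem measurableSet_Ioc] with s hs
      exact ((hf.memRho s).abs_integral_mul_le (hC₁ (t - s) (by linarith [hs.2])
        (by linarith [hs.1]))).trans (mul_le_mul_of_nonneg_left (hM s hs.2) hC₁0)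
  have hdouble : ∫ r in (0:ℝ)..t, ∫ x, srcEvol σ f r x * heatMul σ (σ / 2) 0 φ x =
      (∫ s in (0:ℝ)..t, ∫ x, f (x, s) * heatMul σ (σ / 2) 0 φ x) -
        ∫ s in (0:ℝ)..t, ∫ x, f (x, s) * heatMul σ (σ / 2) (t - s) φ x := by
    simp only [intervalIntegral.integral_of_le ht]
    rw [setIntegral_congr_fun measurableSet_Ioc hY,
      integral_integral_swap (f := fun r s => G (r, s)) hGi,
      setIntegral_congr_fun measurableSet_Ioc hX, integral_sub hi1 hi2]
  rw [hdouble, h1, sub_sub_cancel]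

end IsSource
end weakEquation

/-! ### From the weak equation in space to space-time test functions -/

section spaceTime
variable {N : ℕ} {σ : ℝ} {ζ : Space N × ℝ → ℝ}

attribute [local irreducible] heatMul heatC

lemma exists_le_rho_spaceTime {Z : Space N × ℝ → ℝ} (hZ : Continuous Z)
    (hc : HasCompactSupport Z) : ∃ C : ℝ, 0 ≤ C ∧ ∀ t x, |Z (x, t)| ≤ C * rho σ x := by
  have h : Continuous fun p : Space N × ℝ => Z p / rho σ p.1 :=
    hZ.div (continuous_rho.comp continuous_fst) fun p => (rho_pos p.1).ne'
  obtain ⟨C, hC⟩ := h.bounded_above_of_compact_support (hc.mono fun x hx h0 => hx (by simp [h0]))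
  refine ⟨C, (norm_nonneg _).trans (hC 0), fun t x => ?_⟩
  have := hC (x, t)
  rwa [norm_div, Real.norm_eq_abs, Real.norm_of_nonneg (rho_nonneg x),
    div_le_iff₀ (rho_pos x)] at this

/-- The time derivative of a space-time function. -/
noncomputable def timeDeriv (ζ : Space N × ℝ → ℝ) (p : Space N × ℝ) : ℝ :=
  deriv (fun s => ζ (p.1, s)) p.2

lemma hasDerivAt_timeDeriv (hζ : ContDiff ℝ ∞ ζ) (x : Space N) (t : ℝ) :
    HasDerivAt (fun s => ζ (x, s)) (timeDeriv ζ (x, t)) t :=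
  ((hζ.comp (contDiff_const.prodMk contDiff_id)).differentiable (by simp) t).hasDerivAt

lemma timeDeriv_eq (hζ : ContDiff ℝ ∞ ζ) :
    timeDeriv ζ = fun p => fderiv ℝ ζ p ((0 : Space N), (1 : ℝ)) := by
  funext p
  have h1 := ((hζ.differentiable (by simp)) p).hasFDerivAt.comp_hasDerivAt p.2
    ((hasDerivAt_const p.2 p.1).prodMk (hasDerivAt_id p.2))
  exact h1.deriv

lemma continuous_timeDeriv (hζ : ContDiff ℝ ∞ ζ) : Continuous (timeDeriv ζ) := by
  rw [timeDeriv_eq hζ]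
  exact (hζ.continuous_fderiv (by simp)).clm_apply continuous_const

lemma hasCompactSupport_timeDeriv (hζ : ContDiff ℝ ∞ ζ) (hc : HasCompactSupport ζ) :
    HasCompactSupport (timeDeriv ζ) := by
  rw [timeDeriv_eq hζ]
  exact (hc.fderiv ℝ).comp_left (g := fun L : Space N × ℝ →L[ℝ] ℝ => L ((0 : Space N), (1 : ℝ))) rfl

/-- Continuity of the pairing with the slices of a compactly supported function. -/
lemma continuousAt_integral_mul_slice {Z : Space N × ℝ → ℝ} (hZ : Continuous Z)
    (hc : HasCompactSupport Z) {U : ℝ → Space N → ℝ} {v₀ : ℝ × ℝ}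
    (hU : ∀ᶠ s in 𝓝 v₀.1, MemRho σ (U s))
    (hlim : Tendsto (fun s => rhoNorm σ fun x => U s x - U v₀.1 x) (𝓝 v₀.1) (𝓝 0)) :
    ContinuousAt (fun v : ℝ × ℝ => ∫ x, U v.1 x * Z (x, v.2)) v₀ := by
  obtain ⟨C, -, hC⟩ := exists_le_rho_spaceTime (σ := σ) hZ hc
  have hfst : Tendsto (fun v : ℝ × ℝ => v.1) (𝓝 v₀) (𝓝 v₀.1) := continuous_fst.tendsto v₀
  refine tendsto_integral_mul (l := 𝓝 v₀) (U := fun v : ℝ × ℝ => U v.1)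
    (g := fun v x => Z (x, v.2)) (C := C) (hfst.eventually hU) hU.self_of_nhds (hlim.comp hfst)
    (.of_forall fun v => ?_) (.of_forall fun v => hC v.2) fun x => ?_
  · exact (hZ.comp (continuous_id.prodMk continuous_const)).aestronglyMeasurable
  · exact (hZ.comp (continuous_const.prodMk continuous_snd)).tendsto v₀

/-- Continuity of the pairing with the fractional Laplacian of the slices of a test function. -/
lemma continuousAt_integral_mul_fracLaplacian (hN : 1 ≤ N) (hσ : 0 < σ) (hζ : ContDiff ℝ ∞ ζ)
    (hc : HasCompactSupport ζ) {U : ℝ → Space N → ℝ} {v₀ : ℝ × ℝ}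
    (hU : ∀ᶠ s in 𝓝 v₀.1, MemRho σ (U s))
    (hlim : Tendsto (fun s => rhoNorm σ fun x => U s x - U v₀.1 x) (𝓝 v₀.1) (𝓝 0)) :
    ContinuousAt (fun v : ℝ × ℝ => ∫ x, U v.1 x * fracLaplacian σ (fun y => ζ (y, v.2)) x) v₀ := by
  have g1 : GoodExp σ (σ / 2) := Or.inr le_rfl
  obtain ⟨q, hq, hq0, hqb⟩ := exists_fracLaplacian_slice_bound hN hσ hζ hc
  obtain ⟨C, -, hC⟩ := exists_abs_heatMul_le hN hσ (contDiff_slice hζ v₀.2)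
    (hasCompactSupport_slice hc v₀.2) g1
  have hfst : Tendsto (fun v : ℝ × ℝ => v.1) (𝓝 v₀) (𝓝 v₀.1) := continuous_fst.tendsto v₀
  have hqt : Tendsto (fun v : ℝ × ℝ => q v₀.2 v.2) (𝓝 v₀) (𝓝 0) := by
    have := ((hq v₀.2).comp continuous_snd).tendsto v₀
    simpa only [Function.comp_def, hq0] using this
  refine tendsto_integral_mul (l := 𝓝 v₀) (U := fun v : ℝ × ℝ => U v.1)
    (g := fun v x => fracLaplacian σ (fun y => ζ (y, v.2)) x) (C := C + 1) (hfst.eventually hU)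
    hU.self_of_nhds (hlim.comp hfst) (.of_forall fun v => ?_) ?_ fun x => ?_
  · simp only [fracLaplacian_eq]
    exact (continuous_heatMul_of_nonneg (contDiff_slice hζ v.2) (hasCompactSupport_slice hc v.2) hσ
      (g1.nonneg hσ) le_rfl).aestronglyMeasurable
  · filter_upwards [hqt.eventually_lt_const one_pos] with v hv x
    have h1 := hqb v₀.2 v.2 x
    have h2 := hC x
    rw [← fracLaplacian_eq] at h2
    have h3 : q v₀.2 v.2 * rho σ x ≤ 1 * rho σ x :=
      mul_le_mul_of_nonneg_right hv.le (rho_nonneg x)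
    have h4 := abs_add_le (fracLaplacian σ (fun y => ζ (y, v.2)) x -
      fracLaplacian σ (fun y => ζ (y, v₀.2)) x) (fracLaplacian σ (fun y => ζ (y, v₀.2)) x)
    rw [sub_add_cancel] at h4
    linarith
  · refine tendsto_iff_norm_sub_tendsto_zero.2 ?_
    have h1 := hqt.mul_const (rho σ x)
    rw [zero_mul] at h1
    exact squeeze_zero (fun _ => norm_nonneg _) (fun v => hqb v₀.2 v.2 x) h1

/-- A curve in `L¹(ρ dx)` which solves the equation weakly in space solves it in the sense of
space-time distributions. -/
theorem weak_of_integral_mul_eq (hN : 1 ≤ N) (hσ : 0 < σ) {U F : ℝ → Space N → ℝ}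
    (hU : ∀ t, MemRho σ (U t)) (hF : ∀ t, MemRho σ (F t))
    (hUc : ∀ t, Tendsto (fun s => rhoNorm σ fun x => U s x - U t x) (𝓝 t) (𝓝 0))
    (hFc : ∀ t, 0 < t → Tendsto (fun s => rhoNorm σ fun x => F s x - F t x) (𝓝 t) (𝓝 0))
    (h : ∀ φ : Space N → ℝ, ContDiff ℝ ∞ φ → HasCompactSupport φ → ∀ t, 0 < t →
      HasDerivAt (fun s => ∫ x, U s x * φ x) (-∫ x, (U t x - F t x) * fracLaplacian σ φ x) t)
    (hζ : IsTestFunction ζ) :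
    ∫ t in Ioi (0:ℝ), ∫ x, U t x * deriv (fun s => ζ (x, s)) t =
      ∫ t in Ioi (0:ℝ), ∫ x, (U t x - F t x) * fracLaplacian σ (fun y => ζ (y, t)) x := by
  obtain ⟨hs, hc, hsupp⟩ := hζ
  have hVc : ∀ t, 0 < t → Tendsto (fun s => rhoNorm σ fun x => (U s x - F s x) - (U t x - F t x))
      (𝓝 t) (𝓝 0) := fun t ht => by
    have h1 := (hUc t).add (hFc t ht)
    rw [add_zero] at h1
    refine squeeze_zero (fun _ => rhoNorm_nonneg _) (fun s => ?_) h1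
    have e : (fun x => (U s x - F s x) - (U t x - F t x)) =
        fun x => (U s x - U t x) + (F t x - F s x) := by funext x; ring
    rw [e, rhoNorm_sub_comm (F s)]
    exact rhoNorm_add_le ((hU s).sub (hU t)) ((hF t).sub (hF s))
  -- Separate the time of the curve from that of the test function. The equation in space gives `∂_s
  -- B = -R`, differentiation of `ζ` gives `∂_τ B = P`, so `B(s, s)` has derivative `P - R`. It
  -- vanishes outside a compact subset of `(0, ∞)`, and integrating gives the claim.
  set B : ℝ → ℝ → ℝ := fun s τ => ∫ x, U s x * ζ (x, τ) with hB
  set P : ℝ → ℝ → ℝ := fun s τ => ∫ x, U s x * timeDeriv ζ (x, τ) with hP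
  set R : ℝ → ℝ → ℝ := fun s τ =>
    ∫ x, (U s x - F s x) * fracLaplacian σ (fun y => ζ (y, τ)) x with hR
  have hPc : ∀ v : ℝ × ℝ, ContinuousAt (fun v : ℝ × ℝ => P v.1 v.2) v := fun v =>
    continuousAt_integral_mul_slice (continuous_timeDeriv hs) (hasCompactSupport_timeDeriv hs hc)
      (.of_forall hU) (hUc v.1)
  have hRc : ∀ v : ℝ × ℝ, 0 < v.1 → ContinuousAt (fun v : ℝ × ℝ => R v.1 v.2) v := fun v hv =>
    continuousAt_integral_mul_fracLaplacian hN hσ hs hc (U := fun s x => U s x - F s x)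
      (.of_forall fun s => (hU s).sub (hF s)) (hVc v.1 hv)
  have hd1 : ∀ v : ℝ × ℝ, 0 < v.1 → HasDerivAt (fun r => B r v.2) (-R v.1 v.2) v.1 := fun v hv =>
    h _ (contDiff_slice hs v.2) (hasCompactSupport_slice hc v.2) v.1 hv
  obtain ⟨C, -, hC⟩ := exists_le_rho_spaceTime (σ := σ) hs.continuous hc
  obtain ⟨C', -, hC'⟩ := exists_le_rho_spaceTime (σ := σ) (continuous_timeDeriv hs)
    (hasCompactSupport_timeDeriv hs hc)
  have hm : ∀ {Z : Space N × ℝ → ℝ}, Continuous Z → ∀ τ, AEStronglyMeasurable fun x => Z (x, τ) :=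
    fun hZ τ => (hZ.comp (continuous_id.prodMk continuous_const)).aestronglyMeasurable
  have hd2 : ∀ v : ℝ × ℝ, HasDerivAt (fun r => B v.1 r) (P v.1 v.2) v.2 := fun v => by
    refine (hasDerivAt_integral_of_dominated_loc_of_deriv_le (Metric.ball_mem_nhds v.2 one_pos)
      (bound := fun x => C' * (|U v.1 x| * rho σ x))
      (.of_forall fun τ => (hU v.1).aestronglyMeasurable.mul (hm hs.continuous τ))
      ((hU v.1).mul_of_le (hm hs.continuous v.2) (hC v.2))
      ((hU v.1).aestronglyMeasurable.mul (hm (continuous_timeDeriv hs) v.2))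
      (.of_forall fun x τ _ => ?_) ((hU v.1).abs_mul.const_mul C')
      (.of_forall fun x τ _ => (hasDerivAt_timeDeriv hs x τ).const_mul _)).2
    rw [norm_mul, Real.norm_eq_abs, Real.norm_eq_abs, mul_left_comm]
    exact mul_le_mul_of_nonneg_left (hC' τ x) (abs_nonneg _)
  have hD : ∀ s, 0 < s → HasDerivAt (fun r => B r r) (P s s - R s s) s := fun s hs0 => by
    have hev : ∀ᶠ v : ℝ × ℝ in 𝓝 (s, id s), 0 < v.1 :=
      (continuous_fst.tendsto (s, id s)).eventually_const_lt hs0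
    have h1 := hasDerivAt_diag (B := B) (H₁ := fun a b => -R a b) (H₂ := P) (c := id) (c' := 1)
      (hev.mono fun v hv => hd1 v hv) (.of_forall hd2) (hRc _ hs0).neg (hPc _) (hasDerivAt_id s)
    exact h1.congr_deriv (by simp only [id]; ring)
  obtain ⟨a, ha0, b, hab⟩ : ∃ a, 0 < a ∧ ∃ b, ∀ p ∈ tsupport ζ, p.2 ∈ Icc a b := by
    have hK := hc.isCompact.image (continuous_snd (X := Space N) (Y := ℝ))
    rcases (Prod.snd '' tsupport ζ).eq_empty_or_nonempty with he | hne
    · refine ⟨1, one_pos, 1, fun p hp => ?_⟩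
      have : p.2 ∈ Prod.snd '' tsupport ζ := ⟨p, hp, rfl⟩
      rw [he] at this
      exact absurd this (notMem_empty _)
    · obtain ⟨a, ⟨p, hp, rfl⟩, ha'⟩ := hK.exists_isLeast hne
      obtain ⟨b, hb⟩ := hK.bddAbove
      exact ⟨p.2, hsupp hp, b, fun q hq => ⟨ha' ⟨q, hq, rfl⟩, hb ⟨q, hq, rfl⟩⟩⟩
  have hz : ∀ t, t ∉ Icc a b → ∀ x, ζ (x, t) = 0 := fun t ht x =>
    image_eq_zero_of_notMem_tsupport fun hp => ht (hab _ hp)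
  have hz' : ∀ t, t ∉ Icc a b → ∀ x, timeDeriv ζ (x, t) = 0 := fun t ht x => by
    rw [timeDeriv_eq hs]
    simp only
    have : (x, t) ∉ tsupport (fderiv ℝ ζ) := fun hp => ht (hab _ (tsupport_fderiv_subset ℝ hp))
    rw [image_eq_zero_of_notMem_tsupport this, zero_apply]
  have hB0 : ∀ t, t ∉ Icc a b → B t t = 0 := fun t ht => by simp [hB, hz t ht]
  have hP0 : ∀ t, t ∉ Icc a b → P t t = 0 := fun t ht => by simp [hP, hz' t ht]
  -- The fractional Laplacian is nonlocal in `x`, but it acts on single slices, and here the whole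
  -- slice is zero.
  have hR0 : ∀ t, t ∉ Icc a b → R t t = 0 := fun t ht => by
    have e : (fun y => ζ (y, t)) = fun y => 0 * ζ (y, t) := by
      funext y; rw [hz t ht y, mul_zero]
    have h1 : ∀ x, fracLaplacian σ (fun y => ζ (y, t)) x = 0 := fun x => by
      rw [e, fracLaplacian_eq, heatMul_const_mul, zero_mul]
    simp [hR, h1]
  -- The interval from `a / 2` to `b'` stays in the positive times, contains `[a, b]`, and has its
  -- end points outside it.
  set b' := max a b + 1 with hb'
  have hab' : a / 2 ≤ b' := by linarith [le_max_left a b]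
  have hred : ∀ g : ℝ → ℝ, (∀ t, t ∉ Icc a b → g t = 0) →
      ∫ t in Ioi (0:ℝ), g t = ∫ t in (a / 2)..b', g t := fun g hg => by
    rw [intervalIntegral.integral_of_le hab']
    refine setIntegral_eq_of_subset_of_forall_sdiff_eq_zero measurableSet_Ioi
      (fun t ht => (half_pos ha0).trans ht.1) fun t ht => hg t fun h' => ht.2 ⟨?_, ?_⟩
    · linarith [h'.1]
    · linarith [h'.2, le_max_right a b]
  have hpos : ∀ t ∈ uIcc (a / 2) b', 0 < t := fun t ht => by
    rw [uIcc_of_le hab'] at ht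
    linarith [ht.1]
  have hdiag : Continuous fun t : ℝ => (t, t) := continuous_id.prodMk continuous_id
  have iP : IntervalIntegrable (fun t => P t t) volume (a / 2) b' :=
    ContinuousOn.intervalIntegrable fun t _ =>
      (ContinuousAt.comp (f := fun t : ℝ => (t, t)) (hPc (t, t))
        hdiag.continuousAt).continuousWithinAt
  have iR : IntervalIntegrable (fun t => R t t) volume (a / 2) b' :=
    ContinuousOn.intervalIntegrable fun t ht =>
      (ContinuousAt.comp (f := fun t : ℝ => (t, t)) (hRc (t, t) (hpos t ht))
        hdiag.continuousAt).continuousWithinAt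
  have hFTC := intervalIntegral.integral_eq_sub_of_hasDerivAt (fun t ht => hD t (hpos t ht))
    (iP.sub iR)
  rw [intervalIntegral.integral_sub iP iR, hB0 b' fun h' => ?_, hB0 (a / 2) fun h' => ?_,
    sub_zero, sub_eq_zero] at hFTC
  · change ∫ t in Ioi (0:ℝ), P t t = ∫ t in Ioi (0:ℝ), R t t
    rw [hred _ hP0, hred _ hR0, hFTC]
  · linarith [h'.1]
  · linarith [h'.2, le_max_right a b]

end spaceTime

/-! ### Existence -/

section existence
variable {N : ℕ} {σ α c : ℝ} {f : Space N × ℝ → ℝ} {h : Space N → ℝ} {φ : Space N → ℝ}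

attribute [local irreducible] heatMul heatC

/-- The measure `ρ dx` is finite and bounded by Lebesgue measure, as `ρ ≤ 1`. The datum is used only
through this membership. -/
lemma memRho_of_memLp (hσ : 0 < σ) {p : ℝ≥0∞} (hp : 1 ≤ p) (hh : MemLp h p volume) :
    MemRho σ h := by
  have hle : rhoMeasure N σ ≤ volume := by
    have h1 : rhoMeasure N σ ≤ volume.withDensity 1 := by
      rw [rhoMeasure_eq]
      exact withDensity_mono (.of_forall fun x => ENNReal.ofReal_le_one.2 (rho_le_one hσ x))
    rwa [withDensity_one] at h1
  have : IsFiniteMeasure (rhoMeasure N σ) :=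
    isFiniteMeasure_withDensity_ofReal (integrable_rho hσ).hasFiniteIntegral
  exact integrable_rhoMeasure_iff.1 (memLp_one_iff_integrable.1
    ((hh.mono_measure hle).mono_exponent hp))

lemma continuousAt_integral_mul_heatMul (hN : 1 ≤ N) (hσ : 0 < σ) (hφ : ContDiff ℝ ∞ φ)
    (hc : HasCompactSupport φ) {a : ℝ} (ha : GoodExp σ a) {V : ℝ → Space N → ℝ}
    (hV : ∀ t, MemRho σ (V t)) {t : ℝ}
    (hVc : Tendsto (fun s => rhoNorm σ fun x => V s x - V t x) (𝓝 t) (𝓝 0)) :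
    ContinuousAt (fun s => ∫ x, V s x * heatMul σ a 0 φ x) t := by
  have h1 := tendsto_integral_mul_heatMul (l := 𝓝 t) (τ := fun _ => 0) (τ₀ := 0) hN hσ hφ hc ha
    (.of_forall hV) (hV t) hVc tendsto_const_nhds
  simp only [abs_zero] at h1
  exact h1

/-- The function given by Duhamel's formula. -/
noncomputable def duhamelEvol (σ : ℝ) (f : Space N × ℝ → ℝ) (h : Space N → ℝ) (t : ℝ)
    (x : Space N) : ℝ :=
  dataEvol σ h t x + srcEvol σ f t x

namespace IsSource

lemma memRho_duhamelEvol (hf : IsSource σ α c f) (hN : 1 ≤ N) (hσ : 0 < σ) (hα : 0 < α)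
    (hασ : α ≤ σ) (hc : 0 ≤ c) (hh : MemRho σ h) (t : ℝ) : MemRho σ (duhamelEvol σ f h t) := by
  obtain ⟨C, -, hC⟩ := exists_dataEvol_bound (N := N) hN hσ t
  exact (hC h hh t le_rfl).1.add (hf.memRho_srcEvol hN hσ hα hασ hc t)

lemma tendsto_duhamelEvol (hf : IsSource σ α c f) (hN : 1 ≤ N) (hσ : 0 < σ) (hα : 0 < α)
    (hασ : α ≤ σ) (hc : 0 ≤ c) (hh : MemRho σ h) (t : ℝ) :
    Tendsto (fun s => rhoNorm σ fun x => duhamelEvol σ f h s x - duhamelEvol σ f h t x) (𝓝 t)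
      (𝓝 0) := by
  have h1 := (tendsto_dataEvol hN hσ hh t).add (hf.tendsto_srcEvol hN hσ hα hασ hc t)
  rw [add_zero] at h1
  have hd : ∀ s, MemRho σ (dataEvol σ h s) := fun s => by
    obtain ⟨C, -, hC⟩ := exists_dataEvol_bound (N := N) hN hσ s
    exact (hC h hh s le_rfl).1
  have hs := hf.memRho_srcEvol hN hσ hα hασ hc
  refine squeeze_zero (fun _ => rhoNorm_nonneg _) (fun s => ?_) h1
  have e : (fun x => duhamelEvol σ f h s x - duhamelEvol σ f h t x) = fun x =>
      (dataEvol σ h s x - dataEvol σ h t x) + (srcEvol σ f s x - srcEvol σ f t x) := by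
    funext x; unfold duhamelEvol; ring
  rw [e]
  exact rhoNorm_add_le ((hd s).sub (hd t)) ((hs s).sub (hs t))

lemma duhamelEvol_zero (hf : IsSource σ α c f) : duhamelEvol σ f h 0 = h := by
  funext x
  rw [duhamelEvol, dataEvol_of_nonpos le_rfl, hf.srcEvol_of_nonpos le_rfl, add_zero]

lemma integral_duhamelEvol_mul_test (hf : IsSource σ α c f) (hN : 1 ≤ N) (hσ : 0 < σ)
    (hα : 0 < α) (hασ : α ≤ σ) (hc0 : 0 ≤ c) (hh : MemRho σ h) (hφ : ContDiff ℝ ∞ φ)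
    (hc : HasCompactSupport φ) {t : ℝ} (ht : 0 ≤ t) :
    ∫ x, duhamelEvol σ f h t x * φ x = (∫ x, h x * φ x) +
      (∫ s in (0:ℝ)..t, ∫ x, f (x, s) * heatMul σ (σ / 2) 0 φ x) -
        ∫ r in (0:ℝ)..t, ∫ x, duhamelEvol σ f h r x * heatMul σ (σ / 2) 0 φ x := by
  have g0 : GoodExp σ 0 := Or.inl rfl
  have g1 : GoodExp σ (σ / 2) := Or.inr le_rfl
  have hd : ∀ s, MemRho σ (dataEvol σ h s) := fun s => by
    obtain ⟨C, -, hC⟩ := exists_dataEvol_bound (N := N) hN hσ s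
    exact (hC h hh s le_rfl).1
  have hs := hf.memRho_srcEvol hN hσ hα hασ hc0
  have hadd : ∀ {a}, GoodExp σ a → ∀ r, ∫ x, duhamelEvol σ f h r x * heatMul σ a 0 φ x =
      (∫ x, dataEvol σ h r x * heatMul σ a 0 φ x) +
        ∫ x, srcEvol σ f r x * heatMul σ a 0 φ x := fun {a} ha r => by
    obtain ⟨C, -, hC⟩ := exists_abs_heatMul_le hN hσ hφ hc ha
    have hm := (continuous_heatMul_of_nonneg hφ hc hσ (ha.nonneg hσ)
      (le_refl (0:ℝ))).aestronglyMeasurable (μ := (volume : Measure (Space N)))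
    rw [← integral_add ((hd r).mul_of_le hm hC) ((hs r).mul_of_le hm hC)]
    simp only [duhamelEvol, add_mul]
  have hcont : ∀ {V : ℝ → Space N → ℝ}, (∀ t, MemRho σ (V t)) →
      (∀ t, Tendsto (fun s => rhoNorm σ fun x => V s x - V t x) (𝓝 t) (𝓝 0)) →
      Continuous fun s => ∫ x, V s x * heatMul σ (σ / 2) 0 φ x := fun {V} hV hVc =>
    continuous_iff_continuousAt.2 fun t =>
      continuousAt_integral_mul_heatMul hN hσ hφ hc g1 hV (hVc t)
  have h0 := hadd g0 t
  simp only [heatMul_zero_zero hφ hc] at h0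
  rw [h0, integral_dataEvol_mul_test hN hσ hφ hc hh ht,
    hf.integral_srcEvol_mul_test hN hσ hα hασ hc0 hφ hc ht]
  simp_rw [hadd g1]
  rw [intervalIntegral.integral_add
    ((hcont hd (tendsto_dataEvol hN hσ hh)).intervalIntegrable _ _)
    ((hcont hs (hf.tendsto_srcEvol hN hσ hα hασ hc0)).intervalIntegrable _ _)]
  ring

/-- Differentiation of the integrated equation. Positivity of `t` is needed for the source, whose
pairing with a fixed function need not be continuous at `0`. -/
lemma hasDerivAt_integral_duhamelEvol_mul (hf : IsSource σ α c f) (hN : 1 ≤ N) (hσ : 0 < σ)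
    (hα : 0 < α) (hασ : α ≤ σ) (hc0 : 0 ≤ c) (hh : MemRho σ h) (hφ : ContDiff ℝ ∞ φ)
    (hc : HasCompactSupport φ) {t : ℝ} (ht : 0 < t) :
    HasDerivAt (fun s => ∫ x, duhamelEvol σ f h s x * φ x)
      (-∫ x, (duhamelEvol σ f h t x - f (x, t)) * fracLaplacian σ φ x) t := by
  have g1 : GoodExp σ (σ / 2) := Or.inr le_rfl
  obtain ⟨C, -, hC⟩ := exists_abs_heatMul_le hN hσ hφ hc g1
  have hm := (continuous_heatMul_of_nonneg hφ hc hσ (g1.nonneg hσ)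
    (le_refl (0:ℝ))).aestronglyMeasurable (μ := (volume : Measure (Space N)))
  have hn : Continuous fun s => ∫ x, duhamelEvol σ f h s x * heatMul σ (σ / 2) 0 φ x :=
    continuous_iff_continuousAt.2 fun t =>
      continuousAt_integral_mul_heatMul hN hσ hφ hc g1
        (hf.memRho_duhamelEvol hN hσ hα hασ hc0 hh) (hf.tendsto_duhamelEvol hN hσ hα hασ hc0 hh t)
  have d1 := intervalIntegral.integral_hasDerivAt_right (hn.intervalIntegrable 0 t)
    (hn.stronglyMeasurableAtFilter _ _) hn.continuousAt
  have hpm : StronglyMeasurable fun s => ∫ x, f (x, s) * heatMul σ (σ / 2) 0 φ x := by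
    have h2 := (hf.measurable_pairing hσ hφ hc (g1.nonneg hσ)).comp
      (measurable_id.prodMk (measurable_const (a := (0:ℝ))))
    simp only [Function.comp_def, id, abs_zero] at h2
    exact h2.stronglyMeasurable
  have d2 := intervalIntegral.integral_hasDerivAt_right
    (hf.intervalIntegrable_pairing hN hσ hα hc0 hφ hc ht.le)
    hpm.stronglyMeasurableAtFilter (continuousAt_integral_mul_heatMul hN hσ hφ hc g1
      (V := fun s x => f (x, s)) hf.memRho (hf.tendsto_rhoNorm_sub hσ hα ht.ne'))
  have d3 := (d2.const_add (∫ x, h x * φ x)).sub d1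
  simp_rw [fracLaplacian_eq, sub_mul]
  rw [integral_sub ((hf.memRho_duhamelEvol hN hσ hα hασ hc0 hh t).mul_of_le hm hC)
    ((hf.memRho t).mul_of_le hm hC), neg_sub]
  refine d3.congr_of_eventuallyEq ?_
  filter_upwards [lt_mem_nhds ht] with s hs
  exact hf.integral_duhamelEvol_mul_test hN hσ hα hασ hc0 hh hφ hc hs.le

end IsSource

/-- Duhamel's formula defines a very weak solution. -/
theorem exists_isVeryWeakSolution (hN : 1 ≤ N) (hσ : 0 < σ) (hα : 0 < α) (hασ : α ≤ σ)
    (hc : 0 ≤ c) (hf : IsSource σ α c ((domainQ N).indicator f)) (hh : MemRho σ h) :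
    ∃ u : C(ℝ≥0, Lp ℝ 1 (rhoMeasure N σ)), IsVeryWeakSolution σ f h u ∧
      ∀ t : ℝ≥0, ∀ᵐ x : Space N, u t x = duhamelEvol σ ((domainQ N).indicator f) h t x := by
  have hU := hf.memRho_duhamelEvol hN hσ hα hασ hc hh
  have hUc := hf.tendsto_duhamelEvol hN hσ hα hασ hc hh
  have hcont : Continuous fun t : ℝ => (hU t).toLp :=
    continuous_iff_continuousAt.2 fun t => tendsto_iff_norm_sub_tendsto_zero.2 <| by
      simp_rw [MemRho.norm_toLp_sub]
      exact hUc t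
  have hae : ∀ t, ∀ᵐ x, (hU t).toLp x = _ := fun t => (hU t).coeFn_toLp
  refine ⟨⟨fun t => (hU t).toLp, hcont.comp NNReal.continuous_coe⟩, ⟨fun ζ hζ => ?_, ?_⟩,
    fun t => hae t⟩
  · have hw := weak_of_integral_mul_eq hN hσ hU hf.memRho hUc
      (fun t ht => hf.tendsto_rhoNorm_sub hσ hα ht.ne')
      (fun φ hφ hφc t ht => hf.hasDerivAt_integral_duhamelEvol_mul hN hσ hα hασ hc hh hφ hφc ht) hζ
    refine Eq.trans (setIntegral_congr_fun measurableSet_Ioi fun t ht => ?_)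
      (hw.trans (setIntegral_congr_fun measurableSet_Ioi fun t ht => ?_))
    · refine integral_congr_ae ?_
      filter_upwards [hae t] with x hx
      simp only [ContinuousMap.coe_mk, Real.coe_toNNReal t (le_of_lt ht), hx]
    · refine integral_congr_ae ?_
      filter_upwards [hae t] with x hx
      have : (domainQ N).indicator f (x, t) = f (x, t) :=
        indicator_of_mem (show (x, t) ∈ domainQ N from ht) f
      simp only [ContinuousMap.coe_mk, Real.coe_toNNReal t (le_of_lt ht), hx, this]
  · filter_upwards [hae 0] with x hx
    exact hx.trans (congrFun hf.duhamelEvol_zero x)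

end existence

/-! ### Separated test functions and uniqueness of very weak solutions. -/

section tensor
variable {N : ℕ} {σ α c : ℝ} {f : Space N × ℝ → ℝ} {h : Space N → ℝ} {φ : Space N → ℝ} {θ : ℝ → ℝ}

attribute [local irreducible] heatMul heatC

lemma isTestFunction_tensor (hφ : ContDiff ℝ ∞ φ) (hc : HasCompactSupport φ) (hθ : ContDiff ℝ ∞ θ)
    (hθc : HasCompactSupport θ) (hθs : tsupport θ ⊆ Ioi 0) :
    IsTestFunction fun p : Space N × ℝ => θ p.2 * φ p.1 := by
  have hsub : tsupport (fun p : Space N × ℝ => θ p.2 * φ p.1) ⊆ tsupport φ ×ˢ tsupport θ := by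
    refine closure_minimal (fun p hp => ?_) ((isClosed_tsupport φ).prod (isClosed_tsupport θ))
    exact ⟨subset_tsupport φ (right_ne_zero_of_mul hp), subset_tsupport θ (left_ne_zero_of_mul hp)⟩
  refine ⟨(hθ.comp contDiff_snd).mul (hφ.comp contDiff_fst), ?_, fun p hp => hθs (hsub hp).2⟩
  exact (hc.isCompact.prod hθc.isCompact).of_isClosed_subset (isClosed_tsupport _) hsub

/-- Testing with `θ(t) φ(x)` turns the equation into a distributional ordinary differential equation
for the pairing with `φ`, to which the lemma of du Bois-Reymond applies once the source has been
eliminated. -/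
lemma IsVeryWeakSolution.integral_deriv_mul {u : C(ℝ≥0, Lp ℝ 1 (rhoMeasure N σ))}
    (hu : IsVeryWeakSolution σ f h u) (hN : 1 ≤ N) (hσ : 0 < σ)
    (hf : IsSource σ α c ((domainQ N).indicator f)) (hφ : ContDiff ℝ ∞ φ)
    (hc : HasCompactSupport φ) (hθ : ContDiff ℝ ∞ θ) (hθc : HasCompactSupport θ)
    (hθs : tsupport θ ⊆ Ioi 0) :
    ∫ t, deriv θ t * ∫ x, u t.toNNReal x * φ x =
      ∫ t, θ t * ((∫ x, u t.toNNReal x * heatMul σ (σ / 2) 0 φ x) -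
        ∫ x, (domainQ N).indicator f (x, t) * heatMul σ (σ / 2) 0 φ x) := by
  have g1 : GoodExp σ (σ / 2) := Or.inr le_rfl
  obtain ⟨C, -, hC⟩ := exists_abs_heatMul_le hN hσ hφ hc g1
  have hm := (continuous_heatMul_of_nonneg hφ hc hσ (g1.nonneg hσ)
    (le_refl (0:ℝ))).aestronglyMeasurable (μ := (volume : Measure (Space N)))
  have hθ0 : ∀ t ∉ Ioi (0:ℝ), θ t = 0 := fun t ht =>
    image_eq_zero_of_notMem_tsupport fun h' => ht (hθs h')
  have hθ0' : ∀ t ∉ Ioi (0:ℝ), deriv θ t = 0 := fun t ht =>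
    image_eq_zero_of_notMem_tsupport fun h' => ht (hθs (tsupport_deriv_subset h'))
  have hw := hu.weak _ (isTestFunction_tensor hφ hc hθ hθc hθs)
  refine (setIntegral_eq_integral_of_forall_compl_eq_zero (s := Ioi (0:ℝ))
    fun t ht => by rw [hθ0' t ht, zero_mul]).symm.trans (Eq.trans ?_
      (setIntegral_eq_integral_of_forall_compl_eq_zero (s := Ioi (0:ℝ))
        fun t ht => by rw [hθ0 t ht, zero_mul]))
  refine Eq.trans (setIntegral_congr_fun measurableSet_Ioi fun t ht => ?_)
      (hw.trans (setIntegral_congr_fun measurableSet_Ioi fun t ht => ?_))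
  · simp only
    rw [← integral_const_mul]
    refine integral_congr_ae (.of_forall fun x => ?_)
    simp only [deriv_mul_const_field]
    ring
  · have e : ∀ x, (domainQ N).indicator f (x, t) = f (x, t) := fun x =>
      indicator_of_mem (show (x, t) ∈ domainQ N from ht) f
    simp only [fracLaplacian_eq, heatMul_const_mul]
    rw [← integral_sub ((memRho_coeFn _).mul_of_le hm hC) ((hf.memRho t).mul_of_le hm hC),
      ← integral_const_mul]
    refine integral_congr_ae (.of_forall fun x => ?_)
    simp only [e]
    ring

/-- The source cancels in the difference of two solutions, which then solves the homogeneous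
equation integrated in time, with zero datum. -/
theorem IsVeryWeakSolution.unique {u v : C(ℝ≥0, Lp ℝ 1 (rhoMeasure N σ))}
    (hu : IsVeryWeakSolution σ f h u) (hv : IsVeryWeakSolution σ f h v) (hN : 1 ≤ N) (hσ : 0 < σ)
    (hα : 0 < α) (hf : IsSource σ α c ((domainQ N).indicator f)) : u = v := by
  have h00 : u 0 = v 0 := by
    refine Lp.ext (ae_rhoMeasure_iff.2 ?_)
    filter_upwards [hu.initial, hv.initial] with x h1 h2
    rw [h1, h2]
  have hcu : ∀ w : C(ℝ≥0, Lp ℝ 1 (rhoMeasure N σ)), Continuous fun t : ℝ => w t.toNNReal :=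
    fun w => w.continuous.comp continuous_real_toNNReal
  have hw0 : u (0:ℝ).toNNReal - v (0:ℝ).toNNReal = 0 := by
    rw [Real.toNNReal_zero, h00, sub_self]
  have hpair : ∀ {φ : Space N → ℝ}, ContDiff ℝ ∞ φ → HasCompactSupport φ → ∀ {a : ℝ},
      GoodExp σ a → ∀ w : C(ℝ≥0, Lp ℝ 1 (rhoMeasure N σ)),
      Continuous fun t : ℝ => ∫ x, w t.toNNReal x * heatMul σ a 0 φ x :=
    fun hφ hc a ha w => continuous_iff_continuousAt.2 fun t =>
      continuousAt_integral_mul_heatMul hN hσ hφ hc ha (V := fun t => w t.toNNReal)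
        (fun t => memRho_coeFn _) (tendsto_rhoNorm_coeFn (hcu w).continuousAt)
  have hsub : ∀ {φ : Space N → ℝ}, ContDiff ℝ ∞ φ → HasCompactSupport φ → ∀ {a : ℝ},
      GoodExp σ a → ∀ t : ℝ,
      ∫ x, (u t.toNNReal - v t.toNNReal : Lp ℝ 1 (rhoMeasure N σ)) x * heatMul σ a 0 φ x =
        (∫ x, u t.toNNReal x * heatMul σ a 0 φ x) - ∫ x, v t.toNNReal x * heatMul σ a 0 φ x := by
    intro φ hφ hc a ha t
    obtain ⟨C, -, hC⟩ := exists_abs_heatMul_le hN hσ hφ hc ha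
    have hm := (continuous_heatMul_of_nonneg hφ hc hσ (ha.nonneg hσ)
      (le_refl (0:ℝ))).aestronglyMeasurable (μ := (volume : Measure (Space N)))
    rw [← integral_sub ((memRho_coeFn _).mul_of_le hm hC) ((memRho_coeFn _).mul_of_le hm hC)]
    refine integral_congr_ae ?_
    filter_upwards [ae_rhoMeasure_iff.1 (Lp.coeFn_sub (u t.toNNReal) (v t.toNNReal))] with x hx
    rw [hx, Pi.sub_apply, sub_mul]
  have key : ∀ φ : Space N → ℝ, ContDiff ℝ ∞ φ → HasCompactSupport φ → ∀ t : ℝ, 0 ≤ t →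
      ∫ x, (u t.toNNReal - v t.toNNReal : Lp ℝ 1 (rhoMeasure N σ)) x * φ x =
        -∫ s in (0:ℝ)..t, ∫ x, (u s.toNNReal - v s.toNNReal : Lp ℝ 1 (rhoMeasure N σ)) x *
          heatMul σ (σ / 2) 0 φ x := by
    intro φ hφ hc t ht
    have g0 : GoodExp σ 0 := Or.inl rfl
    have g1 : GoodExp σ (σ / 2) := Or.inr le_rfl
    have hs0 := hsub hφ hc g0
    have hp0 := hpair hφ hc g0
    have hp1 := hpair hφ hc g1
    simp only [heatMul_zero_zero hφ hc] at hs0 hp0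
    simp only [hs0, hsub hφ hc g1]
    suffices hθ : ∀ θ : ℝ → ℝ, ContDiff ℝ ∞ θ → HasCompactSupport θ → tsupport θ ⊆ Ioi 0 →
        ∫ t : ℝ, deriv θ t * ((∫ x, u t.toNNReal x * φ x) - ∫ x, v t.toNNReal x * φ x) =
          ∫ t : ℝ, θ t * ((∫ x, u t.toNNReal x * heatMul σ (σ / 2) 0 φ x) -
            ∫ x, v t.toNNReal x * heatMul σ (σ / 2) 0 φ x) by
      have h1 := eq_sub_integral_of_weak_deriv ((hp0 u).sub (hp0 v)) ((hp1 u).sub (hp1 v)) hθ ht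
      simp only [Pi.sub_apply, Real.toNNReal_zero, h00, sub_self, zero_sub] at h1
      exact h1
    intro θ hθ hθc hθs
    have i0 : ∀ w : C(ℝ≥0, Lp ℝ 1 (rhoMeasure N σ)),
        Integrable fun t : ℝ => deriv θ t * ∫ x, w t.toNNReal x * φ x := fun w =>
      ((hθ.continuous_deriv (by simp)).mul (hp0 w)).integrable_of_hasCompactSupport
        hθc.deriv.mul_right
    -- The pairing with the source may jump at `t = 0`, but `θ` vanishes near that point.
    have hF : Continuous fun t =>
        θ t * ∫ x, (domainQ N).indicator f (x, t) * heatMul σ (σ / 2) 0 φ x := by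
      refine continuous_iff_continuousAt.2 fun t => ?_
      rcases eq_or_ne t 0 with rfl | ht0
      · have h2 : (0:ℝ) ∉ tsupport θ := fun h' => lt_irrefl (0:ℝ) (hθs h')
        refine (continuousAt_const (y := (0:ℝ))).congr ?_
        filter_upwards [notMem_tsupport_iff_eventuallyEq.1 h2] with s hs
        rw [hs, Pi.zero_apply, zero_mul]
      · exact hθ.continuous.continuousAt.mul (continuousAt_integral_mul_heatMul hN hσ hφ hc g1
          (V := fun s x => (domainQ N).indicator f (x, s)) hf.memRho
          (hf.tendsto_rhoNorm_sub hσ hα ht0))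
    have i1 : ∀ w : C(ℝ≥0, Lp ℝ 1 (rhoMeasure N σ)), Integrable fun t : ℝ =>
        θ t * ((∫ x, w t.toNNReal x * heatMul σ (σ / 2) 0 φ x) -
          ∫ x, (domainQ N).indicator f (x, t) * heatMul σ (σ / 2) 0 φ x) := fun w => by
      simp only [mul_sub]
      exact ((hθ.continuous.mul (hp1 w)).integrable_of_hasCompactSupport hθc.mul_right).sub
        (hF.integrable_of_hasCompactSupport hθc.mul_right)
    have e1 := hu.integral_deriv_mul hN hσ hf hφ hc hθ hθc hθs
    have e2 := hv.integral_deriv_mul hN hσ hf hφ hc hθ hθc hθs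
    have e3 := congrArg₂ (· - ·) e1 e2
    rw [← integral_sub (i0 u) (i0 v), ← integral_sub (i1 u) (i1 v)] at e3
    calc _ = _ := by simp only [mul_sub]
      _ = _ := e3
      _ = _ := by
        refine integral_congr_ae (.of_forall fun t => ?_)
        simp only
        ring
  ext1 t
  rcases eq_or_lt_of_le (zero_le (a := t)) with rfl | ht
  · exact h00
  · have h1 := eq_zero_of_integral_mul_eq hN hσ
      (w := fun t => u t.toNNReal - v t.toNNReal) ((hcu u).sub (hcu v)) hw0 key
      (t := t) (NNReal.coe_pos.2 ht)
    simpa only [Real.toNNReal_coe, sub_eq_zero] using h1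

end tensor

/-! ### Duhamel's formula -/

section formula
variable {N : ℕ} {σ α c : ℝ} {f : Space N × ℝ → ℝ} {h : Space N → ℝ}

lemma integral_kernelA_mul (hN : 1 ≤ N) (hσ : 0 < σ) (x : Space N) {s t : ℝ} (hs : 0 < s)
    (hst : s < t) : ∫ y, kernelA σ (x - y) (t - s) * f (y, s) =
      srcConv σ ((domainQ N).indicator f) s (t - s) x := by
  have e : ∀ y, (domainQ N).indicator f (y, s) = f (y, s) := fun y =>
    indicator_of_mem (show (y, s) ∈ domainQ N from hs) f
  simp only [srcConv, e, kernelA_eq hN hσ _ (sub_pos.2 hst)]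

/-- The identification of `kernelA` with the radial kernel holds at positive times, so `s = t` is
discarded as a null set. -/
lemma ae_integral_kernelA_mul (hN : 1 ≤ N) (hσ : 0 < σ) (x : Space N) {t : ℝ} (ht : 0 < t) :
    ∀ᵐ s, s ∈ uIoc 0 t → ∫ y, kernelA σ (x - y) (t - s) * f (y, s) =
      srcConv σ ((domainQ N).indicator f) s (t - s) x := by
  filter_upwards [Measure.ae_ne volume t] with s hne hs
  rw [uIoc_of_le ht.le] at hs
  exact integral_kernelA_mul hN hσ x hs.1 (hs.2.lt_of_ne hne)

lemma IsSource.duhamel_eq (hf : IsSource σ α c ((domainQ N).indicator f)) (hN : 1 ≤ N)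
    (hσ : 0 < σ) (x : Space N) {t : ℝ} (ht : 0 < t) :
    duhamel σ f h x t = duhamelEvol σ ((domainQ N).indicator f) h t x := by
  rw [duhamel, duhamelEvol, dataEvol_of_pos ht,
    intervalIntegral.integral_congr_ae (ae_integral_kernelA_mul hN hσ x ht)]
  simp only [kernelP_eq]
  congr 1
  have h1 := intervalIntegral.integral_comp_sub_left (a := 0) (b := t)
    (fun s => srcConv σ ((domainQ N).indicator f) (t - s) s x) t
  simp only [sub_sub_cancel, sub_zero, sub_self] at h1
  rw [h1, intervalIntegral.integral_of_le ht.le, srcEvol]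
  refine (setIntegral_eq_of_subset_of_forall_sdiff_eq_zero measurableSet_Ioi
    Ioc_subset_Ioi_self fun τ hτ => hf.srcConv_zero ?_ τ x).symm
  by_contra h'
  exact hτ.2 ⟨hτ.1, by linarith⟩

lemma IsSource.duhamelWellDefined (hf : IsSource σ α c ((domainQ N).indicator f)) (hN : 1 ≤ N)
    (hσ : 0 < σ) (hα : 0 < α) (hασ : α ≤ σ) (hc : 0 ≤ c) (hh : MemRho σ h) (x : Space N) {t : ℝ}
    (ht : 0 < t) : DuhamelWellDefined σ f h x t where
  data := by
    obtain ⟨C, hK⟩ := rhoKernel_symP (N := N) hN hσ t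
    simp only [kernelP_eq]
    exact (hK t ht le_rfl).integrable_mul hσ hh x
  source_space s hs := by
    obtain ⟨C, hK⟩ := rhoKernel_symA (N := N) hN hσ (sub_pos.2 hs.2)
    have e : ∀ y, (domainQ N).indicator f (y, s) = f (y, s) := fun y =>
      indicator_of_mem (show (y, s) ∈ domainQ N from hs.1) f
    have h1 := hK.integrable_mul hσ (hf.memRho s) x
    simpa only [e, kernelA_eq hN hσ _ (sub_pos.2 hs.2)] using h1
  source_time := by
    have h1 : IntervalIntegrable
        (fun τ => srcConv σ ((domainQ N).indicator f) (t - τ) τ x) volume 0 t := by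
      rw [intervalIntegrable_iff_integrableOn_Ioc_of_le ht.le]
      exact IntegrableOn.mono_set (hf.integrableOn_srcConv hN hσ hα hασ hc t x)
        Ioc_subset_Ioi_self
    have h2 := (h1.comp_sub_left t).symm
    simp only [sub_sub_cancel, sub_zero, sub_self] at h2
    refine h2.congr_ae ?_
    rw [EventuallyEq, ae_restrict_iff' measurableSet_uIoc]
    filter_upwards [ae_integral_kernelA_mul (f := f) hN hσ x ht] with s hs hs'
    exact (hs hs').symm

end formula

end FractionalHeat

theorem mainTheorem6 (N : ℕ) (hN : 1 ≤ N) (σ : ℝ) (hσ : 0 < σ) (hσ2 : σ < 2)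
    (α : ℝ) (hα : 0 < α) (hα' : α ≤ min 1 σ)
    (f : Space N × ℝ → ℝ) (hfL : MemLinftyLocL1Rho σ f) (hfC : IsSigmaHolder σ α f)
    (p : ℝ≥0∞) (hp : 1 ≤ p) (u₀ : Space N → ℝ) (hu₀ : MemLp u₀ p volume) :
    (∃! u : C(ℝ≥0, Lp ℝ 1 (rhoMeasure N σ)), IsVeryWeakSolution σ f u₀ u) ∧
      (∀ (x : Space N) (t : ℝ), 0 < t → DuhamelWellDefined σ f u₀ x t) ∧
      ∀ u : C(ℝ≥0, Lp ℝ 1 (rhoMeasure N σ)), IsVeryWeakSolution σ f u₀ u →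
        ∀ t : ℝ≥0, 0 < t → ∀ᵐ x : Space N, u t x = duhamel σ f u₀ x t := by
  have hασ : α ≤ σ := hα'.trans (min_le_right _ _)
  -- From here on `f` enters through its extension by zero to nonpositive times; the equation and
  -- Duhamel's formula at positive times do not see the difference.
  obtain ⟨c, hc, hf⟩ := exists_isSource_indicator hσ hα hfL hfC
  have hh := memRho_of_memLp hσ hp hu₀
  obtain ⟨u, hu, hu'⟩ := exists_isVeryWeakSolution hN hσ hα hασ hc hf hh
  refine ⟨⟨u, hu, fun v hv => hv.unique hu hN hσ hα hf⟩,
    fun x t ht => hf.duhamelWellDefined hN hσ hα hασ hc hh x ht, fun v hv t ht => ?_⟩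
  rw [hv.unique hu hN hσ hα hf]
  filter_upwards [hu' t] with x hx
  rw [hx, hf.duhamel_eq hN hσ x (NNReal.coe_pos.2 ht)]
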